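/- **Setting.** Let $\mathcal V$ be a commutative unital quantale (a complete lattice with a commutative monoid structure $(\otimes,k)$ whose multiplication preserves arbitrary joins) that is integral ($k=\top$). For $x,y\in\mathcal V$ write $y\ll x$ ($y$ is way-below $x$) if whenever $x\le\bigvee X$ there is a finite $A\subseteq X$ with $y\le\bigvee A$. Let $B\subseteq\mathcal V$ be a basis of $\mathcal V$ (for each $x$ the set $B\cap\{y\mid y\ll x\}$ is directed with least upper bound $x$; so $\mathcal V$ is continuous) that is closed under finite joins and $\otimes$ and contains $k$. **Calculus.** Fix a class $G$ of ground types and a class $\Sigma$ of operation symbols $f:A_1,\dots,A_n\to A$ ($n\ge1$), where types are generated by $A::=X\in G\mid I\mid A\otimes A\mid A\multimap A$. Contexts are lists of typed, pairwise distinct variables. The judgements $\Gamma\rhd v:A$ of the linear $\lambda$-calculus are generated by $x:A\rhd x:A$ and $-\rhd *:I$; by the rules that form $f(v_1,\dots,v_n)$ from $\Gamma_i\rhd v_i:A_i$, $v\otimes w:A\otimes B$ from $\Gamma\rhd v:A$ and $\Delta\rhd w:B$, $v\ \mathrm{to}\ *.\,w:A$ from $\Gamma\rhd v:I$ and $\Delta\rhd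 w:A$, $\mathrm{pm}\ v\ \mathrm{to}\ x\otimes y.\,w:C$ from $\Gamma\rhd v:A\otimes B$ and $\Delta,x:A,y:B\rhd w:C$, and $v\,w:B$ from $\Gamma\rhd v:A\multimap B$ and $\Delta\rhd w:A$, the context of the conclusion being any shuffle of the contexts $\Gamma_1,\dots,\Gamma_n$ (respectively $\Gamma,\Delta$); and by $\Gamma\rhd\lambda x:A.\,v:A\multimap B$ from $\Gamma,x:A\rhd v:B$. A $\mathcal V$-equation-in-context $\Gamma\rhd v=_q w:A$ consists of $\Gamma\rhd v:A$, $\Gamma\rhd w:A$ and a label $q\in B$. A linear $\mathcal V\lambda$-theory $\mathscr T$ is given by $(G,\Sigma)$ and a class $Ax$ of $\mathcal V$-equations-in-context. Its *theorems without the rule (arch)* form the smallest class of $\mathcal V$-equations-in-context that contains $Ax$; contains, with label $\top$ and in both directions, the equations $$\mathrm{pm}\ v\otimes w\ \mathrm{to}\ x\otimes y.\,u=u[v/x,w/y],\quad \mathrm{pm}\ v\ \mathrm{to}\ x\otimes y.\,u[x\otimes y/z]=u[v/z],\quad *\ \mathrm{to}\ *.\,v=v,\quad v\ \mathrm{to}\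 *.\,w[*/z]=w[v/z],$$ $$(\lambda x:A.\,v)\,w=v[w/x],\quad \lambda x:A.\,(v\,x)=v,$$ $$u[v\ \mathrm{to}\ *.\,w/z]=v\ \mathrm{to}\ *.\,u[w/z],\quad u[\mathrm{pm}\ v\ \mathrm{to}\ x\otimes y.\,w/z]=\mathrm{pm}\ v\ \mathrm{to}\ x\otimes y.\,u[w/z];$$ and is closed under: $v=_\top v$; from $v=_qw$ and $w=_ru$ infer $v=_{q\otimes r}u$; from $v=_qw$ and $r\le q$ ($r\in B$) infer $v=_rw$; from $v=_{q_i}w$ for all $i\le n$ ($n\ge 0$) infer $v=_{\bigvee q_i}w$; compatibility with each term former, the label of the conclusion being the product of the labels of the premisses; permutation of the context; and substitution: from $\Gamma,x:A\rhd v=_qw:A'$ and $\Delta\rhd v'=_rw':A$ infer $\Gamma,\Delta\rhd v[v'/x]=_{q\otimes r}w[w'/x]:A'$. (The omitted rule (arch) would infer $v=_qw$ from $v=_rw$ for all $r\ll q$.) **Models.** A $\mathcal V$-category is a set (or class) $X$ with $a:X\times X\to\mathcal V$ such that $k\le a(x,x)$ and $a(x,y)\otimes a(y,z)\le a(x,z)$;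 it is separated if $k\le a(x,y)$ and $k\le a(y,x)$ imply $x=y$; a map $f:(X,a)\to(Y,b)$ is a $\mathcal V$-functor if $a(x,y)\le b(f(x),f(y))$. A $\mathcal V\text{-}\mathsf{Cat}_{\mathsf{sep}}$-enriched autonomous category is a locally small symmetric monoidal closed category whose hom-sets are separated $\mathcal V$-categories, such that composition and $\otimes$ on morphisms are $\mathcal V$-functors (products of hom-sets carrying $(a\otimes b)((x,y),(x',y'))=a(x,x')\otimes b(y,y')$) and the currying bijections $C(X\otimes Y,Z)\cong C(X,Y\multimap Z)$ are isomorphisms of $\mathcal V$-categories. An interpretation of $(G,\Sigma)$ in it assigns to ground types objects, and to operation symbols $f:A_1,\dots,A_n\to A$ morphisms $[\![A_1]\!]\otimes\dots\otimes[\![A_n]\!]\to[\![A]\!]$; judgements $\Gamma\rhd v:A$ are then interpreted as morphisms $[\![\Gamma]\!]\to[\![A]\!]$ in the usual way. It satisfies $\Gamma\rhd v=_qw:A$ if $q\le a([\![\Gamma\rhd v:A]\!],[\![\Gamma\rhd w:A]\!])$, and is a model of $\mathscr T$ if it satisfies all of $Ax$. The theory $\mathscr T$ is *varietal* if for all types $A,A'$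 the separated quotient (identifying $v,w$ with $a(v,w)=a(w,v)=\top$) of the $\mathcal V$-category of terms $x:A\rhd v:A'$, with $a(v,w)=\bigvee\{q\mid v=_qw\text{ is a theorem}\}$, is small. **Theorem (Approximate completeness).** Let $\mathscr T$ be a varietal linear $\mathcal V\lambda$-theory, where "theorem" refers to the system without (arch). If a $\mathcal V$-equation-in-context $\Gamma\rhd v=_qw:A$ holds in all models of $\mathscr T$, then for every $r\in B$ with $r\ll q$ the equation $\Gamma\rhd v=_rw:A$ is a theorem of $\mathscr T$. In particular, if $q$ is compact ($q\ll q$), then $\Gamma\rhd v=_qw:A$ is a theorem of $\mathscr T$. -/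

import Mathlib

open CategoryTheory MonoidalCategory

universe u w v x

namespace VLam

/-! ## Way-below relation and bases of a quantale -/

/-- `WayBelow y x`: whenever `x ≤ ⋁ X`, there is a finite `A ⊆ X` with `y ≤ ⋁ A`. -/
def WayBelow {L : Type x} [CompleteLattice L] (y x : L) : Prop :=
  ∀ X : Set L, x ≤ sSup X → ∃ A : Set L, A ⊆ X ∧ A.Finite ∧ y ≤ sSup A

/-- A basis of a complete lattice: for every `x`, the elements of `B` way-below `x` form a
directed (in particular non-empty) set with least upper bound `x`.
A complete lattice that has a basis is automatically continuous. -/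
structure IsBasis {L : Type x} [CompleteLattice L] (B : Set L) : Prop where
  nonempty : ∀ x : L, (B ∩ {y | WayBelow y x}).Nonempty
  directed : ∀ x : L, DirectedOn (· ≤ ·) (B ∩ {y | WayBelow y x})
  isLUB : ∀ x : L, IsLUB (B ∩ {y | WayBelow y x}) x

/-- The standing assumption on the set of labels: a basis that is closed under finite joins
(the empty one included) and under multiplication, and contains the unit. -/
structure IsLabelBasis {V : Type x} [CommMonoid V] [CompleteLattice V] (B : Set V) : Prop where
  isBasis : IsBasis B
  bot_mem : ⊥ ∈ B
  sup_mem : ∀ q ∈ B, ∀ r ∈ B, q ⊔ r ∈ B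
  mul_mem : ∀ q ∈ B, ∀ r ∈ B, q * r ∈ B
  one_mem : 1 ∈ B

/-! ## Types, terms and contexts of the linear lambda calculus -/

/-- Types over a collection `G` of ground types. -/
inductive Ty (G : Type u) : Type u
  | base (X : G) : Ty G
  | unit : Ty G
  | tensor (A B : Ty G) : Ty G
  | lolli (A B : Ty G) : Ty G

/-- Ground types and sorted operation symbols `f : A₁, …, Aₙ → A` with `n ≥ 1`. -/
structure Signature where
  Ground : Type u
  Op : Type w
  arity : Op → ℕ
  arity_pos : ∀ f, 0 < arity f
  dom : (f : Op) → Fin (arity f) → Ty Ground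
  cod : Op → Ty Ground

/-- Terms up to renaming of bound variables (de Bruijn representation). The free variables are
natural numbers. `lam A v` binds the variable `0` of `v`; `pm v w`, which stands for
`pm v to x ⊗ y. w`, binds in `w` the variables `1` (for `x`) and `0` (for `y`). Under a
binder of `k` variables the free variable `n` is called `n + k`. -/
inductive Tm (S : Signature.{u, w}) : Type (max u w)
  | var (n : ℕ) : Tm S
  | op (f : S.Op) (args : Fin (S.arity f) → Tm S) : Tm S
  | star : Tm S
  /-- `v to ∗. w` -/
  | unitE (v w : Tm S) : Tm S
  | tens (v w : Tm S) : Tm S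
  | pm (v w : Tm S) : Tm S
  | lam (A : Ty S.Ground) (v : Tm S) : Tm S
  | app (v w : Tm S) : Tm S

/-- Extension of a renaming under a binder. -/
def upRen (ρ : ℕ → ℕ) : ℕ → ℕ
  | 0 => 0
  | n + 1 => ρ n + 1

namespace Tm

variable {S : Signature.{u, w}}

/-- Renaming of free variables. -/
def rename : (ℕ → ℕ) → Tm S → Tm S
  | ρ, var n => var (ρ n)
  | ρ, op f args => op f (fun i => rename ρ (args i))
  | _, star => star
  | ρ, unitE v w => unitE (rename ρ v) (rename ρ w)
  | ρ, tens v w => tens (rename ρ v) (rename ρ w)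
  | ρ, pm v w => pm (rename ρ v) (rename (upRen (upRen ρ)) w)
  | ρ, lam A v => lam A (rename (upRen ρ) v)
  | ρ, app v w => app (rename ρ v) (rename ρ w)

/-- Extension of a substitution under a binder. -/
def up (σ : ℕ → Tm S) : ℕ → Tm S
  | 0 => var 0
  | n + 1 => rename Nat.succ (σ n)

/-- Capture-avoiding simultaneous substitution. -/
def subst : (ℕ → Tm S) → Tm S → Tm S
  | σ, var n => σ n
  | σ, op f args => op f (fun i => subst σ (args i))
  | _, star => star
  | σ, unitE v w => unitE (subst σ v) (subst σ w)
  | σ, tens v w => tens (subst σ v) (subst σ w)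
  | σ, pm v w => pm (subst σ v) (subst (up (up σ)) w)
  | σ, lam A v => lam A (subst (up σ) v)
  | σ, app v w => app (subst σ v) (subst σ w)

/-- `v[t/z]` for a free variable `z`. -/
def sub (v : Tm S) (z : ℕ) (t : Tm S) : Tm S :=
  subst (fun n => if n = z then t else var n) v

/-- `u[t/z]` where the result is placed under a binder of two variables (a `pm`), whose bound
variables may occur in `t`. -/
def subUnder₂ (u : Tm S) (z : ℕ) (t : Tm S) : Tm S :=
  subst (fun n => if n = z then t else var (n + 2)) u

/-- `v[t/x]` for the variable `x` bound by a `lam` around `v`. -/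
def inst₁ (v t : Tm S) : Tm S :=
  subst (fun n => match n with
    | 0 => t
    | n + 1 => var n) v

/-- `u[s/x, t/y]` for the variables `x`, `y` bound by a `pm` around `u`. -/
def inst₂ (u s t : Tm S) : Tm S :=
  subst (fun n => match n with
    | 0 => t
    | 1 => s
    | n + 2 => var n) u

end Tm

/-- Lists of typed variables, written from right to left: `(x, A) :: Γ` is `Γ, x : A`, and
`Δ ++ Γ` is the concatenation `Γ, Δ`. -/
abbrev Ctx (S : Signature.{u, w}) : Type u := List (ℕ × Ty S.Ground)

namespace Ctx

variable {S : Signature.{u, w}}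

/-- Each variable occurs at most once. -/
def Valid (Γ : Ctx S) : Prop := (Γ.map Prod.fst).Nodup

/-- The same context, seen from under a binder of `k` variables. -/
def shift (k : ℕ) (Γ : Ctx S) : Ctx S := Γ.map fun p => (p.1 + k, p.2)

end Ctx

/-- `Shuffle Γ Δ E`: `E` is a shuffle of `Γ` and `Δ`, that is `E ∈ Sf(Γ; Δ)`. -/
inductive Shuffle {S : Signature.{u, w}} : Ctx S → Ctx S → Ctx S → Type u
  | nil : Shuffle [] [] []
  | left (p : ℕ × Ty S.Ground) {Γ Δ E : Ctx S} :
      Shuffle Γ Δ E → Shuffle (p :: Γ) Δ (p :: E)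
  | right (p : ℕ × Ty S.Ground) {Γ Δ E : Ctx S} :
      Shuffle Γ Δ E → Shuffle Γ (p :: Δ) (p :: E)

/-- `E ∈ Sf(Γ₁; …; Γₙ)`, where a shuffle of `n + 2` contexts is a shuffle of (a shuffle of the
first `n + 1` ones) and the last one. -/
inductive ShuffleN {S : Signature.{u, w}} : {n : ℕ} → (Fin n → Ctx S) → Ctx S → Type u
  | nil (Γs : Fin 0 → Ctx S) : ShuffleN Γs []
  | one (Γs : Fin 1 → Ctx S) : ShuffleN Γs (Γs 0)
  | snoc {n : ℕ} (Γs : Fin (n + 2) → Ctx S) {E' E : Ctx S} :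
      ShuffleN (fun i : Fin (n + 1) => Γs i.castSucc) E' →
      Shuffle E' (Γs (Fin.last (n + 1))) E → ShuffleN Γs E

/-- Derivations of the judgement `Γ ▷ v : A`. -/
inductive Der {S : Signature.{u, w}} : Ctx S → Tm S → Ty S.Ground → Type (max u w)
  | hyp (n : ℕ) (A : Ty S.Ground) : Der [(n, A)] (.var n) A
  | op (f : S.Op) (Γs : Fin (S.arity f) → Ctx S) (vs : Fin (S.arity f) → Tm S) {E : Ctx S} :
      (∀ i, Der (Γs i) (vs i) (S.dom f i)) → ShuffleN Γs E → E.Valid →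
      Der E (.op f vs) (S.cod f)
  | unitI : Der [] .star .unit
  | unitE {Γ Δ E : Ctx S} {v t : Tm S} {A : Ty S.Ground} :
      Der Γ v .unit → Der Δ t A → Shuffle Γ Δ E → E.Valid → Der E (.unitE v t) A
  | tensI {Γ Δ E : Ctx S} {v t : Tm S} {A B : Ty S.Ground} :
      Der Γ v A → Der Δ t B → Shuffle Γ Δ E → E.Valid → Der E (.tens v t) (.tensor A B)
  | tensE {Γ Δ E : Ctx S} {v t : Tm S} {A B C : Ty S.Ground} :
      Der Γ v (.tensor A B) → Der ((0, B) :: (1, A) :: Δ.shift 2) t C →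
      Shuffle Γ Δ E → E.Valid → Der E (.pm v t) C
  | lolliI {Γ : Ctx S} {v : Tm S} {A B : Ty S.Ground} :
      Der ((0, A) :: Γ.shift 1) v B → Der Γ (.lam A v) (.lolli A B)
  | lolliE {Γ Δ E : Ctx S} {v t : Tm S} {A B : Ty S.Ground} :
      Der Γ v (.lolli A B) → Der Δ t A → Shuffle Γ Δ E → E.Valid → Der E (.app v t) B

/-- `Γ ▷ v : A` is derivable. -/
def Typed {S : Signature.{u, w}} (Γ : Ctx S) (v : Tm S) (A : Ty S.Ground) : Prop :=
  Nonempty (Der Γ v A)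

/-! ## Equations, theories and theorems -/

/-- The equations-in-context of the linear lambda calculus that correspond to the axioms of
autonomous categories. They are stated in the concatenation of the contexts of the
subterms; all other contexts are reached by the exchange rule of `Thm`. -/
inductive BaseEq {S : Signature.{u, w}} : Ctx S → Tm S → Tm S → Ty S.Ground → Prop
  /-- `pm v ⊗ t to x ⊗ y. s = s[v/x, t/y]` -/
  | tens_beta {Γ Δ Θ : Ctx S} {v t s : Tm S} {A B C : Ty S.Ground} :
      Typed Γ v A → Typed Δ t B → Typed ((0, B) :: (1, A) :: Θ.shift 2) s C →
      Ctx.Valid (Θ ++ Δ ++ Γ) →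
      BaseEq (Θ ++ Δ ++ Γ) (.pm (.tens v t) s) (s.inst₂ v t) C
  /-- `pm v to x ⊗ y. s[x ⊗ y/z] = s[v/z]` -/
  | tens_eta {Γ Θ : Ctx S} {v s : Tm S} {z : ℕ} {A B C : Ty S.Ground} :
      Typed Γ v (.tensor A B) → Typed ((z, .tensor A B) :: Θ) s C → Ctx.Valid (Θ ++ Γ) →
      BaseEq (Θ ++ Γ) (.pm v (s.subUnder₂ z (.tens (.var 1) (.var 0)))) (s.sub z v) C
  /-- `∗ to ∗. v = v` -/
  | unit_beta {Γ : Ctx S} {v : Tm S} {A : Ty S.Ground} :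
      Typed Γ v A → BaseEq Γ (.unitE .star v) v A
  /-- `v to ∗. s[∗/z] = s[v/z]` -/
  | unit_eta {Γ Θ : Ctx S} {v s : Tm S} {z : ℕ} {C : Ty S.Ground} :
      Typed Γ v .unit → Typed ((z, .unit) :: Θ) s C → Ctx.Valid (Θ ++ Γ) →
      BaseEq (Θ ++ Γ) (.unitE v (s.sub z .star)) (s.sub z v) C
  /-- `(λ x : A. v) t = v[t/x]` -/
  | lolli_beta {Γ Δ : Ctx S} {v t : Tm S} {A B : Ty S.Ground} :
      Typed ((0, A) :: Γ.shift 1) v B → Typed Δ t A → Ctx.Valid (Δ ++ Γ) →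
      BaseEq (Δ ++ Γ) (.app (.lam A v) t) (v.inst₁ t) B
  /-- `λ x : A. (v x) = v` -/
  | lolli_eta {Γ : Ctx S} {v : Tm S} {A B : Ty S.Ground} :
      Typed Γ v (.lolli A B) →
      BaseEq Γ (.lam A (.app (v.rename Nat.succ) (.var 0))) v (.lolli A B)
  /-- `s[v to ∗. t/z] = v to ∗. s[t/z]` -/
  | unit_comm {Γ Δ Θ : Ctx S} {v t s : Tm S} {z : ℕ} {A C : Ty S.Ground} :
      Typed Γ v .unit → Typed Δ t A → Typed ((z, A) :: Θ) s C →
      Ctx.Valid (Θ ++ Δ ++ Γ) →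
      BaseEq (Θ ++ Δ ++ Γ) (s.sub z (.unitE v t)) (.unitE v (s.sub z t)) C
  /-- `s[pm v to x ⊗ y. t/z] = pm v to x ⊗ y. s[t/z]` -/
  | tens_comm {Γ Δ Θ : Ctx S} {v t s : Tm S} {z : ℕ} {A B D C : Ty S.Ground} :
      Typed Γ v (.tensor A B) → Typed ((0, B) :: (1, A) :: Δ.shift 2) t D →
      Typed ((z, D) :: Θ) s C → Ctx.Valid (Θ ++ Δ ++ Γ) →
      BaseEq (Θ ++ Δ ++ Γ) (s.sub z (.pm v t)) (.pm v (s.subUnder₂ z t)) C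

/-- A `V`-equation-in-context `Γ ▷ v =_q t : A` with label `q ∈ B`. -/
structure VEq (S : Signature.{u, w}) {V : Type x} (B : Set V) where
  ctx : Ctx S
  lhs : Tm S
  rhs : Tm S
  ty : Ty S.Ground
  label : V
  label_mem : label ∈ B
  lhs_typed : Typed ctx lhs ty
  rhs_typed : Typed ctx rhs ty

section Theory

variable {S : Signature.{u, w}} {V : Type x} [CommMonoid V] [CompleteLattice V] {B : Set V}

/-- `Thm Ax Γ v q t A`: the `V`-equation `Γ ▷ v =_q t : A` is a theorem of the theory with the
axioms `Ax`, in the `V`-equational system without the rule (arch). -/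
inductive Thm (Ax : Set (VEq S B)) : Ctx S → Tm S → V → Tm S → Ty S.Ground → Prop
  | ax (e : VEq S B) : e ∈ Ax → Thm Ax e.ctx e.lhs e.label e.rhs e.ty
  | base {Γ : Ctx S} {v t : Tm S} {A : Ty S.Ground} :
      BaseEq Γ v t A → Thm Ax Γ v ⊤ t A
  | base_symm {Γ : Ctx S} {v t : Tm S} {A : Ty S.Ground} :
      BaseEq Γ v t A → Thm Ax Γ t ⊤ v A
  | refl {Γ : Ctx S} {v : Tm S} {A : Ty S.Ground} : Typed Γ v A → Thm Ax Γ v ⊤ v A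
  | trans {Γ : Ctx S} {v t s : Tm S} {A : Ty S.Ground} {q r : V} :
      Thm Ax Γ v q t A → Thm Ax Γ t r s A → Thm Ax Γ v (q * r) s A
  | weak {Γ : Ctx S} {v t : Tm S} {A : Ty S.Ground} {q r : V} :
      Thm Ax Γ v q t A → r ∈ B → r ≤ q → Thm Ax Γ v r t A
  | join {Γ : Ctx S} {v t : Tm S} {A : Ty S.Ground} {n : ℕ} {q : Fin n → V} :
      Typed Γ v A → Typed Γ t A → (∀ i, Thm Ax Γ v (q i) t A) → Thm Ax Γ v (⨆ i, q i) t A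
  | tens {Γ Δ E : Ctx S} {v t v' t' : Tm S} {A A' : Ty S.Ground} {q r : V} :
      Thm Ax Γ v q t A → Thm Ax Δ v' r t' A' → Shuffle Γ Δ E → E.Valid →
      Thm Ax E (.tens v v') (q * r) (.tens t t') (.tensor A A')
  | op (f : S.Op) {Γs : Fin (S.arity f) → Ctx S} {vs ts : Fin (S.arity f) → Tm S} {E : Ctx S}
      {q : Fin (S.arity f) → V} :
      (∀ i, Thm Ax (Γs i) (vs i) (q i) (ts i) (S.dom f i)) → ShuffleN Γs E → E.Valid →
      Thm Ax E (.op f vs) (∏ i, q i) (.op f ts) (S.cod f)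
  | unitE {Γ Δ E : Ctx S} {v t v' t' : Tm S} {A : Ty S.Ground} {q r : V} :
      Thm Ax Γ v q t .unit → Thm Ax Δ v' r t' A → Shuffle Γ Δ E → E.Valid →
      Thm Ax E (.unitE v v') (q * r) (.unitE t t') A
  | lam {Γ : Ctx S} {v t : Tm S} {A A' : Ty S.Ground} {q : V} :
      Thm Ax ((0, A) :: Γ.shift 1) v q t A' → Thm Ax Γ (.lam A v) q (.lam A t) (.lolli A A')
  | pm {Γ Δ E : Ctx S} {v t v' t' : Tm S} {A A' C : Ty S.Ground} {q r : V} :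
      Thm Ax Γ v q t (.tensor A A') →
      Thm Ax ((0, A') :: (1, A) :: Δ.shift 2) v' r t' C → Shuffle Γ Δ E → E.Valid →
      Thm Ax E (.pm v v') (q * r) (.pm t t') C
  | app {Γ Δ E : Ctx S} {v t v' t' : Tm S} {A A' : Ty S.Ground} {q r : V} :
      Thm Ax Γ v q t (.lolli A A') → Thm Ax Δ v' r t' A → Shuffle Γ Δ E → E.Valid →
      Thm Ax E (.app v v') (q * r) (.app t t') A'
  | exch {Γ Δ : Ctx S} {v t : Tm S} {A : Ty S.Ground} {q : V} :
      Thm Ax Γ v q t A → Δ.Perm Γ → Thm Ax Δ v q t A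
  | subst {Γ Δ : Ctx S} {z : ℕ} {v t v' t' : Tm S} {A A' : Ty S.Ground} {q r : V} :
      Thm Ax ((z, A) :: Γ) v q t A' → Thm Ax Δ v' r t' A → Ctx.Valid (Δ ++ Γ) →
      Thm Ax (Δ ++ Γ) (v.sub z v') (q * r) (t.sub z t') A'

end Theory

/-! ## `V`-categories and varietal theories -/

/-- The structure of a `V`-category on `X`. -/
structure VCat (V : Type x) [CommMonoid V] [CompleteLattice V] (X : Type w) where
  a : X → X → V
  one_le : ∀ p, 1 ≤ a p p
  mul_le : ∀ p q r, a p q * a q r ≤ a p r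

namespace VCat

variable {V : Type x} [CommMonoid V] [CompleteLattice V] {X : Type w}

/-- Anti-symmetry of the natural order. -/
def Separated (c : VCat V X) : Prop := ∀ p q, 1 ≤ c.a p q → 1 ≤ c.a q p → p = q

/-- The equivalence relation whose quotient is the separated `V`-category reflecting `X`. -/
def setoid [IsQuantale V] (c : VCat V X) : Setoid X where
  r p q := 1 ≤ c.a p q ∧ 1 ≤ c.a q p
  iseqv := by
    have key : ∀ p q r, 1 ≤ c.a p q → 1 ≤ c.a q r → 1 ≤ c.a p r := fun p q r h h' =>
      calc (1 : V) = 1 * 1 := (mul_one 1).symm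
        _ ≤ c.a p q * c.a q r := mul_le_mul' h h'
        _ ≤ c.a p r := c.mul_le p q r
    exact ⟨fun p => ⟨c.one_le p, c.one_le p⟩, fun h => ⟨h.2, h.1⟩,
      fun h h' => ⟨key _ _ _ h.1 h'.1, key _ _ _ h'.2 h.2⟩⟩

end VCat

section Varietal

variable {S : Signature.{u, w}} {V : Type x} [CommMonoid V] [CompleteLattice V] [IsQuantale V]
  {B : Set V}

/-- The `V`-category of the terms `v` with `x : A ▷ v : A'`, where
`a v t = ⋁ {q | v =_q t is a theorem}`. -/
def termVCat (Ax : Set (VEq S B)) (A A' : Ty S.Ground) :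
    VCat V {t : Tm S // Typed [(0, A)] t A'} where
  a v t := sSup {q | Thm Ax [(0, A)] v.1 q t.1 A'}
  one_le p := le_top.trans (le_sSup (Thm.refl p.2))
  mul_le p q r := by
    rw [IsQuantale.sSup_mul_distrib]
    refine iSup₂_le fun i hi => ?_
    rw [IsQuantale.mul_sSup_distrib]
    exact iSup₂_le fun j hj => le_sSup (Thm.trans hi hj)

/-- The theory is varietal: for all types, the separated quotient of the `V`-category of terms
is small, that is, in bijection with an element of the universe `Type v` of the hom-sets. -/
def Varietal (Ax : Set (VEq S B)) : Prop :=
  ∀ A A' : Ty S.Ground, Small.{v} (Quotient (termVCat Ax A A').setoid)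

end Varietal

/-! ## Enriched autonomous categories -/

section Semantics

variable {C : Type u} [Category.{v} C] [MonoidalCategory C] [SymmetricCategory C]
  [MonoidalClosed C]

/-- The right transpose `X ⟶ (Y ⊸ Z)` of `f : X ⊗ Y ⟶ Z`. -/
noncomputable def transpose {X Y Z : C} (f : X ⊗ Y ⟶ Z) : X ⟶ (ihom Y).obj Z :=
  MonoidalClosed.curry ((β_ Y X).hom ≫ f)

/-- `app : (Y ⊸ Z) ⊗ Y ⟶ Z`. -/
noncomputable def evalMap (Y Z : C) : (ihom Y).obj Z ⊗ Y ⟶ Z :=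
  (β_ ((ihom Y).obj Z) Y).hom ≫ (ihom.ev Y).app Z

end Semantics

/-- Autonomous (symmetric monoidal closed) categories enriched over separated `V`-categories:
the hom-sets are separated `V`-categories, composition and the tensor are `V`-functors, and
the bijection between maps `X ⊗ Y ⟶ Z` and maps `X ⟶ (Y ⊸ Z)` is a `V`-isomorphism. -/
class EnrichedAutonomous (V : Type x) [CommMonoid V] [CompleteLattice V]
    (C : Type u) [Category.{v} C] [MonoidalCategory C] [SymmetricCategory C]
    [MonoidalClosed C] where
  homV : ∀ X Y : C, VCat V (X ⟶ Y)
  separated : ∀ X Y : C, (homV X Y).Separated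
  comp_le : ∀ {X Y Z : C} (f f' : X ⟶ Y) (g g' : Y ⟶ Z),
    (homV X Y).a f f' * (homV Y Z).a g g' ≤ (homV X Z).a (f ≫ g) (f' ≫ g')
  tensor_le : ∀ {X X' Y Y' : C} (f f' : X ⟶ Y) (g g' : X' ⟶ Y'),
    (homV X Y).a f f' * (homV X' Y').a g g' ≤
      (homV (X ⊗ X') (Y ⊗ Y')).a (f ⊗ₘ g) (f' ⊗ₘ g')
  transpose_eq : ∀ {X Y Z : C} (f g : X ⊗ Y ⟶ Z),
    (homV X ((ihom Y).obj Z)).a (transpose f) (transpose g) = (homV (X ⊗ Y) Z).a f g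

/-! ## Interpretation of types, contexts and judgements -/

section Interpretation

/-- The `n`-tensor `(… (X₁ ⊗ X₂) ⊗ …) ⊗ Xₙ`. -/
def nTensor {C : Type u} [Category.{v} C] [MonoidalCategory C] : (n : ℕ) → (Fin n → C) → C
  | 0, _ => 𝟙_ C
  | 1, X => X 0
  | n + 2, X => nTensor (n + 1) (fun i => X i.castSucc) ⊗ X (Fin.last (n + 1))

/-- The `n`-tensor `(… (m₁ ⊗ m₂) ⊗ …) ⊗ mₙ` of morphisms. -/
def nTensorMap {C : Type u} [Category.{v} C] [MonoidalCategory C] :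
    (n : ℕ) → {X Y : Fin n → C} → (∀ i, X i ⟶ Y i) → (nTensor n X ⟶ nTensor n Y)
  | 0, _, _, _ => 𝟙 (𝟙_ C)
  | 1, _, _, m => m 0
  | n + 2, _, _, m => nTensorMap (n + 1) (fun i => m i.castSucc) ⊗ₘ m (Fin.last (n + 1))

variable (S : Signature.{u, w}) (C : Type u) [Category.{v} C] [MonoidalCategory C]
  [MonoidalClosed C]

variable {S} in
/-- Interpretation of types, given that of the ground types. -/
def tyObj {C : Type u} [Category.{v} C] [MonoidalCategory C] [MonoidalClosed C]
    (g : S.Ground → C) : Ty S.Ground → C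
  | .base X => g X
  | .unit => 𝟙_ C
  | .tensor A B => tyObj g A ⊗ tyObj g B
  | .lolli A B => (ihom (tyObj g A)).obj (tyObj g B)

/-- An interpretation of the ground types and operation symbols in `C`. -/
structure Interp where
  ground : S.Ground → C
  op : ∀ f : S.Op, nTensor (S.arity f) (fun i => tyObj ground (S.dom f i)) ⟶
    tyObj ground (S.cod f)

namespace Interp

variable {S C} (M : Interp S C)

/-- Interpretation of types. -/
abbrev ty (A : Ty S.Ground) : C := tyObj M.ground A

/-- Interpretation of contexts; recall that `p :: Γ` is `Γ, p`. -/
def ctx : Ctx S → C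
  | [] => 𝟙_ C
  | [p] => M.ty p.2
  | p :: q :: Γ => ctx (q :: Γ) ⊗ M.ty p.2

/-- The isomorphism `⟦Γ, x : A⟧ ≅ ⟦Γ⟧ ⊗ ⟦A⟧`, which is an identity unless `Γ` is empty. -/
def snocIso : (p : ℕ × Ty S.Ground) → (Γ : Ctx S) → (M.ctx (p :: Γ) ≅ M.ctx Γ ⊗ M.ty p.2)
  | p, [] => (λ_ (M.ty p.2)).symm
  | _, _ :: _ => Iso.refl _

theorem ctx_shift (k : ℕ) : ∀ Γ : Ctx S, M.ctx (Γ.shift k) = M.ctx Γ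
  | [] => rfl
  | [_] => rfl
  | p :: q :: Γ => congrArg (· ⊗ M.ty p.2) (ctx_shift k (q :: Γ))

/-- Contexts that differ in the names of the variables have the same interpretation. -/
def shiftIso (k : ℕ) (Γ : Ctx S) : M.ctx (Γ.shift k) ≅ M.ctx Γ := eqToIso (M.ctx_shift k Γ)

variable [SymmetricCategory C]

/-- The composite `⟦E⟧ ⟶ ⟦Γ, Δ⟧ ⟶ ⟦Γ⟧ ⊗ ⟦Δ⟧` of the shuffling and the splitting morphism,
built from the structural isomorphisms along the shuffle. -/
def split : {Γ Δ E : Ctx S} → Shuffle Γ Δ E → (M.ctx E ⟶ M.ctx Γ ⊗ M.ctx Δ)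
  | _, _, _, .nil => (λ_ (𝟙_ C)).inv
  | _, _, _, .left (Γ := Γ) (Δ := Δ) (E := E) p s =>
      (M.snocIso p E).hom ≫ (split s ▷ M.ty p.2) ≫
        (α_ (M.ctx Γ) (M.ctx Δ) (M.ty p.2)).hom ≫
        (M.ctx Γ ◁ (β_ (M.ctx Δ) (M.ty p.2)).hom) ≫
        (α_ (M.ctx Γ) (M.ty p.2) (M.ctx Δ)).inv ≫ ((M.snocIso p Γ).inv ▷ M.ctx Δ)
  | _, _, _, .right (Γ := Γ) (Δ := Δ) (E := E) p s =>
      (M.snocIso p E).hom ≫ (split s ▷ M.ty p.2) ≫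
        (α_ (M.ctx Γ) (M.ctx Δ) (M.ty p.2)).hom ≫ (M.ctx Γ ◁ (M.snocIso p Δ).inv)

/-- The composite `⟦E⟧ ⟶ ⟦Γ₁, …, Γₙ⟧ ⟶ ⟦Γ₁⟧ ⊗ … ⊗ ⟦Γₙ⟧`. -/
def splitN : {n : ℕ} → {Γs : Fin n → Ctx S} → {E : Ctx S} → ShuffleN Γs E →
    (M.ctx E ⟶ nTensor n (fun i => M.ctx (Γs i)))
  | _, _, _, .nil _ => 𝟙 (𝟙_ C)
  | _, _, _, .one Γs => 𝟙 (M.ctx (Γs 0))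
  | _, _, _, .snoc Γs s s' =>
      M.split s' ≫ (splitN s ▷ M.ctx (Γs (Fin.last _)))

/-- Interpretation `⟦Γ ▷ v : A⟧ : ⟦Γ⟧ ⟶ ⟦A⟧` of judgements, by recursion on derivations. -/
noncomputable def den : {Γ : Ctx S} → {v : Tm S} → {A : Ty S.Ground} → Der Γ v A →
    (M.ctx Γ ⟶ M.ty A)
  | _, _, _, .hyp _ A => 𝟙 (M.ty A)
  | _, _, _, .op f _ _ d s _ => M.splitN s ≫ nTensorMap (S.arity f) (fun i => den (d i)) ≫ M.op f
  | _, _, _, .unitI => 𝟙 (𝟙_ C)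
  | _, _, _, .unitE (Δ := Δ) d e s _ =>
      M.split s ≫ (den d ▷ M.ctx Δ) ≫ (λ_ (M.ctx Δ)).hom ≫ den e
  | _, _, _, .tensI d e s _ => M.split s ≫ (den d ⊗ₘ den e)
  | _, _, _, .tensE (Δ := Δ) (A := A) (B := B) d e s _ =>
      M.split s ≫ (den d ▷ M.ctx Δ) ≫ (β_ (M.ty A ⊗ M.ty B) (M.ctx Δ)).hom ≫
        (α_ (M.ctx Δ) (M.ty A) (M.ty B)).inv ≫
        (((M.shiftIso 2 Δ).inv ▷ M.ty A) ▷ M.ty B) ≫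
        ((M.snocIso (1, A) (Δ.shift 2)).inv ▷ M.ty B) ≫
        (M.snocIso (0, B) ((1, A) :: Δ.shift 2)).inv ≫ den e
  | _, _, _, .lolliI (Γ := Γ) (A := A) d =>
      transpose (((M.shiftIso 1 Γ).inv ▷ M.ty A) ≫ (M.snocIso (0, A) (Γ.shift 1)).inv ≫ den d)
  | _, _, _, .lolliE (A := A) (B := B) d e s _ =>
      M.split s ≫ (den d ⊗ₘ den e) ≫ evalMap (M.ty A) (M.ty B)

variable {V : Type x} [CommMonoid V] [CompleteLattice V] {B : Set V} [EnrichedAutonomous V C]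

/-- The `V`-equation `Γ ▷ v =_q t : A` is satisfied: `q ≤ a(⟦Γ ▷ v : A⟧, ⟦Γ ▷ t : A⟧)`.
(A judgement has only one derivation, so the quantification over derivations is harmless.) -/
def Satisfies (e : VEq S B) : Prop :=
  ∀ (d : Der e.ctx e.lhs e.ty) (d' : Der e.ctx e.rhs e.ty),
    e.label ≤ (EnrichedAutonomous.homV (V := V) (M.ctx e.ctx) (M.ty e.ty)).a (M.den d) (M.den d')

/-- The interpretation satisfies all axioms. -/
def IsModel (Ax : Set (VEq S B)) : Prop := ∀ e ∈ Ax, M.Satisfies e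

end Interp

end Interpretation

end VLam

open VLam

namespace VLam

section

/-! ## Renaming and substitution -/

namespace Tm

variable {S : Signature.{u, w}}

/-! The proof builds a syntactic model. For terms of the same type in the same context, let `D` be
the join of the labels of all provable equations between them. Since multiplication distributes over
joins, the rules of the calculus turn into inequalities for `D`: transitivity makes it a
`V`-category structure, and the compatibility and substitution rules make term formers and
substitution `V`-functorial. Types as objects, and terms in one variable modulo `Eqv` (`D` at least
`1` in both directions) as morphisms, form an enriched autonomous category `Syn`. The varietal
hypothesis is what allows these classes of terms to live in the universe `Type v` of hom-sets.

When the signature is interpreted in `Syn` by itself, the denotation of a judgement sends the tuple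
of its variables to the term itself (`Syn.ev_den`). Hence the distance of two denotations is exactly
the join of the provable labels (`Syn.homV_den`). The axioms hold because their labels are among
those joined. An equation with label `q` valid in all models therefore satisfies `q ≤ ⋁ {provable
labels}`. If `r` is way below `q`, finitely many provable labels already have a join above `r`; the
finite join rule and weakening then derive the equation with label `r`. The rule (arch) would be
needed only to pass from all such `r` to `q`.

Two devices keep the construction manageable. Typing and provability are invariant under permutation
of the context, so contexts are treated as multisets (`MT`, `D`) and shuffles become sums. Moreover,
β and η for `⊗` and `I` show that matching against a pattern of variables is inverse to substituting
the pattern, without loss of distance (`Elim`, `Pat.exists_elim`). So a morphism and its distances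
are determined by its value on a pattern (`Pat.D_le`), and any term in the variables of a pattern
defines a morphism (`Pat.exists_plug`). Every coherence law then reduces to evaluating both sides on
a generic tuple, which the relation `Ev` records. -/

theorem upRen_comp (ρ τ : ℕ → ℕ) : upRen (τ ∘ ρ) = upRen τ ∘ upRen ρ := by
  funext n; cases n <;> rfl

theorem rename_rename (v : Tm S) : ∀ ρ τ : ℕ → ℕ, (v.rename ρ).rename τ = v.rename (τ ∘ ρ) := by
  induction v <;> intro ρ τ <;> simp_all [rename, upRen_comp]

theorem up_comp_upRen (σ : ℕ → Tm S) (ρ : ℕ → ℕ) : up (σ ∘ ρ) = up σ ∘ upRen ρ := by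
  funext n; cases n <;> rfl

theorem subst_rename (v : Tm S) :
    ∀ (ρ : ℕ → ℕ) (σ : ℕ → Tm S), (v.rename ρ).subst σ = v.subst (σ ∘ ρ) := by
  induction v <;> intro ρ σ <;> simp_all [rename, subst, up_comp_upRen]

theorem up_rename (σ : ℕ → Tm S) (ρ : ℕ → ℕ) :
    up (fun n => (σ n).rename ρ) = fun n => (up σ n).rename (upRen ρ) := by
  funext n
  cases n with
  | zero => rfl
  | succ n => simp only [up, rename_rename]; rfl

theorem rename_subst (v : Tm S) : ∀ (σ : ℕ → Tm S) (ρ : ℕ → ℕ),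
    (v.subst σ).rename ρ = v.subst (fun n => (σ n).rename ρ) := by
  induction v <;> intro σ ρ <;> simp_all [rename, subst, up_rename]

theorem up_subst (σ τ : ℕ → Tm S) :
    up (fun n => (σ n).subst τ) = fun n => (up σ n).subst (up τ) := by
  funext n
  cases n with
  | zero => rfl
  | succ n => simp only [up, rename_subst, subst_rename]; rfl

/-- The fusion laws have to come in the order renaming–renaming, the two mixed ones,
substitution–substitution, because `up` itself renames the substituted terms. -/
theorem subst_subst (v : Tm S) : ∀ σ τ : ℕ → Tm S,
    (v.subst σ).subst τ = v.subst (fun n => (σ n).subst τ) := by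
  induction v <;> intro σ τ <;> simp_all [subst, up_subst]

theorem up_var : up (var : ℕ → Tm S) = var := by
  funext n; cases n <;> rfl

theorem subst_var (v : Tm S) : v.subst var = v := by
  induction v <;> simp_all [subst, up_var]

theorem up_var_comp (ρ : ℕ → ℕ) : up (fun n => (var (ρ n) : Tm S)) = fun n => var (upRen ρ n) := by
  funext n; cases n <;> rfl

theorem rename_eq_subst (v : Tm S) :
    ∀ ρ : ℕ → ℕ, v.rename ρ = v.subst (fun n => var (ρ n)) := by
  induction v <;> intro ρ <;> simp_all [rename, subst, up_var_comp]

/-- Replacement of all free variables by the same term. -/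
def plug (v s : Tm S) : Tm S := v.subst (fun _ => s)

theorem plug_subst (v s : Tm S) (σ : ℕ → Tm S) : (v.plug s).subst σ = v.plug (s.subst σ) :=
  subst_subst ..

theorem plug_rename (v s : Tm S) (ρ : ℕ → ℕ) : (v.plug s).rename ρ = v.plug (s.rename ρ) :=
  rename_subst ..

theorem plug_plug (v s t : Tm S) : (v.plug s).plug t = v.plug (s.plug t) :=
  subst_subst ..

end Tm

end

section

/-! ## Typing in unordered contexts -/

variable {S : Signature.{u, w}}

/-- Contexts without order. -/
abbrev MCtx (S : Signature.{u, w}) : Type u := Multiset (ℕ × Ty S.Ground)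

namespace MCtx

/-- Each variable occurs at most once. -/
def Nd (m : MCtx S) : Prop := (m.map Prod.fst).Nodup

/-- The same context, seen from under a binder of `k` variables. -/
def shift (k : ℕ) (m : MCtx S) : MCtx S := m.map fun p => (p.1 + k, p.2)

@[simp] theorem shift_coe (k : ℕ) (Γ : Ctx S) :
    shift k (Γ : MCtx S) = ((Γ.shift k : Ctx S) : MCtx S) := rfl

@[simp] theorem shift_cons (k : ℕ) (p : ℕ × Ty S.Ground) (m : MCtx S) :
    shift k (p ::ₘ m) = (p.1 + k, p.2) ::ₘ shift k m := Multiset.map_cons ..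

@[simp] theorem shift_singleton (k : ℕ) (p : ℕ × Ty S.Ground) :
    shift k ({p} : MCtx S) = {(p.1 + k, p.2)} := Multiset.map_singleton ..

theorem shift_shift (k l : ℕ) (m : MCtx S) : shift k (shift l m) = shift (l + k) m := by
  simp [shift, add_assoc]

theorem Nd.of_le {m n : MCtx S} (h : n.Nd) (hmn : m ≤ n) : m.Nd :=
  Multiset.nodup_of_le (Multiset.map_le_map hmn) h

theorem nd_coe {Γ : Ctx S} : Nd (Γ : MCtx S) ↔ Γ.Valid := by
  simp [Nd, Ctx.Valid]

theorem Nd.left {m n : MCtx S} (h : (m + n).Nd) : m.Nd := h.of_le (Multiset.le_add_right ..)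

theorem Nd.right {m n : MCtx S} (h : (m + n).Nd) : n.Nd := h.of_le (Multiset.le_add_left ..)

theorem Nd.shift {m : MCtx S} (h : m.Nd) (k : ℕ) : (m.shift k).Nd := by
  have : (m.shift k).map Prod.fst = (m.map Prod.fst).map (· + k) := by
    simp [MCtx.shift]
  rw [Nd, this]
  exact h.map (add_left_injective k)

theorem nd_cons {p : ℕ × Ty S.Ground} {m : MCtx S} :
    Nd (p ::ₘ m) ↔ p.1 ∉ m.map Prod.fst ∧ m.Nd := by
  simp [Nd]

theorem Nd.cons_shift {m : MCtx S} (h : m.Nd) (A : Ty S.Ground) :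
    Nd ((0, A) ::ₘ m.shift 1) := by
  refine nd_cons.2 ⟨?_, h.shift 1⟩
  simp [MCtx.shift]

theorem Nd.cons_cons_shift {m : MCtx S} (h : m.Nd) (A B : Ty S.Ground) :
    Nd ((0, B) ::ₘ (1, A) ::ₘ m.shift 2) := by
  refine nd_cons.2 ⟨?_, nd_cons.2 ⟨?_, h.shift 2⟩⟩ <;> simp [MCtx.shift]

end MCtx

open MCtx

namespace Shuffle

theorem coe_eq {Γ Δ E : Ctx S} (s : Shuffle Γ Δ E) : (E : MCtx S) = Γ + Δ := by
  induction s with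
  | nil => rfl
  | left p s ih => simp [← Multiset.cons_coe, ih]
  | right p s ih => rw [← Multiset.cons_coe, ih, ← Multiset.cons_coe, Multiset.add_cons]

/-- Concatenation is a shuffle. -/
def append : (Γ Δ : Ctx S) → Shuffle Γ Δ (Γ ++ Δ)
  | [], [] => .nil
  | [], q :: Δ => .right q (append [] Δ)
  | p :: Γ, Δ => .left p (append Γ Δ)

/-- It suffices to swap two neighbours: if both come from the same part, that part is permuted; if
they come from different parts, only the order of the two shuffle steps changes. -/
theorem exists_perm {E E' : Ctx S} (h : E.Perm E') : ∀ {Γ Δ : Ctx S}, Shuffle Γ Δ E →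
    ∃ Γ' Δ' : Ctx S, Γ.Perm Γ' ∧ Δ.Perm Δ' ∧ Nonempty (Shuffle Γ' Δ' E') := by
  induction h with
  | nil => exact fun {Γ Δ} s => ⟨Γ, Δ, .refl _, .refl _, ⟨s⟩⟩
  | cons p h ih =>
    intro Γ Δ s
    cases s with
    | left _ s =>
      obtain ⟨Γ', Δ', h₁, h₂, ⟨s'⟩⟩ := ih s
      exact ⟨_, _, h₁.cons p, h₂, ⟨.left p s'⟩⟩
    | right _ s =>
      obtain ⟨Γ', Δ', h₁, h₂, ⟨s'⟩⟩ := ih s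
      exact ⟨_, _, h₁, h₂.cons p, ⟨.right p s'⟩⟩
  | swap p q E =>
    intro Γ Δ s
    cases s with
    | left _ s =>
      cases s with
      | left _ s => exact ⟨_, _, .swap .., .refl _, ⟨.left _ (.left _ s)⟩⟩
      | right _ s => exact ⟨_, _, .refl _, .refl _, ⟨.right _ (.left _ s)⟩⟩
    | right _ s =>
      cases s with
      | left _ s => exact ⟨_, _, .refl _, .refl _, ⟨.left _ (.right _ s)⟩⟩
      | right _ s => exact ⟨_, _, .refl _, .swap .., ⟨.right _ (.right _ s)⟩⟩
  | trans _ _ ih₁ ih₂ =>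
    intro Γ Δ s
    obtain ⟨Γ', Δ', h₁, h₂, ⟨s'⟩⟩ := ih₁ s
    obtain ⟨Γ'', Δ'', h₁', h₂', s''⟩ := ih₂ s'
    exact ⟨_, _, h₁.trans h₁', h₂.trans h₂', s''⟩

end Shuffle

namespace ShuffleN

theorem coe_eq {n : ℕ} {Γs : Fin n → Ctx S} {E : Ctx S} (s : ShuffleN Γs E) :
    (E : MCtx S) = ∑ i, (Γs i : MCtx S) := by
  induction s with
  | nil => rfl
  | one Γs => simp
  | snoc Γs s s' ih => rw [s'.coe_eq, ih]; exact (Fin.sum_univ_castSucc fun i => (Γs i : MCtx S)).symm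

theorem exists_shuffle : ∀ {n : ℕ} (Γs : Fin n → Ctx S), ∃ E, Nonempty (ShuffleN Γs E)
  | 0, Γs => ⟨[], ⟨.nil Γs⟩⟩
  | 1, Γs => ⟨_, ⟨.one Γs⟩⟩
  | n + 2, Γs => by
    obtain ⟨E, ⟨s⟩⟩ := exists_shuffle fun i : Fin (n + 1) => Γs i.castSucc
    exact ⟨_, ⟨.snoc Γs s (.append _ _)⟩⟩

theorem exists_perm {n : ℕ} {Γs : Fin n → Ctx S} {E : Ctx S} (s : ShuffleN Γs E) :
    ∀ {E' : Ctx S}, E.Perm E' →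
      ∃ Γs' : Fin n → Ctx S, (∀ i, (Γs i).Perm (Γs' i)) ∧ Nonempty (ShuffleN Γs' E') := by
  induction s with
  | nil Γs =>
    intro E' h
    rw [List.nil_perm.1 h]
    exact ⟨Γs, fun _ => .refl _, ⟨.nil Γs⟩⟩
  | one Γs =>
    intro E' h
    exact ⟨fun _ => E', fun i => by rwa [Subsingleton.elim i 0], ⟨.one fun _ => E'⟩⟩
  | @snoc n Γs E₁ E s s' ih =>
    intro E' h
    obtain ⟨E₁', Δ', h₁, h₂, ⟨t'⟩⟩ := s'.exists_perm h
    obtain ⟨Γs', h₃, ⟨t⟩⟩ := ih h₁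
    refine ⟨Fin.snoc (α := fun _ => Ctx S) Γs' Δ', fun i => ?_,
      ⟨@ShuffleN.snoc _ _ (Fin.snoc (α := fun _ => Ctx S) Γs' Δ') E₁' _ ?_ ?_⟩⟩
    · refine Fin.lastCases ?_ (fun i => ?_) i
      · simpa using h₂
      · simpa using h₃ i
    · simpa using t
    · simpa using t'

end ShuffleN

theorem Der.valid {Γ : Ctx S} {v : Tm S} {A : Ty S.Ground} (d : Der Γ v A) : Γ.Valid := by
  induction d with
  | hyp n A => simp [Ctx.Valid]
  | unitI => simp [Ctx.Valid]
  | lolliI d ih =>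
    refine List.Nodup.of_map (· + 1) ?_
    simpa [Ctx.shift, Function.comp_def] using ih.of_cons
  | op | unitE | tensI | tensE | lolliE => assumption

theorem Ctx.Valid.perm {Γ Δ : Ctx S} (h : Γ.Valid) (p : Γ.Perm Δ) : Δ.Valid :=
  (p.map Prod.fst).nodup_iff.1 h

theorem Ctx.shift_perm {Γ Δ : Ctx S} (k : ℕ) (p : Γ.Perm Δ) :
    (Ctx.shift k Γ).Perm (Ctx.shift k Δ) := p.map _

/-- Exchange is not a typing rule, but it is admissible: a permutation of the conclusion is pushed
through the shuffle to the premisses. This justifies typing in multisets. -/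
theorem Der.perm {Γ : Ctx S} {v : Tm S} {A : Ty S.Ground} (d : Der Γ v A) :
    ∀ {Δ : Ctx S}, Γ.Perm Δ → Typed Δ v A := by
  induction d with
  | hyp n A => intro Δ h; rw [← List.singleton_perm.1 h]; exact ⟨.hyp n A⟩
  | op f Γs vs d s hE ih =>
    intro Δ h
    obtain ⟨Γs', h', ⟨s'⟩⟩ := s.exists_perm h
    exact ⟨.op f Γs' vs (fun i => (ih i (h' i)).some) s' (hE.perm h)⟩
  | unitI => intro Δ h; rw [List.nil_perm.1 h]; exact ⟨.unitI⟩
  | unitE d e s hE ih ih' =>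
    intro Δ h
    obtain ⟨Γ', Δ', h₁, h₂, ⟨s'⟩⟩ := s.exists_perm h
    exact ⟨.unitE (ih h₁).some (ih' h₂).some s' (hE.perm h)⟩
  | tensI d e s hE ih ih' =>
    intro Δ h
    obtain ⟨Γ', Δ', h₁, h₂, ⟨s'⟩⟩ := s.exists_perm h
    exact ⟨.tensI (ih h₁).some (ih' h₂).some s' (hE.perm h)⟩
  | tensE d e s hE ih ih' =>
    intro Δ h
    obtain ⟨Γ', Δ', h₁, h₂, ⟨s'⟩⟩ := s.exists_perm h
    exact ⟨.tensE (ih h₁).some (ih' (((Ctx.shift_perm 2 h₂).cons _).cons _)).some s' (hE.perm h)⟩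
  | lolliI d ih => exact fun h => ⟨.lolliI (ih ((Ctx.shift_perm 1 h).cons _)).some⟩
  | lolliE d e s hE ih ih' =>
    intro Δ h
    obtain ⟨Γ', Δ', h₁, h₂, ⟨s'⟩⟩ := s.exists_perm h
    exact ⟨.lolliE (ih h₁).some (ih' h₂).some s' (hE.perm h)⟩

/-- Typing in a context without order. -/
def MT (m : MCtx S) (v : Tm S) (A : Ty S.Ground) : Prop := ∃ Γ : Ctx S, (Γ : MCtx S) = m ∧ Typed Γ v A

namespace MT

variable {m n : MCtx S} {v t : Tm S} {A B C : Ty S.Ground}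

theorem typed {Γ : Ctx S} (h : MT (Γ : MCtx S) v A) : Typed Γ v A := by
  obtain ⟨Γ', h, ⟨d⟩⟩ := h
  exact d.perm (Multiset.coe_eq_coe.1 h)

theorem of_typed {Γ : Ctx S} (h : Typed Γ v A) : MT (Γ : MCtx S) v A := ⟨Γ, rfl, h⟩

theorem nd (h : MT m v A) : m.Nd := by
  obtain ⟨Γ, rfl, ⟨d⟩⟩ := h
  exact nd_coe.2 d.valid

theorem var (k : ℕ) (A : Ty S.Ground) : MT {(k, A)} (.var k) A := ⟨[(k, A)], rfl, ⟨.hyp k A⟩⟩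

theorem star : MT 0 (.star : Tm S) .unit := ⟨[], rfl, ⟨.unitI⟩⟩

theorem op (f : S.Op) {ms : Fin (S.arity f) → MCtx S} {vs : Fin (S.arity f) → Tm S}
    (h : ∀ i, MT (ms i) (vs i) (S.dom f i)) (hn : (∑ i, ms i).Nd) :
    MT (∑ i, ms i) (.op f vs) (S.cod f) := by
  choose Γs hΓ d using h
  obtain ⟨E, ⟨s⟩⟩ := ShuffleN.exists_shuffle Γs
  have e : (E : MCtx S) = ∑ i, ms i := by rw [s.coe_eq]; simp [hΓ]
  exact ⟨E, e, ⟨.op f Γs vs (fun i => (d i).some) s (nd_coe.1 (e ▸ hn))⟩⟩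

theorem unitE (h : MT m v .unit) (h' : MT n t A) (hn : (m + n).Nd) :
    MT (m + n) (.unitE v t) A := by
  obtain ⟨Γ, rfl, ⟨d⟩⟩ := h
  obtain ⟨Δ, rfl, ⟨e⟩⟩ := h'
  exact ⟨_, (Multiset.coe_add ..).symm, ⟨.unitE d e (.append Γ Δ) (nd_coe.1 hn)⟩⟩

theorem tens (h : MT m v A) (h' : MT n t B) (hn : (m + n).Nd) :
    MT (m + n) (.tens v t) (.tensor A B) := by
  obtain ⟨Γ, rfl, ⟨d⟩⟩ := h
  obtain ⟨Δ, rfl, ⟨e⟩⟩ := h'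
  exact ⟨_, (Multiset.coe_add ..).symm, ⟨.tensI d e (.append Γ Δ) (nd_coe.1 hn)⟩⟩

theorem app (h : MT m v (.lolli A B)) (h' : MT n t A) (hn : (m + n).Nd) :
    MT (m + n) (.app v t) B := by
  obtain ⟨Γ, rfl, ⟨d⟩⟩ := h
  obtain ⟨Δ, rfl, ⟨e⟩⟩ := h'
  exact ⟨_, (Multiset.coe_add ..).symm, ⟨.lolliE d e (.append Γ Δ) (nd_coe.1 hn)⟩⟩

theorem pm (h : MT m v (.tensor A B)) (h' : MT ((0, B) ::ₘ (1, A) ::ₘ n.shift 2) t C)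
    (hn : (m + n).Nd) : MT (m + n) (.pm v t) C := by
  obtain ⟨Γ, rfl, ⟨d⟩⟩ := h
  obtain ⟨Δ, rfl⟩ := Quot.exists_rep n
  obtain ⟨e⟩ := typed (Γ := (0, B) :: (1, A) :: Ctx.shift 2 Δ) h'
  exact ⟨_, (Multiset.coe_add ..).symm, ⟨.tensE d e (.append Γ Δ) (nd_coe.1 hn)⟩⟩

theorem lam (h : MT ((0, A) ::ₘ m.shift 1) v B) : MT m (.lam A v) (.lolli A B) := by
  obtain ⟨Γ, rfl⟩ := Quot.exists_rep m
  obtain ⟨e⟩ := typed (Γ := (0, A) :: Ctx.shift 1 Γ) h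
  exact ⟨_, rfl, ⟨.lolliI e⟩⟩

theorem cast (h : MT m v A) (e : m = n) : MT n v A := e ▸ h

end MT

/-! ## Substitution and typing -/

/-- The free variables of a typed term all lie in its context. Substitutions are total functions on
`ℕ`, so their values elsewhere are junk that must be shown irrelevant. -/
theorem Der.subst_congr {Γ : Ctx S} {v : Tm S} {A : Ty S.Ground} (d : Der Γ v A) :
    ∀ {σ τ : ℕ → Tm S}, (∀ p ∈ Γ, σ p.1 = τ p.1) → v.subst σ = v.subst τ := by
  induction d with
  | hyp n A => intro σ τ h; exact h _ (List.mem_singleton_self _)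
  | op f Γs vs d s hE ih =>
    intro σ τ h
    simp only [Tm.subst, Tm.op.injEq, heq_eq_eq, true_and]
    refine funext fun i => ih i fun p hp => h p ?_
    have : p ∈ (∑ i, (Γs i : MCtx S)) :=
      Multiset.mem_of_le (Finset.single_le_sum (f := fun i => (Γs i : MCtx S))
        (fun _ _ => zero_le) (Finset.mem_univ i)) hp
    rwa [← s.coe_eq] at this
  | unitI => intros; rfl
  | unitE d e s hE ih ih' | tensI d e s hE ih ih' | lolliE d e s hE ih ih' =>
    intro σ τ h
    have hs : ∀ p, p ∈ _ ∨ p ∈ _ → p ∈ _ := fun p hp =>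
      Multiset.mem_coe.1 (s.coe_eq ▸ Multiset.mem_add.2 hp)
    simp only [Tm.subst]
    rw [ih fun p hp => h p (hs p (.inl hp)), ih' fun p hp => h p (hs p (.inr hp))]
  | tensE d e s hE ih ih' =>
    intro σ τ h
    have hs : ∀ p, p ∈ _ ∨ p ∈ _ → p ∈ _ := fun p hp =>
      Multiset.mem_coe.1 (s.coe_eq ▸ Multiset.mem_add.2 hp)
    simp only [Tm.subst]
    rw [ih fun p hp => h p (hs p (.inl hp)), ih']
    intro p hp
    simp only [List.mem_cons, Ctx.shift, List.mem_map] at hp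
    obtain rfl | rfl | ⟨p, hp, rfl⟩ := hp
    · rfl
    · rfl
    · simp only [Tm.up, h p (hs p (.inr hp))]
  | lolliI d ih =>
    intro σ τ h
    simp only [Tm.subst]
    rw [ih]
    intro p hp
    simp only [List.mem_cons, Ctx.shift, List.mem_map] at hp
    obtain rfl | ⟨p, hp, rfl⟩ := hp
    · rfl
    · simp only [Tm.up, h p hp]

theorem MT.subst_congr {m : MCtx S} {v : Tm S} {A : Ty S.Ground} (h : MT m v A)
    {σ τ : ℕ → Tm S} (hσ : ∀ p ∈ m, σ p.1 = τ p.1) : v.subst σ = v.subst τ := by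
  obtain ⟨Γ, rfl, ⟨d⟩⟩ := h
  exact d.subst_congr hσ

theorem MT.subst_eq_self {m : MCtx S} {v : Tm S} {A : Ty S.Ground} (h : MT m v A)
    {σ : ℕ → Tm S} (hσ : ∀ p ∈ m, σ p.1 = .var p.1) : v.subst σ = v := by
  rw [h.subst_congr hσ]; exact Tm.subst_var v

/-- Extension of a family of contexts under a binder. -/
def upCtx (Δ : ℕ × Ty S.Ground → MCtx S) : ℕ × Ty S.Ground → MCtx S
  | (0, A) => {(0, A)}
  | (n + 1, A) => (Δ (n, A)).shift 1

/-- By linearity the context of a substituted term is the sum of the contexts `Δ p` of the terms put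
in for the variables `p`, that is, a `bind`. Here this is made compatible with passing under a
binder. -/
theorem bind_upCtx (Δ : ℕ × Ty S.Ground → MCtx S) (m : MCtx S) (A : Ty S.Ground) :
    ((0, A) ::ₘ m.shift 1).bind (upCtx Δ) = (0, A) ::ₘ shift 1 (m.bind Δ) := by
  simp [MCtx.shift, Multiset.bind_map, Multiset.map_bind, upCtx]

theorem bind_upCtx_upCtx (Δ : ℕ × Ty S.Ground → MCtx S) (m : MCtx S) (A B : Ty S.Ground) :
    ((0, B) ::ₘ (1, A) ::ₘ m.shift 2).bind (upCtx (upCtx Δ)) =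
      (0, B) ::ₘ (1, A) ::ₘ shift 2 (m.bind Δ) := by
  have h₁ : ((0, B) ::ₘ (1, A) ::ₘ m.shift 2) = (0, B) ::ₘ shift 1 ((0, A) ::ₘ m.shift 1) := by
    simp [shift_shift]
  rw [h₁, bind_upCtx, bind_upCtx]
  simp [shift_shift]

/-- The main step of the typing of renamings and of substitutions: `K` says which terms may be
substituted. -/
theorem Der.subst_of {K : MCtx S → Tm S → Ty S.Ground → Prop}
    (hK : ∀ m v A, K m v A → MT m v A) (hvar : ∀ n A, K {(n, A)} (.var n) A)
    (hsucc : ∀ m v A, K m v A → K (m.shift 1) (v.rename Nat.succ) A)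
    {Γ : Ctx S} {v : Tm S} {A : Ty S.Ground} (d : Der Γ v A) :
    ∀ {σ : ℕ → Tm S} {Δ : ℕ × Ty S.Ground → MCtx S}, (∀ p ∈ Γ, K (Δ p) (σ p.1) p.2) →
      Nd ((Γ : MCtx S).bind Δ) → MT ((Γ : MCtx S).bind Δ) (v.subst σ) A := by
  -- Under a binder the new variable is covered by `hvar` and the shifted old terms by `hsucc`.
  have hup : ∀ {m : MCtx S} {σ : ℕ → Tm S} {Δ : ℕ × Ty S.Ground → MCtx S} (A : Ty S.Ground),
      (∀ p ∈ m, K (Δ p) (σ p.1) p.2) →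
      ∀ p ∈ (0, A) ::ₘ m.shift 1, K (upCtx Δ p) (Tm.up σ p.1) p.2 := by
    intro m σ Δ A h p hp
    simp only [Multiset.mem_cons, MCtx.shift, Multiset.mem_map] at hp
    obtain rfl | ⟨p, hp, rfl⟩ := hp
    · exact hvar ..
    · exact hsucc _ _ _ (h p hp)
  induction d with
  | hyp n A =>
    intro σ Δ h _
    simpa [Tm.subst] using hK _ _ _ (h (n, A) (List.mem_singleton_self _))
  | @op f Γs vs E d s hE ih =>
    intro σ Δ h hn
    have e : (E : MCtx S).bind Δ = ∑ i, (Γs i : MCtx S).bind Δ := by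
      rw [s.coe_eq]
      exact map_sum (⟨⟨fun m : MCtx S => m.bind Δ, Multiset.zero_bind _⟩,
        fun a b => Multiset.add_bind a b Δ⟩ : MCtx S →+ MCtx S) _ _
    have hle : ∀ i, (Γs i : MCtx S).bind Δ ≤ ∑ i, (Γs i : MCtx S).bind Δ := fun i =>
      Finset.single_le_sum (f := fun i => (Γs i : MCtx S).bind Δ) (fun _ _ => zero_le)
        (Finset.mem_univ i)
    rw [e] at hn ⊢
    refine .op f (fun i => ih i (fun p hp => h p ?_) (hn.of_le (hle i))) hn
    have : p ∈ (∑ i, (Γs i : MCtx S)) :=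
      Multiset.mem_of_le (Finset.single_le_sum (f := fun i => (Γs i : MCtx S))
        (fun _ _ => zero_le) (Finset.mem_univ i)) hp
    rwa [← s.coe_eq] at this
  | unitI => intro _ _ _ _; exact .star
  | unitE d e s hE ih ih' | tensI d e s hE ih ih' | lolliE d e s hE ih ih' =>
    intro σ Δ h hn
    have hs : ∀ p, p ∈ _ ∨ p ∈ _ → p ∈ _ := fun p hp =>
      Multiset.mem_coe.1 (s.coe_eq ▸ Multiset.mem_add.2 hp)
    rw [s.coe_eq, Multiset.add_bind] at hn ⊢
    have h₁ := ih (fun p hp => h p (hs p (.inl hp))) hn.left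
    have h₂ := ih' (fun p hp => h p (hs p (.inr hp))) hn.right
    first | exact h₁.unitE h₂ hn | exact h₁.tens h₂ hn | exact h₁.app h₂ hn
  | @tensE _ D _ _ _ A B _ d e s hE ih ih' =>
    intro σ Δ h hn
    have hs : ∀ p, p ∈ _ ∨ p ∈ _ → p ∈ _ := fun p hp =>
      Multiset.mem_coe.1 (s.coe_eq ▸ Multiset.mem_add.2 hp)
    rw [s.coe_eq, Multiset.add_bind] at hn ⊢
    have h₁ := ih (fun p hp => h p (hs p (.inl hp))) hn.left
    have hΔ : ∀ p ∈ (D : MCtx S), K (Δ p) (σ p.1) p.2 := fun p hp => h p (hs p (.inr hp))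
    have eq : (((0, B) :: (1, A) :: D.shift 2 : Ctx S) : MCtx S).bind (upCtx (upCtx Δ)) =
      (0, B) ::ₘ (1, A) ::ₘ shift 2 ((D : MCtx S).bind Δ) := bind_upCtx_upCtx Δ D A B
    have h₂ := ih' (σ := Tm.up (Tm.up σ)) (Δ := upCtx (upCtx Δ)) (by
      have := hup B (hup A hΔ)
      simpa [shift_shift, Ctx.shift, Function.comp_def] using this) (by
      rw [eq]; exact hn.right.cons_cons_shift ..)
    rw [eq] at h₂
    exact h₁.pm h₂ hn
  | @lolliI Γ _ A _ d ih =>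
    intro σ Δ h hn
    have eq : (((0, A) :: Γ.shift 1 : Ctx S) : MCtx S).bind (upCtx Δ) =
      (0, A) ::ₘ shift 1 ((Γ : MCtx S).bind Δ) := bind_upCtx Δ Γ A
    have h₂ := ih (σ := Tm.up σ) (Δ := upCtx Δ) (hup (m := Γ) A h) (by
      rw [eq]; exact hn.cons_shift ..)
    rw [eq] at h₂
    exact h₂.lam

theorem MT.rename {m : MCtx S} {v : Tm S} {A : Ty S.Ground} (h : MT m v A) (ρ : ℕ → ℕ)
    (hn : Nd (m.map fun p => (ρ p.1, p.2))) :
    MT (m.map fun p => (ρ p.1, p.2)) (v.rename ρ) A := by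
  obtain ⟨Γ, rfl, ⟨d⟩⟩ := h
  have e : (Γ : MCtx S).map (fun p => (ρ p.1, p.2)) = (Γ : MCtx S).bind fun p => {(ρ p.1, p.2)} :=
    (Multiset.bind_singleton _ _).symm
  rw [e] at hn ⊢
  rw [Tm.rename_eq_subst]
  -- Allowing only variables makes closure under shifting trivial. With `K := MT` that closure is an
  -- instance of the present lemma, so renamings have to be treated first.
  refine Der.subst_of (K := fun m v A => ∃ k, m = {(k, A)} ∧ v = .var k) ?_ ?_ ?_ d ?_ hn
  · rintro _ _ _ ⟨k, rfl, rfl⟩; exact .var ..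
  · exact fun n A => ⟨n, rfl, rfl⟩
  · rintro _ _ _ ⟨k, rfl, rfl⟩; exact ⟨k + 1, by simp, rfl⟩
  · exact fun p _ => ⟨_, rfl, rfl⟩

theorem MT.rename_add {m : MCtx S} {v : Tm S} {A : Ty S.Ground} (h : MT m v A) (k : ℕ) :
    MT (m.shift k) (v.rename (· + k)) A := h.rename (· + k) (h.nd.shift k)

theorem MT.subst {m : MCtx S} {v : Tm S} {A : Ty S.Ground} (h : MT m v A)
    {σ : ℕ → Tm S} {Δ : ℕ × Ty S.Ground → MCtx S} (hσ : ∀ p ∈ m, MT (Δ p) (σ p.1) p.2)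
    (hn : Nd (m.bind Δ)) : MT (m.bind Δ) (v.subst σ) A := by
  obtain ⟨Γ, rfl, ⟨d⟩⟩ := h
  exact Der.subst_of (K := MT) (fun _ _ _ h => h) .var (fun _ _ _ h => h.rename_add 1) d hσ hn

end

section

open MCtx

/-! ### Typing of substitution for one or two variables -/

section Single

variable {S : Signature.{u, w}} {m n k : MCtx S} {v t s : Tm S} {A B C : Ty S.Ground}

theorem bind_eq_self {Δ : ℕ × Ty S.Ground → MCtx S} (h : ∀ p ∈ m, Δ p = {p}) : m.bind Δ = m := by
  rw [Multiset.bind_congr h, Multiset.bind_singleton, Multiset.map_id']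

theorem MCtx.exists_coe (m : MCtx S) : ∃ Γ : Ctx S, (Γ : MCtx S) = m := Quot.exists_rep m

theorem MCtx.Nd.ne {z : ℕ} (h : Nd ((z, A) ::ₘ m)) {p : ℕ × Ty S.Ground} (hp : p ∈ m) :
    p.1 ≠ z := fun e => (nd_cons.1 h).1 (Multiset.mem_map.2 ⟨p, hp, e⟩)

theorem MCtx.Nd.ne_of_add (h : Nd (m + n)) {p q : ℕ × Ty S.Ground} (hp : p ∈ m) (hq : q ∈ n) :
    p.1 ≠ q.1 := fun e => by
  rw [Nd, Multiset.map_add, Multiset.nodup_add] at h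
  exact Multiset.disjoint_left.1 h.2.2 (Multiset.mem_map_of_mem _ hp)
    (e ▸ Multiset.mem_map_of_mem _ hq)

theorem MT.sub {z : ℕ} (h : MT ((z, A) ::ₘ m) v C) (h' : MT n s A) (hn : Nd (m + n)) :
    MT (m + n) (v.sub z s) C := by
  -- A single substitution is the simultaneous one that replaces `z` by the context `n` and every
  -- other variable by itself.
  let Δ : ℕ × Ty S.Ground → MCtx S := fun p => if p.1 = z then n else {p}
  have e : ((z, A) ::ₘ m).bind Δ = m + n := by
    rw [Multiset.cons_bind, add_comm, bind_eq_self fun p hp => if_neg (h.nd.ne hp)]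
    simp [Δ]
  rw [← e] at hn ⊢
  refine h.subst (fun p hp => ?_) hn
  obtain rfl | hp := Multiset.mem_cons.1 hp
  · simpa [Δ] using h'
  · simpa [Δ, h.nd.ne hp] using MT.var p.1 p.2

theorem MT.inst₁ (h : MT ((0, A) ::ₘ m.shift 1) v C) (h' : MT n s A) (hn : Nd (m + n)) :
    MT (m + n) (v.inst₁ s) C := by
  let Δ : ℕ × Ty S.Ground → MCtx S := fun
    | (0, _) => n
    | (k + 1, B) => {(k, B)}
  have e : ((0, A) ::ₘ m.shift 1).bind Δ = m + n := by
    rw [Multiset.cons_bind, MCtx.shift, Multiset.bind_map, add_comm]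
    exact congrArg (· + n) (bind_eq_self fun _ _ => rfl)
  rw [← e] at hn ⊢
  refine h.subst (fun p hp => ?_) hn
  simp only [Multiset.mem_cons, MCtx.shift, Multiset.mem_map] at hp
  obtain rfl | ⟨p, hp, rfl⟩ := hp
  · exact h'
  · exact .var ..

theorem MT.inst₂ (h : MT ((0, B) ::ₘ (1, A) ::ₘ k.shift 2) s C) (h₁ : MT m v A) (h₂ : MT n t B)
    (hn : Nd (m + n + k)) : MT (m + n + k) (s.inst₂ v t) C := by
  let Δ : ℕ × Ty S.Ground → MCtx S := fun
    | (0, _) => n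
    | (1, _) => m
    | (k + 2, B) => {(k, B)}
  have e : ((0, B) ::ₘ (1, A) ::ₘ k.shift 2).bind Δ = m + n + k := by
    rw [Multiset.cons_bind, Multiset.cons_bind, MCtx.shift, Multiset.bind_map, ← add_assoc,
      add_comm m n]
    exact congrArg (n + m + ·) (bind_eq_self fun _ _ => rfl)
  rw [← e] at hn ⊢
  refine h.subst (fun p hp => ?_) hn
  simp only [Multiset.mem_cons, MCtx.shift, Multiset.mem_map] at hp
  obtain rfl | rfl | ⟨p, hp, rfl⟩ := hp
  · exact h₂
  · exact h₁
  · exact .var ..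

theorem MT.subUnder₂ {z : ℕ} (h : MT ((z, .tensor A B) ::ₘ m) s C) :
    MT ((0, B) ::ₘ (1, A) ::ₘ m.shift 2) (s.subUnder₂ z (.tens (.var 1) (.var 0))) C := by
  let Δ : ℕ × Ty S.Ground → MCtx S := fun p =>
    if p.1 = z then {(1, A), (0, B)} else {(p.1 + 2, p.2)}
  have e : ((z, .tensor A B) ::ₘ m).bind Δ = (0, B) ::ₘ (1, A) ::ₘ m.shift 2 := by
    rw [Multiset.cons_bind, Multiset.bind_congr fun p hp => if_neg (h.nd.ne hp),
      Multiset.bind_singleton, Multiset.cons_swap]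
    simp [Δ, MCtx.shift]
  rw [← e]
  refine h.subst (fun p hp => ?_) ?_
  · obtain rfl | hp := Multiset.mem_cons.1 hp
    · simpa [Δ] using (MT.var 1 A).tens (MT.var 0 B) (by simp [Nd])
    · simpa [Δ, h.nd.ne hp] using MT.var (p.1 + 2) p.2
  · rw [e]; exact (nd_cons.1 h.nd).2.cons_cons_shift ..

end Single

/-! ## The distance of terms -/

variable {S : Signature.{u, w}} {V : Type x} [CommMonoid V] [CompleteLattice V] {B : Set V}
  {Ax : Set (VEq S B)}

/-- The join of the labels `q` of all theorems `v =_q t` in a context without order. -/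
def D (Ax : Set (VEq S B)) (m : MCtx S) (v t : Tm S) (A : Ty S.Ground) : V :=
  sSup {q | ∃ Γ : Ctx S, (Γ : MCtx S) = m ∧ Thm Ax Γ v q t A}

variable {m n k : MCtx S} {v t s v' t' : Tm S} {A A' C E : Ty S.Ground}

/-- By the exchange rule every ordering of the context admits the same labels, so the join over all
orderings may be computed in one of them. -/
theorem D_coe (Γ : Ctx S) : D Ax (Γ : MCtx S) v t A = sSup {q | Thm Ax Γ v q t A} :=
  congrArg sSup <| Set.ext fun _ => ⟨fun ⟨_, h, h'⟩ => h'.exch (Multiset.coe_eq_coe.1 h).symm,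
    fun h => ⟨Γ, rfl, h⟩⟩

theorem le_D_of_thm {q : V} {Γ : Ctx S} (h : Thm Ax Γ v q t A) : q ≤ D Ax (Γ : MCtx S) v t A :=
  le_sSup ⟨Γ, rfl, h⟩

theorem one_le_D_self (h : MT m v A) : 1 ≤ D Ax m v v A := by
  obtain ⟨Γ, rfl, h⟩ := h
  exact le_top.trans (le_D_of_thm (.refl h))

/-- `v` and `t` are identified in the separated quotient. -/
structure Eqv (Ax : Set (VEq S B)) (m : MCtx S) (v t : Tm S) (A : Ty S.Ground) : Prop where
  left : MT m v A
  right : MT m t A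
  le : 1 ≤ D Ax m v t A
  ge : 1 ≤ D Ax m t v A

theorem Eqv.symm (h : Eqv Ax m v t A) : Eqv Ax m t v A := ⟨h.2, h.1, h.4, h.3⟩

theorem Eqv.refl (h : MT m v A) : Eqv Ax m v v A := ⟨h, h, one_le_D_self h, one_le_D_self h⟩

theorem Eqv.cast (h : Eqv Ax m v t A) (e : m = n) : Eqv Ax n v t A := e ▸ h

theorem Eqv.of_base {Γ : Ctx S} (h : BaseEq Γ v t A) (hv : MT (Γ : MCtx S) v A)
    (ht : MT (Γ : MCtx S) t A) : Eqv Ax Γ v t A :=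
  ⟨hv, ht, le_top.trans (le_D_of_thm (.base h)), le_top.trans (le_D_of_thm (.base_symm h))⟩

theorem Eqv.unit_beta (h : MT m v A) : Eqv Ax m (.unitE .star v) v A := by
  obtain ⟨Γ, rfl, d⟩ := h
  exact .of_base (.unit_beta d) ((MT.star.unitE (.of_typed d) (by
    rw [zero_add]; exact MT.nd (.of_typed d))).cast (zero_add _)) (.of_typed d)

theorem Eqv.unit_eta {z : ℕ} (h : MT m v .unit) (h' : MT ((z, .unit) ::ₘ k) s C)
    (hn : Nd (k + m)) : Eqv Ax (k + m) (.unitE v (s.sub z .star)) (s.sub z v) C := by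
  obtain ⟨Γ, rfl, d⟩ := h
  obtain ⟨Θ, rfl⟩ := exists_coe k
  have h₁ : MT (Θ : MCtx S) (s.sub z .star) C :=
    (h'.sub MT.star (by rw [add_zero]; exact hn.left)).cast (add_zero _)
  exact .of_base (Γ := Θ ++ Γ) (.unit_eta d (MT.typed (Γ := (z, .unit) :: Θ) h') (nd_coe.1 hn))
    (((MT.of_typed d).unitE h₁ (add_comm (_ : MCtx S) _ ▸ hn)).cast (add_comm _ _))
    (h'.sub (.of_typed d) hn)

theorem Eqv.tens_beta (h : MT m v A) (h' : MT n t A')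
    (hs : MT ((0, A') ::ₘ (1, A) ::ₘ k.shift 2) s C) (hn : Nd (m + n + k)) :
    Eqv Ax (m + n + k) (.pm (.tens v t) s) (s.inst₂ v t) C := by
  obtain ⟨Γ, rfl, d⟩ := h
  obtain ⟨Δ, rfl, d'⟩ := h'
  obtain ⟨Θ, rfl⟩ := exists_coe k
  have e : ((Θ ++ Δ ++ Γ : Ctx S) : MCtx S) = (Γ + Δ + Θ : MCtx S) := by
    rw [← Multiset.coe_add, ← Multiset.coe_add]; abel
  refine Eqv.cast ?_ e
  refine .of_base (.tens_beta (A := A) (B := A') d d'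
    (MT.typed (Γ := (0, A') :: (1, A) :: Ctx.shift 2 Θ) hs) (nd_coe.1 (e ▸ hn))) ?_ ?_
  · rw [e]
    exact ((MT.of_typed d).tens (.of_typed d') hn.left).pm hs hn
  · rw [e]
    exact hs.inst₂ (.of_typed d) (.of_typed d') hn

theorem Eqv.tens_eta {z : ℕ} (h : MT m v (.tensor A A')) (h' : MT ((z, .tensor A A') ::ₘ k) s C)
    (hn : Nd (k + m)) :
    Eqv Ax (k + m) (.pm v (s.subUnder₂ z (.tens (.var 1) (.var 0)))) (s.sub z v) C := by
  obtain ⟨Γ, rfl, d⟩ := h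
  obtain ⟨Θ, rfl⟩ := exists_coe k
  exact .of_base (Γ := Θ ++ Γ)
    (.tens_eta d (MT.typed (Γ := (z, .tensor A A') :: Θ) h') (nd_coe.1 hn))
    (((MT.of_typed d).pm h'.subUnder₂ (add_comm (_ : MCtx S) _ ▸ hn)).cast (add_comm _ _))
    (h'.sub (.of_typed d) hn)

theorem Eqv.lolli_beta (h : MT ((0, A) ::ₘ m.shift 1) v C) (h' : MT n t A) (hn : Nd (m + n)) :
    Eqv Ax (m + n) (.app (.lam A v) t) (v.inst₁ t) C := by
  obtain ⟨Γ, rfl⟩ := exists_coe m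
  obtain ⟨Δ, rfl, d'⟩ := h'
  have e : ((Δ ++ Γ : Ctx S) : MCtx S) = (Γ + Δ : MCtx S) := by
    rw [← Multiset.coe_add]; abel
  refine Eqv.cast ?_ e
  refine .of_base (.lolli_beta (A := A)
    (MT.typed (Γ := (0, A) :: Ctx.shift 1 Γ) h) d' (nd_coe.1 (e ▸ hn))) ?_ ?_
  · rw [e]
    exact h.lam.app (.of_typed d') hn
  · rw [e]
    exact h.inst₁ (.of_typed d') hn

theorem Eqv.lolli_eta (h : MT m v (.lolli A C)) :
    Eqv Ax m (.lam A (.app (v.rename Nat.succ) (.var 0))) v (.lolli A C) := by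
  obtain ⟨Γ, rfl, d⟩ := h
  have e : MCtx.shift 1 (Γ : MCtx S) + {(0, A)} = (0, A) ::ₘ MCtx.shift 1 (Γ : MCtx S) := by
    rw [add_comm, Multiset.singleton_add]
  refine .of_base (.lolli_eta d) ?_ (.of_typed d)
  refine .lam (.cast (((MT.of_typed d).rename_add 1).app (.var 0 A) ?_) e)
  rw [e]
  exact (MT.of_typed d).nd.cons_shift A

theorem D_lam : D Ax ((0, A) ::ₘ m.shift 1) v t C ≤ D Ax m (.lam A v) (.lam A t) (.lolli A C) := by
  obtain ⟨Γ, rfl⟩ := exists_coe m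
  refine sSup_le ?_
  rintro q ⟨Γ', e, h⟩
  exact le_D_of_thm (Thm.lam (h.exch (Δ := (0, A) :: Ctx.shift 1 Γ)
    (Multiset.coe_eq_coe.1 e).symm))

theorem Eqv.lam (h : Eqv Ax ((0, A) ::ₘ m.shift 1) v t C) :
    Eqv Ax m (.lam A v) (.lam A t) (.lolli A C) :=
  ⟨h.1.lam, h.2.lam, h.3.trans D_lam, h.4.trans D_lam⟩

variable [IsQuantale V]

/-- Distributivity over joins turns each two-premiss rule, whose label is a product, into an
inequality between products of values of `D`. The bounds that follow are the rules of the calculus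
in this form. -/
theorem sSup_mul_sSup_le {s t : Set V} {c : V} (h : ∀ a ∈ s, ∀ b ∈ t, a * b ≤ c) :
    sSup s * sSup t ≤ c := by
  rw [IsQuantale.sSup_mul_distrib]
  refine iSup₂_le fun a ha => ?_
  rw [IsQuantale.mul_sSup_distrib]
  exact iSup₂_le fun b hb => h a ha b hb

theorem D_trans : D Ax m v t A * D Ax m t s A ≤ D Ax m v s A := by
  refine sSup_mul_sSup_le ?_
  rintro q ⟨Γ, rfl, h⟩ r ⟨Γ', e, h'⟩
  exact le_D_of_thm (h.trans (h'.exch (Multiset.coe_eq_coe.1 e).symm))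

theorem D_tens (hn : Nd (m + n)) :
    D Ax m v t A * D Ax n v' t' A' ≤ D Ax (m + n) (.tens v v') (.tens t t') (.tensor A A') := by
  refine sSup_mul_sSup_le ?_
  rintro q ⟨Γ, rfl, h⟩ r ⟨Δ, rfl, h'⟩
  exact le_D_of_thm (h.tens h' (.append ..) (nd_coe.1 hn))

theorem D_unitE (hn : Nd (m + n)) :
    D Ax m v t .unit * D Ax n v' t' A' ≤ D Ax (m + n) (.unitE v v') (.unitE t t') A' := by
  refine sSup_mul_sSup_le ?_
  rintro q ⟨Γ, rfl, h⟩ r ⟨Δ, rfl, h'⟩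
  exact le_D_of_thm (h.unitE h' (.append ..) (nd_coe.1 hn))

theorem D_app (hn : Nd (m + n)) :
    D Ax m v t (.lolli A A') * D Ax n v' t' A ≤ D Ax (m + n) (.app v v') (.app t t') A' := by
  refine sSup_mul_sSup_le ?_
  rintro q ⟨Γ, rfl, h⟩ r ⟨Δ, rfl, h'⟩
  exact le_D_of_thm (h.app h' (.append ..) (nd_coe.1 hn))

theorem D_pm (hn : Nd (m + n)) :
    D Ax m v t (.tensor A A') * D Ax ((0, A') ::ₘ (1, A) ::ₘ n.shift 2) v' t' C ≤
      D Ax (m + n) (.pm v v') (.pm t t') C := by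
  obtain ⟨Δ, rfl⟩ := exists_coe n
  refine sSup_mul_sSup_le ?_
  rintro q ⟨Γ, rfl, h⟩ r ⟨Δ', e, h'⟩
  exact le_D_of_thm (h.pm (h'.exch (Δ := (0, A') :: (1, A) :: Ctx.shift 2 Δ)
    (Multiset.coe_eq_coe.1 e).symm) (.append ..) (nd_coe.1 hn))

theorem D_sub {z : ℕ} (hn : Nd (m + n)) :
    D Ax ((z, A) ::ₘ m) v t C * D Ax n v' t' A ≤ D Ax (m + n) (v.sub z v') (t.sub z t') C := by
  obtain ⟨Γ, rfl⟩ := exists_coe m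
  refine sSup_mul_sSup_le ?_
  rintro q ⟨Γ', e, h⟩ r ⟨Δ, rfl, h'⟩
  have := le_D_of_thm (Thm.subst (h.exch (Δ := (z, A) :: Γ) (Multiset.coe_eq_coe.1 e).symm) h'
    (nd_coe.1 (by rw [← Multiset.coe_add, add_comm]; exact hn)))
  rwa [← Multiset.coe_add, add_comm] at this

end

section

open MCtx

/-! ## Simultaneous substitution -/

variable {S : Signature.{u, w}} {V : Type x} [CommMonoid V] [CompleteLattice V] [IsQuantale V]
  {B : Set V} {Ax : Set (VEq S B)}
  {m n k : MCtx S} {v t s v' t' s' : Tm S} {A A' C E : Ty S.Ground}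

theorem one_le_mul_of {a b : V} (ha : 1 ≤ a) (hb : 1 ≤ b) : 1 ≤ a * b :=
  (mul_one (1 : V)).symm.trans_le (mul_le_mul' ha hb)

theorem le_mul_of_one_le {a b : V} (hb : 1 ≤ b) : a ≤ a * b :=
  (mul_one a).symm.trans_le (mul_le_mul' le_rfl hb)

theorem le_mul_of_one_le_left {a b : V} (hb : 1 ≤ b) : a ≤ b * a :=
  (one_mul a).symm.trans_le (mul_le_mul' hb le_rfl)

theorem Eqv.trans (h : Eqv Ax m v t A) (h' : Eqv Ax m t s A) : Eqv Ax m v s A :=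
  ⟨h.1, h'.2, (one_le_mul_of h.3 h'.3).trans D_trans, (one_le_mul_of h'.4 h.4).trans D_trans⟩

/-- Two triangle inequalities with factors above the unit: distances descend to the separated
quotient. -/
theorem D_le_of_eqv (h : Eqv Ax m v v' A) (h' : Eqv Ax m t t' A) :
    D Ax m v t A ≤ D Ax m v' t' A :=
  ((le_mul_of_one_le h'.3).trans D_trans).trans ((le_mul_of_one_le_left h.4).trans D_trans)

theorem Eqv.tens (h : Eqv Ax m v t A) (h' : Eqv Ax n v' t' A') (hn : Nd (m + n)) :
    Eqv Ax (m + n) (.tens v v') (.tens t t') (.tensor A A') :=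
  ⟨h.1.tens h'.1 hn, h.2.tens h'.2 hn, (one_le_mul_of h.3 h'.3).trans (D_tens hn),
    (one_le_mul_of h.4 h'.4).trans (D_tens hn)⟩

theorem Eqv.unitE (h : Eqv Ax m v t .unit) (h' : Eqv Ax n v' t' A') (hn : Nd (m + n)) :
    Eqv Ax (m + n) (.unitE v v') (.unitE t t') A' :=
  ⟨h.1.unitE h'.1 hn, h.2.unitE h'.2 hn, (one_le_mul_of h.3 h'.3).trans (D_unitE hn),
    (one_le_mul_of h.4 h'.4).trans (D_unitE hn)⟩

theorem Eqv.app (h : Eqv Ax m v t (.lolli A A')) (h' : Eqv Ax n v' t' A) (hn : Nd (m + n)) :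
    Eqv Ax (m + n) (.app v v') (.app t t') A' :=
  ⟨h.1.app h'.1 hn, h.2.app h'.2 hn, (one_le_mul_of h.3 h'.3).trans (D_app hn),
    (one_le_mul_of h.4 h'.4).trans (D_app hn)⟩

theorem Eqv.pm (h : Eqv Ax m v t (.tensor A A'))
    (h' : Eqv Ax ((0, A') ::ₘ (1, A) ::ₘ n.shift 2) v' t' C) (hn : Nd (m + n)) :
    Eqv Ax (m + n) (.pm v v') (.pm t t') C :=
  ⟨h.1.pm h'.1 hn, h.2.pm h'.2 hn, (one_le_mul_of h.3 h'.3).trans (D_pm hn),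
    (one_le_mul_of h.4 h'.4).trans (D_pm hn)⟩

/-- The substitution that agrees with `σ` on the variables of `L` and leaves the others alone. -/
def substOn (L : Ctx S) (σ : ℕ → Tm S) (n : ℕ) : Tm S :=
  if n ∈ L.map Prod.fst then σ n else .var n

/-- Disjointness ensures that the remaining substitutions do not act on the variables just
introduced by `σ p.1`, so substituting successively or at once is the same. -/
theorem sub_substOn {σ : ℕ → Tm S} {p : ℕ × Ty S.Ground} {L : Ctx S} {A : Ty S.Ground}
    (h : MT m (σ p.1) A) (hn : Nd (m + (L : MCtx S))) (v : Tm S) :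
    (v.sub p.1 (σ p.1)).subst (substOn L σ) = v.subst (substOn (p :: L) σ) := by
  rw [Tm.sub, Tm.subst_subst]
  congr 1
  funext j
  by_cases hj : j = p.1
  · subst hj
    simp only [if_true, substOn, List.map_cons, List.mem_cons, true_or]
    refine h.subst_eq_self fun q hq => if_neg fun hL => ?_
    obtain ⟨r, hr, e⟩ := List.mem_map.1 hL
    exact hn.ne_of_add hq (Multiset.mem_coe.2 hr) e.symm
  · simp only [hj, if_false, Tm.subst, substOn, List.map_cons, List.mem_cons, false_or]

/-- The calculus only has substitution for one variable; it is iterated along `L`. The parameter `Θ`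
collects the contexts of the terms already substituted. -/
theorem D_substOn {σ σ' : ℕ → Tm S} {Δ : ℕ × Ty S.Ground → MCtx S} : ∀ (L : Ctx S)
    (Θ : MCtx S) (v t : Tm S), (∀ p ∈ L, Eqv Ax (Δ p) (σ p.1) (σ' p.1) p.2) →
    Nd ((L : MCtx S).bind Δ + (Θ + (L : MCtx S))) →
    D Ax (Θ + (L : MCtx S)) v t C ≤
      D Ax ((L : MCtx S).bind Δ + Θ) (v.subst (substOn L σ)) (t.subst (substOn L σ')) C
  | [], Θ, v, t, _, _ => by
    have e : ∀ σ : ℕ → Tm S, substOn [] σ = .var := fun σ => funext fun n => if_neg (by simp)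
    simp [e, Tm.subst_var]
  | p :: L, Θ, v, t, hσ, hn => by
    have hp := hσ p List.mem_cons_self
    have e₁ : Θ + ((p :: L : Ctx S) : MCtx S) = p ::ₘ (Θ + (L : MCtx S)) := by
      rw [← Multiset.cons_coe, Multiset.add_cons]
    have e₂ : ((p :: L : Ctx S) : MCtx S).bind Δ = Δ p + (L : MCtx S).bind Δ := by
      rw [← Multiset.cons_coe, Multiset.cons_bind]
    rw [e₂, e₁, Multiset.add_cons] at hn
    have hn' := (nd_cons.1 hn).2
    have e₃ : Δ p + (L : MCtx S).bind Δ + (Θ + (L : MCtx S)) =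
        (L : MCtx S).bind Δ + (Θ + Δ p + (L : MCtx S)) := by abel
    have e₄ : Θ + (L : MCtx S) + Δ p = Θ + Δ p + (L : MCtx S) := by abel
    have hn₁ : Nd (Θ + (L : MCtx S) + Δ p) := hn'.of_le (by
      rw [e₃, ← e₄]; exact Multiset.le_add_left ..)
    have hn₂ : Nd (Δ p + (L : MCtx S)) := hn₁.of_le (by
      rw [e₄, add_assoc]; exact Multiset.le_add_left ..)
    have h₁ : D Ax (Θ + ((p :: L : Ctx S) : MCtx S)) v t C ≤
        D Ax (Θ + Δ p + (L : MCtx S)) (v.sub p.1 (σ p.1)) (t.sub p.1 (σ' p.1)) C := by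
      rw [e₁, ← e₄]
      exact (le_mul_of_one_le hp.3).trans (D_sub hn₁)
    refine h₁.trans ((D_substOn L (Θ + Δ p) _ _ (fun q hq => hσ q (List.mem_cons_of_mem _ hq))
      (e₃ ▸ hn')).trans ?_)
    rw [sub_substOn hp.1 hn₂, sub_substOn hp.2 hn₂, e₂]
    exact le_of_eq (congrArg (fun m => D Ax m _ _ C) (by abel))

theorem substOn_self {Γ : Ctx S} (hv : MT (Γ : MCtx S) v A) (σ : ℕ → Tm S) :
    v.subst (substOn Γ σ) = v.subst σ :=
  hv.subst_congr fun _ hp => if_pos (List.mem_map_of_mem (f := Prod.fst) (Multiset.mem_coe.1 hp))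

theorem D_subst_of_disjoint {σ σ' : ℕ → Tm S} {Δ : ℕ × Ty S.Ground → MCtx S}
    (hv : MT m v A) (ht : MT m t A) (hσ : ∀ p ∈ m, Eqv Ax (Δ p) (σ p.1) (σ' p.1) p.2)
    (hn : Nd (m.bind Δ + m)) :
    D Ax m v t A ≤ D Ax (m.bind Δ) (v.subst σ) (t.subst σ') A := by
  obtain ⟨L, rfl⟩ := exists_coe m
  have := D_substOn (Ax := Ax) (C := A) L 0 v t hσ (by rwa [zero_add])
  rwa [zero_add, add_zero, substOn_self hv, substOn_self ht] at this

theorem nd_add_of_lt {N : ℕ} (hm : Nd m) (hn : Nd n) (h : ∀ p ∈ m, p.1 < N)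
    (h' : ∀ p ∈ n, N ≤ p.1) : Nd (m + n) := by
  rw [Nd, Multiset.map_add, Multiset.nodup_add]
  refine ⟨hm, hn, Multiset.disjoint_left.2 fun {a} ha hb => ?_⟩
  obtain ⟨p, hp, rfl⟩ := Multiset.mem_map.1 ha
  obtain ⟨q, hq, e⟩ := Multiset.mem_map.1 hb
  exact absurd (h p hp) (not_lt.2 (e ▸ h' q hq))

/-- A number above all variables of a context. -/
theorem exists_bound (m : MCtx S) : ∃ N, ∀ p ∈ m, p.1 < N := by
  refine ⟨(m.map Prod.fst).sum + 1, fun p hp => Nat.lt_succ_of_le ?_⟩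
  exact Multiset.le_sum_of_mem (Multiset.mem_map_of_mem _ hp)

/-- New contexts may reuse old variable names, which would break an iterated substitution. All
variables are therefore first renamed to fresh ones, and the terms are substituted for those; both
steps fall under the disjoint case. -/
theorem D_subst {σ σ' : ℕ → Tm S} {Δ : ℕ × Ty S.Ground → MCtx S}
    (hv : MT m v A) (ht : MT m t A) (hσ : ∀ p ∈ m, Eqv Ax (Δ p) (σ p.1) (σ' p.1) p.2)
    (hn : Nd (m.bind Δ)) :
    D Ax m v t A ≤ D Ax (m.bind Δ) (v.subst σ) (t.subst σ') A := by
  -- Shifting by `N` moves the variables above everything in the source and in the target context.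
  obtain ⟨N, hN⟩ := exists_bound (m + m.bind Δ)
  have hlt : ∀ {j : MCtx S}, j ≤ m + m.bind Δ → ∀ p ∈ j, p.1 < N :=
    fun h p hp => hN p (Multiset.mem_of_le h hp)
  have hge : ∀ p ∈ m.shift N, N ≤ p.1 := by
    intro p hp
    obtain ⟨q, _, rfl⟩ := Multiset.mem_map.1 hp
    exact Nat.le_add_left ..
  have e₁ : m.bind (fun p => ({(p.1 + N, p.2)} : MCtx S)) = m.shift N := Multiset.bind_singleton ..
  have h₁ := D_subst_of_disjoint (Ax := Ax) (σ := fun j => .var (j + N))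
    (σ' := fun j => .var (j + N)) (Δ := fun p => {(p.1 + N, p.2)}) hv ht
    (fun p _ => .refl (.var _ _)) (by
      rw [e₁, add_comm]
      exact nd_add_of_lt hv.nd (hv.nd.shift N) (hlt (Multiset.le_add_right ..)) hge)
  rw [e₁] at h₁
  have e₂ : (m.shift N).bind (fun p => Δ (p.1 - N, p.2)) = m.bind Δ := by
    simp [MCtx.shift, Multiset.bind_map]
  have e₃ : ∀ r : Tm S, r.rename (· + N) = r.subst fun j => .var (j + N) :=
    fun r => Tm.rename_eq_subst r _
  have h₂ := D_subst_of_disjoint (Ax := Ax) (σ := fun j => σ (j - N)) (σ' := fun j => σ' (j - N))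
    (Δ := fun p => Δ (p.1 - N, p.2)) (hv.rename_add N) (ht.rename_add N) (by
      intro p hp
      obtain ⟨q, hq, rfl⟩ := Multiset.mem_map.1 hp
      simpa using hσ q hq) (by
      rw [e₂]
      exact nd_add_of_lt hn (hv.nd.shift N) (hlt (Multiset.le_add_left ..)) hge)
  rw [e₂, e₃, e₃, Tm.subst_subst, Tm.subst_subst] at h₂
  simpa [Tm.subst] using h₁.trans h₂

theorem Eqv.subst {σ σ' : ℕ → Tm S} {Δ : ℕ × Ty S.Ground → MCtx S}
    (h : Eqv Ax m v t A) (hσ : ∀ p ∈ m, Eqv Ax (Δ p) (σ p.1) (σ' p.1) p.2)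
    (hn : Nd (m.bind Δ)) : Eqv Ax (m.bind Δ) (v.subst σ) (t.subst σ') A :=
  ⟨h.1.subst (fun p hp => (hσ p hp).1) hn, h.2.subst (fun p hp => (hσ p hp).2) hn,
    h.3.trans (D_subst h.1 h.2 hσ hn),
    h.4.trans (D_subst h.2 h.1 (fun p hp => (hσ p hp).symm) hn)⟩

end

section

open MCtx

/-! ## Pattern matching -/

/-- Patterns built from variables. -/
inductive Pat (S : Signature.{u, w}) : Type u
  | var (n : ℕ) (A : Ty S.Ground) : Pat S
  | unit : Pat S
  | tens (P Q : Pat S) : Pat S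

namespace Pat

variable {S : Signature.{u, w}}

/-- The type of a pattern. -/
def ty : Pat S → Ty S.Ground
  | var _ A => A
  | unit => .unit
  | tens P Q => .tensor P.ty Q.ty

/-- The variables of a pattern. -/
def ctx : Pat S → MCtx S
  | var n A => {(n, A)}
  | unit => 0
  | tens P Q => P.ctx + Q.ctx

/-- A pattern as a term. -/
def tm : Pat S → Tm S
  | var n _ => .var n
  | unit => .star
  | tens P Q => .tens P.tm Q.tm

theorem typed : ∀ {P : Pat S}, Nd P.ctx → MT P.ctx P.tm P.ty
  | var n A, _ => .var n A
  | unit, _ => .star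
  | tens P Q, h => (typed (P := P) h.left).tens (typed (P := Q) h.right) h

end Pat

variable {S : Signature.{u, w}} {V : Type x} [CommMonoid V] [CompleteLattice V]
  {B : Set V} {Ax : Set (VEq S B)} {m n k Θ : MCtx S} {v t s v' t' s' p : Tm S}
  {X Y A A' C E : Ty S.Ground} {z : ℕ}

/-- `F` takes terms `t` in the context `m`, which extends `Θ` by the variables of `p`, to terms in
the context `Θ, z : X` that match `z` with the pattern `p` and then proceed as `t`. -/
structure Elim (Ax : Set (VEq S B)) (m : MCtx S) (p : Tm S) (X : Ty S.Ground) (z : ℕ)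
    (Θ : MCtx S) (C : Ty S.Ground) (F : Tm S → Tm S) : Prop where
  beta {t : Tm S} : MT m t C →
    MT ((z, X) ::ₘ Θ) (F t) C ∧ Eqv Ax m ((F t).sub z p) t C
  le {t t' : Tm S} : MT m t C → MT m t' C →
    D Ax m t t' C ≤ D Ax ((z, X) ::ₘ Θ) (F t) (F t') C
  eta {s : Tm S} : MT ((z, X) ::ₘ Θ) s C → Eqv Ax ((z, X) ::ₘ Θ) (F (s.sub z p)) s C

theorem Elim.eqv {F : Tm S → Tm S} (hF : Elim Ax m p X z Θ C F) (h : Eqv Ax m t t' C) :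
    Eqv Ax ((z, X) ::ₘ Θ) (F t) (F t') C :=
  ⟨(hF.beta h.1).1, (hF.beta h.2).1, h.3.trans (hF.le h.1 h.2), h.4.trans (hF.le h.2 h.1)⟩

theorem MT.sub_eq_self (h : MT m t A) (hz : z ∉ m.map Prod.fst) (s : Tm S) : t.sub z s = t :=
  h.subst_eq_self fun _ hq => if_neg fun e => hz (Multiset.mem_map.2 ⟨_, hq, e⟩)

theorem sub_var_self (t : Tm S) (z : ℕ) : t.sub z (.var z) = t := by
  have : (fun n => if n = z then Tm.var z else .var n : ℕ → Tm S) = .var := by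
    funext n; split_ifs with h
    · rw [h]
    · rfl
  rw [Tm.sub, this, Tm.subst_var]

theorem sub_var_sub (h : MT ((z, X) ::ₘ Θ) t C) {a : ℕ} (ha : a ∉ Θ.map Prod.fst) (s : Tm S) :
    (t.sub z (.var a)).sub a s = t.sub z s := by
  rw [Tm.sub, Tm.sub, Tm.subst_subst]
  refine h.subst_congr fun q hq => ?_
  obtain rfl | hq := Multiset.mem_cons.1 hq
  · simp [Tm.subst]
  · have : q.1 ≠ a := fun e => ha (Multiset.mem_map.2 ⟨_, hq, e⟩)
    simp [h.nd.ne hq, Tm.subst, this]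

variable [IsQuantale V]

theorem Eqv.sub (h : Eqv Ax ((z, A) ::ₘ m) v t C) (h' : Eqv Ax n s s' A) (hn : Nd (m + n)) :
    Eqv Ax (m + n) (v.sub z s) (t.sub z s') C :=
  ⟨h.1.sub h'.1 hn, h.2.sub h'.2 hn, (one_le_mul_of h.3 h'.3).trans (D_sub hn),
    (one_le_mul_of h.4 h'.4).trans (D_sub hn)⟩

theorem D_sub_le (h : MT n s A) (hn : Nd (m + n)) :
    D Ax ((z, A) ::ₘ m) v t C ≤ D Ax (m + n) (v.sub z s) (t.sub z s) C :=
  (le_mul_of_one_le (one_le_D_self h)).trans (D_sub hn)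

/-- Matching with a variable is renaming. -/
theorem elim_var {a : ℕ} (ha : Nd ({(a, A)} + Θ)) (hz : Nd ((z, A) ::ₘ Θ)) :
    Elim Ax ({(a, A)} + Θ) (.var a) A z Θ C fun t => t.sub a (.var z) := by
  have e : ∀ b : ℕ, Θ + {(b, A)} = (b, A) ::ₘ Θ := fun b => by
    rw [add_comm, Multiset.singleton_add]
  rw [Multiset.singleton_add] at ha
  refine ⟨fun {t} h => ?_, fun {t t'} h h' => ?_, fun {s} h => ?_⟩
  · rw [Multiset.singleton_add] at h ⊢
    refine ⟨(h.sub (.var z A) (e z ▸ hz)).cast (e z), ?_⟩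
    rw [sub_var_sub h (nd_cons.1 hz).1, sub_var_self]
    exact .refl h
  · have := D_sub_le (Ax := Ax) (z := a) (v := t) (t := t') (C := C) (MT.var z A) (e z ▸ hz)
    rwa [e] at this
  · rw [sub_var_sub h (nd_cons.1 ha).1, sub_var_self]
    exact .refl h

/-- The laws of `Elim` are here β, compatibility and η of `to ∗`, applied to the variable `z`. -/
theorem elim_unit (hz : Nd ((z, .unit) ::ₘ Θ)) :
    Elim Ax Θ .star .unit z Θ C fun t => .unitE (.var z) t := by
  have e : {(z, .unit)} + Θ = (z, .unit) ::ₘ Θ := Multiset.singleton_add ..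
  refine ⟨fun {t} h => ?_, fun {t t'} h h' => ?_, fun {s} h => ?_⟩
  · refine ⟨((MT.var z .unit).unitE h (e ▸ hz)).cast e, ?_⟩
    have : (Tm.unitE (.var z) t).sub z .star = .unitE .star (t.sub z .star) := by
      simp [Tm.sub, Tm.subst]
    rw [this, h.sub_eq_self (nd_cons.1 hz).1]
    exact .unit_beta h
  · rw [← e]
    exact (le_mul_of_one_le_left (one_le_D_self (.var z .unit))).trans (D_unitE (e ▸ hz))
  · have := Eqv.unit_eta (Ax := Ax) (MT.var z .unit) h (by rw [add_comm, e]; exact hz)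
    rwa [sub_var_self, add_comm, e] at this

theorem elim_pair {a b : ℕ} (hab : Nd ({(a, A)} + {(b, A')} + Θ))
    (hz : Nd ((z, .tensor A A') ::ₘ Θ)) :
    Elim Ax ({(a, A)} + {(b, A')} + Θ) (.tens (.var a) (.var b)) (.tensor A A') z Θ C fun t =>
      .pm (.var z) (t.subst fun j =>
        if j = a then .var 1 else if j = b then .var 0 else .var (j + 2)) := by
  -- `pm` binds the first component as variable `1` and the second as `0`, so the named variables
  -- `a`, `b` are moved there and all others are shifted by two.
  set ρ : ℕ → Tm S := fun j => if j = a then .var 1 else if j = b then .var 0 else .var (j + 2)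
    with hρ
  have ea : {(a, A)} + {(b, A')} + Θ = (a, A) ::ₘ (b, A') ::ₘ Θ := by
    rw [add_assoc, Multiset.singleton_add, Multiset.singleton_add]
  have ez : {(z, .tensor A A')} + Θ = (z, .tensor A A') ::ₘ Θ := Multiset.singleton_add ..
  have hab' := ea ▸ hab
  have hb := (nd_cons.1 hab').2
  have hba : b ≠ a := hab'.ne (p := (b, A')) (by simp)
  have ha' : ∀ q ∈ Θ, q.1 ≠ a := fun q hq => hab'.ne (Multiset.mem_cons_of_mem hq)
  have hb' : ∀ q ∈ Θ, q.1 ≠ b := fun q hq => hb.ne hq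
  have hz' : ∀ q ∈ Θ, q.1 ≠ z := fun q hq => hz.ne hq
  let Δ : ℕ × Ty S.Ground → MCtx S := fun q =>
    if q.1 = a then {(1, A)} else if q.1 = b then {(0, A')} else {(q.1 + 2, q.2)}
  have eΔ : ({(a, A)} + {(b, A')} + Θ).bind Δ = (0, A') ::ₘ (1, A) ::ₘ Θ.shift 2 := by
    rw [ea, Multiset.cons_bind, Multiset.cons_bind, Multiset.bind_congr (g := fun q =>
      {(q.1 + 2, q.2)}) fun q hq => by simp [Δ, ha' q hq, hb' q hq], Multiset.bind_singleton]
    simp [Δ, hba, MCtx.shift]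
  have hnd : Nd (({(a, A)} + {(b, A')} + Θ).bind Δ) := by
    rw [eΔ]; exact hb.of_le (Multiset.le_cons_self ..) |>.cons_cons_shift ..
  have hMT : ∀ q ∈ {(a, A)} + {(b, A')} + Θ, MT (Δ q) (ρ q.1) q.2 := by
    rw [ea]
    intro q hq
    obtain rfl | hq := Multiset.mem_cons.1 hq
    · simpa [Δ, ρ] using MT.var 1 A
    obtain rfl | hq := Multiset.mem_cons.1 hq
    · simpa [Δ, ρ, hba] using MT.var 0 A'
    · simpa [Δ, ρ, ha' q hq, hb' q hq] using MT.var (q.1 + 2) q.2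
  refine ⟨fun {t} h => ?_, fun {t t'} h h' => ?_, fun {s} h => ?_⟩
  · have h₁ := (h.subst hMT hnd).cast eΔ
    refine ⟨((MT.var z _).pm h₁ (ez ▸ hz)).cast ez, ?_⟩
    have h₂ : (Tm.pm (.var z) (t.subst ρ)).sub z (.tens (.var a) (.var b)) =
        .pm (.tens (.var a) (.var b)) (t.subst ρ) := by
      simp only [Tm.sub, Tm.subst, if_true, Tm.pm.injEq, true_and]
      rw [Tm.subst_subst]
      refine h.subst_congr ?_
      rw [ea]
      intro q hq
      obtain rfl | hq := Multiset.mem_cons.1 hq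
      · simp [ρ, Tm.subst, Tm.up, Tm.rename]
      obtain rfl | hq := Multiset.mem_cons.1 hq
      · simp [ρ, Tm.subst, Tm.up, hba]
      · simp [ρ, Tm.subst, Tm.up, Tm.rename, ha' q hq, hb' q hq, hz' q hq]
    have h₃ : (t.subst ρ).inst₂ (.var a) (.var b) = t := by
      rw [Tm.inst₂, Tm.subst_subst]
      refine h.subst_eq_self ?_
      rw [ea]
      intro q hq
      obtain rfl | hq := Multiset.mem_cons.1 hq
      · simp [ρ, Tm.subst]
      obtain rfl | hq := Multiset.mem_cons.1 hq
      · simp [ρ, Tm.subst, hba]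
      · simp [ρ, Tm.subst, ha' q hq, hb' q hq]
    have h₄ := Eqv.tens_beta (Ax := Ax) (MT.var a A) (MT.var b A') h₁ hab
    rwa [h₃, ← h₂] at h₄
  · rw [← ez]
    refine le_trans ?_ (((le_mul_of_one_le_left (one_le_D_self (.var z _))).trans
      (D_pm (ez ▸ hz))))
    rw [← eΔ]
    exact D_subst h h' (fun q hq => .refl (hMT q hq)) hnd
  · have h₁ := Eqv.tens_eta (Ax := Ax) (MT.var z _) h (by rw [add_comm, ez]; exact hz)
    rw [sub_var_self, add_comm, ez] at h₁
    have h₂ : (s.sub z (.tens (.var a) (.var b))).subst ρ =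
        s.subUnder₂ z (.tens (.var 1) (.var 0)) := by
      rw [Tm.sub, Tm.subst_subst, Tm.subUnder₂]
      refine h.subst_congr fun q hq => ?_
      obtain rfl | hq := Multiset.mem_cons.1 hq
      · simp [ρ, Tm.subst, hba]
      · simp [ρ, Tm.subst, ha' q hq, hb' q hq, hz' q hq]
    simpa only [h₂] using h₁

theorem sub_pair {a b : ℕ} (h : MT ((z, X) ::ₘ Θ) t C) (hp : MT m p A)
    (ha : a ∉ Θ.map Prod.fst) (hb : b ∉ Θ.map Prod.fst) (hab : b ≠ a) (hbp : b ∉ m.map Prod.fst)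
    (q : Tm S) :
    ((t.sub z (.tens (.var a) (.var b))).sub a p).sub b q = t.sub z (.tens p q) := by
  rw [Tm.sub, Tm.sub, Tm.sub, Tm.subst_subst, Tm.subst_subst]
  refine h.subst_congr fun r hr => ?_
  obtain rfl | hr := Multiset.mem_cons.1 hr
  · have := hp.sub_eq_self hbp q
    rw [Tm.sub] at this
    simp [Tm.subst, hab, this]
  · have h₁ : r.1 ≠ a := fun e => ha (Multiset.mem_map.2 ⟨_, hr, e⟩)
    have h₂ : r.1 ≠ b := fun e => hb (Multiset.mem_map.2 ⟨_, hr, e⟩)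
    simp [h.nd.ne hr, Tm.subst, h₁, h₂]

/-- Nested matching: `z` is split as `a ⊗ b`, then `a` is matched with `p` and `b` with `q`. Dually,
the substitution of `p ⊗ q` for `z` factors through `a ⊗ b`, then `p` for `a`, then `q` for `b`, and
the three pairs of mutually inverse operations are composed. -/
theorem Elim.tens {a b : ℕ} {q : Tm S} {F₀ F₁ F₂ : Tm S → Tm S}
    (hp : MT m p X) (hq : MT n q Y) (hab : Nd ((a, X) ::ₘ (b, Y) ::ₘ Θ))
    (hb : b ∉ m.map Prod.fst) (hn : Nd (n + (m + Θ)))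
    (H₂ : Elim Ax (n + (m + Θ)) q Y b (m + Θ) C F₂)
    (H₁ : Elim Ax ((b, Y) ::ₘ (m + Θ)) p X a ((b, Y) ::ₘ Θ) C F₁)
    (H₀ : Elim Ax ((a, X) ::ₘ (b, Y) ::ₘ Θ) (.tens (.var a) (.var b)) (.tensor X Y) z Θ C F₀) :
    Elim Ax (n + (m + Θ)) (.tens p q) (.tensor X Y) z Θ C fun t => F₀ (F₁ (F₂ t)) := by
  have hba : b ≠ a := hab.ne (p := (b, Y)) (by simp)
  have ha' : a ∉ Θ.map Prod.fst := fun h => (nd_cons.1 hab).1 (by simp_all)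
  have hb' : b ∉ Θ.map Prod.fst := (nd_cons.1 (nd_cons.1 hab).2).1
  have e₁ : (b, Y) ::ₘ Θ + m = (b, Y) ::ₘ (m + Θ) := by rw [Multiset.cons_add, add_comm]
  have e₂ : m + Θ + n = n + (m + Θ) := add_comm ..
  have e₃ : Θ + ({(a, X)} + {(b, Y)}) = (a, X) ::ₘ (b, Y) ::ₘ Θ := by
    rw [add_comm, add_assoc, Multiset.singleton_add, Multiset.singleton_add]
  have hbm : Nd ((b, Y) ::ₘ (m + Θ)) := nd_cons.2
    ⟨by rw [Multiset.map_add, Multiset.mem_add]; exact not_or.2 ⟨hb, hb'⟩, hn.right⟩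
  have key : ∀ {s : Tm S}, MT ((z, .tensor X Y) ::ₘ Θ) s C → ∀ {r r' : Tm S},
      Eqv Ax ((a, X) ::ₘ (b, Y) ::ₘ Θ) (s.sub z (.tens (.var a) (.var b))) r C →
      Eqv Ax ((b, Y) ::ₘ (m + Θ)) (r.sub a p) r' C →
      Eqv Ax (n + (m + Θ)) (s.sub z (.tens p q)) (r'.sub b q) C := by
    intro s hs r r' h₁ h₂
    have h₃ := ((h₁.sub (.refl hp) (e₁ ▸ hbm)).cast e₁).trans h₂
    have h₄ := (h₃.sub (.refl hq) (e₂ ▸ hn)).cast e₂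
    rwa [sub_pair hs hp ha' hb' hba hb] at h₄
  refine ⟨fun {t} h => ?_, fun {t t'} h h' => ?_, fun {s} h => ?_⟩
  · have h₂ := H₂.beta h
    have h₁ := H₁.beta h₂.1
    have h₀ := H₀.beta h₁.1
    exact ⟨h₀.1, (key h₀.1 h₀.2 h₁.2).trans h₂.2⟩
  · have h₂ := (H₂.beta h).1
    have h₂' := (H₂.beta h').1
    exact (H₂.le h h').trans ((H₁.le h₂ h₂').trans
      (H₀.le (H₁.beta h₂).1 (H₁.beta h₂').1))
  · have h₀ : MT ((a, X) ::ₘ (b, Y) ::ₘ Θ) (s.sub z (.tens (.var a) (.var b))) C :=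
      (h.sub ((MT.var a X).tens (MT.var b Y) (by simp [Nd, hba.symm])) (e₃ ▸ hab)).cast e₃
    have h₁ : MT ((b, Y) ::ₘ (m + Θ)) ((s.sub z (.tens (.var a) (.var b))).sub a p) C :=
      (h₀.sub hp (e₁ ▸ hbm)).cast e₁
    have h₃ := H₂.eta h₁
    rw [sub_pair h hp ha' hb' hba hb] at h₃
    exact (H₀.eqv ((H₁.eqv h₃).trans (H₁.eta h₀))).trans (H₀.eta h)

/-- The matched variable `z` and the side context `Θ` must be arbitrary in the induction: while one
half of a tensor pattern is matched, the other half belongs to the side context. -/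
theorem Pat.exists_elim (Ax : Set (VEq S B)) (C : Ty S.Ground) (P : Pat S) :
    ∀ {z : ℕ} {Θ : MCtx S}, Nd (P.ctx + Θ) → Nd ((z, P.ty) ::ₘ Θ) →
      ∃ F, Elim Ax (P.ctx + Θ) P.tm P.ty z Θ C F := by
  induction P with
  | var n A => exact fun h hz => ⟨_, elim_var h hz⟩
  | unit =>
    intro z Θ _ hz
    have e : Pat.unit.ctx + Θ = Θ := zero_add Θ
    rw [e]
    exact ⟨_, elim_unit hz⟩
  | tens P Q ihP ihQ =>
    intro z Θ h hz
    -- The bound `a` and its successor `b` serve as fresh names for the two components of the pair.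
    obtain ⟨a, ha⟩ := exists_bound (P.ctx + Q.ctx + Θ)
    have hlt : ∀ {j : MCtx S}, j ≤ P.ctx + Q.ctx + Θ → ∀ {i : ℕ}, a ≤ i → i ∉ j.map Prod.fst := by
      intro j hj i hi hm
      obtain ⟨q, hq, rfl⟩ := Multiset.mem_map.1 hm
      exact absurd (ha q (Multiset.mem_of_le hj hq)) (not_lt.2 hi)
    set b := a + 1 with hb
    have hΘ : Θ.Nd := (nd_cons.1 hz).2
    have hPΘ : P.ctx + Θ ≤ P.ctx + Q.ctx + Θ := by
      gcongr; exact Multiset.le_add_right ..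
    have hPΘ' : Nd (P.ctx + Θ) := Nd.of_le h hPΘ
    have lΘ : Θ ≤ P.ctx + Q.ctx + Θ := Multiset.le_add_left ..
    have nb : Nd ((b, Q.ty) ::ₘ Θ) := nd_cons.2 ⟨hlt lΘ (Nat.le_succ a), hΘ⟩
    have nab : Nd ((a, P.ty) ::ₘ (b, Q.ty) ::ₘ Θ) :=
      nd_cons.2 ⟨by simpa [hb] using hlt lΘ le_rfl, nb⟩
    have nbP : Nd ((b, Q.ty) ::ₘ (P.ctx + Θ)) := nd_cons.2 ⟨hlt hPΘ (Nat.le_succ a), hPΘ'⟩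
    have e₀ : {(a, P.ty)} + {(b, Q.ty)} + Θ = (a, P.ty) ::ₘ (b, Q.ty) ::ₘ Θ := by
      rw [add_assoc, Multiset.singleton_add, Multiset.singleton_add]
    have e₁ : P.ctx + (b, Q.ty) ::ₘ Θ = (b, Q.ty) ::ₘ (P.ctx + Θ) := Multiset.add_cons ..
    have e₂ : Q.ctx + (P.ctx + Θ) = (Pat.tens P Q).ctx + Θ := by
      rw [Pat.ctx]; abel
    have H₀ := elim_pair (Ax := Ax) (C := C) (e₀ ▸ nab) hz
    obtain ⟨F₁, H₁⟩ := ihP (z := a) (Θ := (b, Q.ty) ::ₘ Θ) (e₁ ▸ nbP) nab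
    obtain ⟨F₂, H₂⟩ := ihQ (z := b) (Θ := P.ctx + Θ) (e₂ ▸ h) nbP
    have hb' := hlt ((Multiset.le_add_right ..).trans hPΘ) (Nat.le_succ a)
    have H := Elim.tens (Pat.typed (Nd.left hPΘ')) (Pat.typed h.left.right) nab hb' (e₂ ▸ h)
      H₂ (e₁ ▸ H₁) (e₀ ▸ H₀)
    exact ⟨_, e₂ ▸ H⟩

/-- Terms that agree on a pattern are equal. -/
theorem Pat.D_le {P : Pat S} (h : Nd P.ctx) (hs : MT {(0, P.ty)} s C) (hs' : MT {(0, P.ty)} s' C) :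
    D Ax P.ctx (s.plug P.tm) (s'.plug P.tm) C ≤ D Ax {(0, P.ty)} s s' C := by
  obtain ⟨F, hF⟩ := P.exists_elim Ax C (z := 0) (Θ := 0) (by rwa [add_zero]) (by simp [Nd])
  rw [add_zero] at hF
  have e : ∀ {s : Tm S}, MT {(0, P.ty)} s C → s.sub 0 P.tm = s.plug P.tm := fun h =>
    h.subst_congr fun q hq => by simp [Multiset.mem_singleton.1 hq]
  have hty : ∀ {s : Tm S}, MT {(0, P.ty)} s C → MT P.ctx (s.sub 0 P.tm) C := fun hs =>
    (MT.sub (m := 0) hs (Pat.typed h) (by rwa [zero_add])).cast (zero_add _)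
  rw [← e hs, ← e hs']
  exact (hF.le (hty hs) (hty hs')).trans (D_le_of_eqv (hF.eta hs) (hF.eta hs'))

/-- Every term in the variables of a pattern is obtained by matching with the pattern. -/
theorem Pat.exists_plug (Ax : Set (VEq S B)) {P : Pat S} (h : MT P.ctx t C) :
    ∃ s, MT {(0, P.ty)} s C ∧ Eqv Ax P.ctx (s.plug P.tm) t C := by
  obtain ⟨F, hF⟩ := P.exists_elim Ax C (z := 0) (Θ := 0) (by rw [add_zero]; exact h.nd) (by simp [Nd])
  rw [add_zero] at hF
  obtain ⟨h₁, h₂⟩ := hF.beta h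
  have : (F t).sub 0 P.tm = (F t).plug P.tm :=
    h₁.subst_congr fun q hq => by simp [Multiset.mem_singleton.1 hq]
  exact ⟨F t, h₁, this ▸ h₂⟩

end

section

open MCtx

/-! ## The syntactic category -/

section Plug

variable {S : Signature.{u, w}} {V : Type x} [CommMonoid V] [CompleteLattice V]
  {B : Set V} {Ax : Set (VEq S B)} {m : MCtx S} {v t s s' : Tm S} {A C : Ty S.Ground}

theorem MT.sub_zero_eq_plug (h : MT {(0, A)} t C) (s : Tm S) : t.sub 0 s = t.plug s :=
  h.subst_congr fun q hq => by simp [Multiset.mem_singleton.1 hq]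

theorem MT.plug (h : MT {(0, A)} t C) (hs : MT m s A) : MT m (t.plug s) C := by
  rw [← h.sub_zero_eq_plug]
  exact (MT.sub (m := 0) h hs (by rw [zero_add]; exact hs.nd)).cast (zero_add _)

variable [IsQuantale V]

theorem D_plug (hv : MT {(0, A)} v C) (ht : MT {(0, A)} t C) (hm : m.Nd) :
    D Ax {(0, A)} v t C * D Ax m s s' A ≤ D Ax m (v.plug s) (t.plug s') C := by
  rw [← hv.sub_zero_eq_plug, ← ht.sub_zero_eq_plug]
  have := D_sub (Ax := Ax) (z := 0) (m := 0) (n := m) (v := v) (t := t) (v' := s) (t' := s')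
    (A := A) (C := C) (by rwa [zero_add])
  rwa [zero_add] at this

theorem Eqv.plug (h : Eqv Ax {(0, A)} v t C) (h' : Eqv Ax m s s' A) :
    Eqv Ax m (v.plug s) (t.plug s') C :=
  ⟨h.1.plug h'.1, h.2.plug h'.2, (one_le_mul_of h.3 h'.3).trans (D_plug h.1 h.2 h'.1.nd),
    (one_le_mul_of h.4 h'.4).trans (D_plug h.2 h.1 h'.1.nd)⟩

end Plug

/-- The objects of the syntactic category: the types. -/
structure Syn {S : Signature.{u, w}} {V : Type x} [CommMonoid V] [CompleteLattice V] [IsQuantale V]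
    {B : Set V} {Ax : Set (VEq S B)} (hAx : Varietal.{u, w, v, x} Ax) : Type u where
  ty : Ty S.Ground

variable {S : Signature.{u, w}} {V : Type x} [CommMonoid V] [CompleteLattice V] [IsQuantale V]
  {B : Set V} {Ax : Set (VEq S B)} {hAx : Varietal.{u, w, v, x} Ax}
  {m n k M : MCtx S} {a b c s t r s' t' : Tm S}

namespace Syn

/-- The morphisms of the syntactic category: classes of terms in one variable. -/
def Hom (X Y : Syn hAx) : Type v :=
  @Shrink.{v} (Quotient (termVCat Ax X.ty Y.ty).setoid) (hAx X.ty Y.ty)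

/-- Morphisms as classes of terms. -/
noncomputable def Hom.equiv (X Y : Syn hAx) :
    Quotient (termVCat Ax X.ty Y.ty).setoid ≃ Hom X Y :=
  @equivShrink _ (hAx X.ty Y.ty)

variable {X Y Z W X' Y' : Syn hAx}

/-- The morphism given by a term. -/
noncomputable def homMk (t : Tm S) (h : MT {(0, X.ty)} t Y.ty) : Hom X Y :=
  Hom.equiv X Y (Quotient.mk _ ⟨t, MT.typed (Γ := [(0, X.ty)]) h⟩)

/-- Equality of morphisms becomes provable equality up to joins of labels; beyond this point the
quotient and the shrinking play no role. -/
theorem homMk_eq_homMk {h : MT {(0, X.ty)} t Y.ty} {h' : MT {(0, X.ty)} s Y.ty} :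
    (homMk t h : Hom X Y) = homMk s h' ↔ Eqv Ax {(0, X.ty)} t s Y.ty := by
  have e : ∀ v t : Tm S, D Ax {(0, X.ty)} v t Y.ty = sSup {q | Thm Ax [(0, X.ty)] v q t Y.ty} :=
    fun v t => D_coe [(0, X.ty)]
  rw [homMk, homMk, (Hom.equiv X Y).apply_eq_iff_eq, Quotient.eq]
  refine ⟨fun H => ⟨h, h', ?_, ?_⟩, fun H => ⟨?_, ?_⟩⟩
  · rw [e]; exact H.1
  · rw [e]; exact H.2
  · have := H.3; rwa [e] at this
  · have := H.4; rwa [e] at this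

theorem exists_rep (f : Hom X Y) : ∃ t h, f = homMk t h := by
  obtain ⟨q, rfl⟩ := (Hom.equiv X Y).surjective f
  obtain ⟨⟨t, ht⟩, rfl⟩ := Quotient.exists_rep q
  exact ⟨t, MT.of_typed (Γ := [(0, X.ty)]) ht, rfl⟩

/-- A term that represents a morphism. -/
noncomputable def Hom.rep (f : Hom X Y) : Tm S := (exists_rep f).choose

theorem Hom.typed (f : Hom X Y) : MT {(0, X.ty)} f.rep Y.ty := (exists_rep f).choose_spec.choose

theorem homMk_rep (f : Hom X Y) : homMk f.rep f.typed = f :=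
  (exists_rep f).choose_spec.choose_spec.symm

theorem rep_homMk (h : MT {(0, X.ty)} t Y.ty) : Eqv Ax {(0, X.ty)} (homMk t h : Hom X Y).rep t Y.ty :=
  homMk_eq_homMk.1 (homMk_rep (homMk t h))

/-- The morphism `f` takes the element `s` to the element `t`. -/
structure Ev (m : MCtx S) (f : Hom X Y) (s t : Tm S) : Prop where
  typed : MT m s X.ty
  eqv : Eqv Ax m (f.rep.plug s) t Y.ty

theorem Ev.cast {f : Hom X Y} (h : Ev m f s t) (e : m = n) : Ev n f s t := e ▸ h

theorem Ev.homMk (h : MT {(0, X.ty)} r Y.ty) (hs : MT m s X.ty)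
    (e : Eqv Ax m (r.plug s) t Y.ty) : Ev m (Syn.homMk r h : Hom X Y) s t :=
  ⟨hs, ((rep_homMk h).plug (.refl hs)).trans e⟩

theorem Ev.homMk_self (h : MT {(0, X.ty)} r Y.ty) (hs : MT m s X.ty) :
    Ev m (Syn.homMk r h : Hom X Y) s (r.plug s) := .homMk h hs (.refl (h.plug hs))

theorem Ev.self (f : Hom X Y) (hs : MT m s X.ty) : Ev m f s (f.rep.plug s) :=
  ⟨hs, .refl (f.typed.plug hs)⟩

theorem Ev.congr {f : Hom X Y} (h : Ev m f s t) (hs : Eqv Ax m s' s X.ty)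
    (ht : Eqv Ax m t t' Y.ty) : Ev m f s' t' :=
  ⟨hs.1, ((Eqv.refl f.typed).plug hs).trans (h.eqv.trans ht)⟩

theorem Ev.typed_right {f : Hom X Y} (h : Ev m f s t) : MT m t Y.ty := h.eqv.right

/-- Morphisms that agree on a pattern are equal. -/
theorem Hom.ext {f g : Hom X Y} (P : Pat S) (hP : P.ty = X.ty) (h : Nd P.ctx)
    (hf : Ev P.ctx f P.tm t) (hg : Ev P.ctx g P.tm t) : f = g := by
  have hle : ∀ {f g : Hom X Y}, Ev P.ctx f P.tm t → Ev P.ctx g P.tm t →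
      1 ≤ D Ax {(0, X.ty)} f.rep g.rep Y.ty := by
    intro f g hf hg
    have := Pat.D_le (Ax := Ax) (C := Y.ty) h (hP.symm ▸ f.typed) (hP.symm ▸ g.typed)
    rw [hP] at this
    exact (hf.eqv.trans hg.eqv.symm).3.trans this
  rw [← homMk_rep f, ← homMk_rep g, homMk_eq_homMk]
  exact ⟨f.typed, g.typed, hle hf hg, hle hg hf⟩

theorem Hom.ext_var {f g : Hom X Y} (hf : Ev {(0, X.ty)} f (.var 0) t)
    (hg : Ev {(0, X.ty)} g (.var 0) t) : f = g :=
  Hom.ext (.var 0 X.ty) rfl (by simp [Nd, Pat.ctx]) hf hg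

theorem exists_lift (P : Pat S) (hP : P.ty = X.ty) (h : MT P.ctx t Y.ty) :
    ∃ f : Hom X Y, Ev P.ctx f P.tm t := by
  obtain ⟨s, hs, e⟩ := Pat.exists_plug Ax h
  rw [hP] at hs
  exact ⟨homMk s hs, .homMk hs (hP ▸ Pat.typed h.nd) e⟩

/-- The morphism that matches its argument with the pattern `P` and returns `t`. -/
noncomputable def lift (P : Pat S) (hP : P.ty = X.ty) (h : MT P.ctx t Y.ty) : Hom X Y :=
  (exists_lift P hP h).choose

/-- By definition `lift` is known only on the pattern itself; closure of `Eqv` under substitution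
gives its value on every instance of the pattern. -/
theorem ev_lift (P : Pat S) (hP : P.ty = X.ty) (h : MT P.ctx t Y.ty) {σ : ℕ → Tm S}
    {Δ : ℕ × Ty S.Ground → MCtx S} (hσ : ∀ p ∈ P.ctx, MT (Δ p) (σ p.1) p.2)
    (hn : Nd (P.ctx.bind Δ)) :
    Ev (P.ctx.bind Δ) (lift P hP h) (P.tm.subst σ) (t.subst σ) := by
  have H := (exists_lift P hP h).choose_spec
  refine ⟨H.typed.subst hσ hn, ?_⟩
  have := H.eqv.subst (fun p hp => .refl (hσ p hp)) hn
  rwa [Tm.plug_subst] at this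

/-- The contexts and terms substituted for the variables `0`, `1`, `2`. -/
def seq {α : Type*} (a b c : α) : ℕ → α
  | 0 => a
  | 1 => b
  | _ => c

theorem ev_lift₂ (h : MT (Pat.ctx (.tens (.var 0 X.ty) (.var 1 Y.ty))) t Z.ty)
    (hW : Ty.tensor X.ty Y.ty = W.ty) (ha : MT m a X.ty) (hb : MT n b Y.ty) (hM : m + n = M)
    (hn : Nd M) :
    Ev M (lift (X := W) (Y := Z) (.tens (.var 0 X.ty) (.var 1 Y.ty)) hW h) (.tens a b)
      (t.subst (seq a b b)) := by
  subst hM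
  have := ev_lift (hAx := hAx) (X := W) (Y := Z) (.tens (.var 0 X.ty) (.var 1 Y.ty)) hW h
    (σ := seq a b b) (Δ := fun p => seq m n n p.1)
  simp only [Pat.ctx, Multiset.add_bind, Multiset.singleton_bind, Multiset.mem_add,
    Multiset.mem_singleton] at this
  refine this ?_ hn
  rintro p (rfl | rfl)
  exacts [ha, hb]

theorem ev_lift_left (h : MT (Pat.ctx (.tens (.tens (.var 0 X.ty) (.var 1 Y.ty)) (.var 2 Z.ty)))
      t X'.ty)
    (hW : Ty.tensor (.tensor X.ty Y.ty) Z.ty = W.ty) (ha : MT m a X.ty) (hb : MT n b Y.ty)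
    (hc : MT k c Z.ty) (hM : m + n + k = M) (hn : Nd M) :
    Ev M (lift (X := W) (Y := X') (.tens (.tens (.var 0 X.ty) (.var 1 Y.ty)) (.var 2 Z.ty)) hW h)
      (.tens (.tens a b) c) (t.subst (seq a b c)) := by
  subst hM
  have := ev_lift (hAx := hAx) (X := W) (Y := X')
    (.tens (.tens (.var 0 X.ty) (.var 1 Y.ty)) (.var 2 Z.ty)) hW h
    (σ := seq a b c) (Δ := fun p => seq m n k p.1)
  simp only [Pat.ctx, Multiset.add_bind, Multiset.singleton_bind, Multiset.mem_add,
    Multiset.mem_singleton] at this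
  refine this ?_ hn
  rintro p ((rfl | rfl) | rfl)
  exacts [ha, hb, hc]

theorem ev_lift_right (h : MT (Pat.ctx (.tens (.var 0 X.ty) (.tens (.var 1 Y.ty) (.var 2 Z.ty))))
      t X'.ty)
    (hW : Ty.tensor X.ty (.tensor Y.ty Z.ty) = W.ty) (ha : MT m a X.ty) (hb : MT n b Y.ty)
    (hc : MT k c Z.ty) (hM : m + n + k = M) (hn : Nd M) :
    Ev M (lift (X := W) (Y := X') (.tens (.var 0 X.ty) (.tens (.var 1 Y.ty) (.var 2 Z.ty))) hW h)
      (.tens a (.tens b c)) (t.subst (seq a b c)) := by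
  subst hM
  rw [add_assoc] at hn ⊢
  have := ev_lift (hAx := hAx) (X := W) (Y := X')
    (.tens (.var 0 X.ty) (.tens (.var 1 Y.ty) (.var 2 Z.ty))) hW h
    (σ := seq a b c) (Δ := fun p => seq m n k p.1)
  simp only [Pat.ctx, Multiset.add_bind, Multiset.singleton_bind, Multiset.mem_add,
    Multiset.mem_singleton] at this
  refine this ?_ hn
  rintro p (rfl | rfl | rfl)
  exacts [ha, hb, hc]

/-! ### Structure morphisms -/

/-- Composition is substitution of representatives. The laws are tested on the variable `0`, where
they become associativity of substitution. -/
noncomputable instance : Category.{v} (Syn hAx) where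
  Hom := Hom
  id X := homMk (.var 0) (.var 0 X.ty)
  comp f g := homMk (g.rep.plug f.rep) (g.typed.plug f.typed)
  id_comp f := by
    refine Hom.ext_var (Ev.homMk_self _ (.var 0 _)) (Ev.congr (Ev.self f (.var 0 _)) (.refl (.var 0 _)) ?_)
    rw [Tm.plug_plug]
    refine (Eqv.refl f.typed).plug (.symm ?_)
    exact (Ev.homMk_self (X := _) (Y := _) _ (.var 0 _)).eqv
  comp_id f := by
    refine Hom.ext_var ?_ (Ev.self f (.var 0 _))
    refine (Ev.homMk_self _ (.var 0 _)).congr (.refl (.var 0 _)) ?_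
    rw [Tm.plug_plug]
    exact (Ev.homMk_self (r := .var 0) _ (f.typed.plug (.var 0 _))).eqv
  assoc f g h := by
    refine Hom.ext_var (Ev.homMk_self _ (.var 0 _)) ((Ev.homMk_self _ (.var 0 _)).congr (.refl (.var 0 _)) ?_)
    simp only [Tm.plug_plug]
    have h₁ := (rep_homMk (g.typed.plug f.typed)).symm.plug (m := {(0, _)}) (.refl (.var 0 _))
    have h₂ := (rep_homMk (h.typed.plug g.typed)).plug (Eqv.refl (f.typed.plug (.var 0 _)))
    refine h₂.trans ?_
    rw [Tm.plug_plug] at h₁ ⊢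
    exact (Eqv.refl h.typed).plug h₁

theorem Ev.id (hs : MT m s X.ty) : Ev m (𝟙 X) s s := Ev.homMk _ hs (.refl hs)

/-- This allows composites to be evaluated by chasing elements, which is how all coherence laws are
verified. -/
theorem Ev.comp {f : X ⟶ Y} {g : Y ⟶ Z} (hf : Ev m f s t) (hg : Ev m g t r) :
    Ev m (f ≫ g) s r := by
  refine Ev.homMk _ hf.typed ?_
  rw [Tm.plug_plug]
  exact (hg.congr hf.eqv (.refl hg.typed_right)).eqv

/-- The tensor product of objects. -/
def tensorO (X Y : Syn hAx) : Syn hAx := ⟨.tensor X.ty Y.ty⟩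

/-- The tensor unit. -/
def unitO (hAx : Varietal.{u, w, v, x} Ax) : Syn hAx := ⟨.unit⟩

/-- The internal hom. -/
def lolliO (X Y : Syn hAx) : Syn hAx := ⟨.lolli X.ty Y.ty⟩

theorem nd₂ {i j : ℕ} (h : i ≠ j) (A A' : Ty S.Ground) : Nd ({(i, A)} + {(j, A')}) := by
  simp [Nd, h]

theorem nd₃ (A A' A'' : Ty S.Ground) : Nd ({(0, A)} + {(1, A')} + {(2, A'')}) := by
  simp [Nd]

theorem nd₄ (A A' A'' A''' : Ty S.Ground) :
    Nd ({(0, A)} + {(1, A')} + {(2, A'')} + {(3, A''')}) := by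
  simp [Nd]

/-- The tensor product of morphisms. -/
noncomputable def tensorH (f : X ⟶ Y) (g : X' ⟶ Y') : tensorO X X' ⟶ tensorO Y Y' :=
  lift (.tens (.var 0 X.ty) (.var 1 X'.ty)) rfl
    ((f.typed.plug (.var 0 _)).tens (g.typed.plug (.var 1 _)) (nd₂ zero_ne_one _ _))

theorem Ev.tensorH {f : X ⟶ Y} {g : X' ⟶ Y'} (hf : Ev m f a t) (hg : Ev n g b s) (hM : m + n = M)
    (hn : Nd M) : Ev M (tensorH f g) (.tens a b) (.tens t s) := by
  have h := ev_lift₂ (hAx := hAx) (W := tensorO X X') (Z := tensorO Y Y')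
    ((f.typed.plug (.var 0 _)).tens (g.typed.plug (.var 1 _)) (nd₂ zero_ne_one _ _)) rfl
    hf.typed hg.typed hM hn
  refine h.congr (.refl h.typed) ?_
  subst hM
  simp only [Tm.subst, Tm.plug_subst]
  exact hf.eqv.tens hg.eqv hn

/-- The associator. -/
noncomputable def assocHom (X Y Z : Syn hAx) :
    tensorO (tensorO X Y) Z ⟶ tensorO X (tensorO Y Z) :=
  lift (.tens (.tens (.var 0 X.ty) (.var 1 Y.ty)) (.var 2 Z.ty)) rfl
    (((MT.var 0 _).tens ((MT.var 1 _).tens (.var 2 _) (nd₂ (by simp) _ _)) (by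
      rw [← add_assoc]; exact nd₃ ..)).cast (add_assoc ..).symm)

/-- The inverse of the associator. -/
noncomputable def assocInv (X Y Z : Syn hAx) :
    tensorO X (tensorO Y Z) ⟶ tensorO (tensorO X Y) Z :=
  lift (.tens (.var 0 X.ty) (.tens (.var 1 Y.ty) (.var 2 Z.ty))) rfl
    ((((MT.var 0 _).tens (.var 1 _) (nd₂ (by simp) _ _)).tens (.var 2 _) (nd₃ ..)).cast
      (add_assoc ..))

theorem Ev.assocHom (ha : MT m a X.ty) (hb : MT n b Y.ty) (hc : MT k c Z.ty)
    (hM : m + n + k = M) (hn : Nd M) :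
    Ev M (assocHom X Y Z) (.tens (.tens a b) c) (.tens a (.tens b c)) :=
  ev_lift_left (W := tensorO (tensorO X Y) Z) (X' := tensorO X (tensorO Y Z)) _ rfl ha hb hc hM hn

theorem Ev.assocInv (ha : MT m a X.ty) (hb : MT n b Y.ty) (hc : MT k c Z.ty)
    (hM : m + n + k = M) (hn : Nd M) :
    Ev M (assocInv X Y Z) (.tens a (.tens b c)) (.tens (.tens a b) c) :=
  ev_lift_right (W := tensorO X (tensorO Y Z)) (X' := tensorO (tensorO X Y) Z) _ rfl ha hb hc hM hn

/-- The left unitor. -/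
noncomputable def leftHom (X : Syn hAx) : tensorO (unitO hAx) X ⟶ X :=
  lift (.tens .unit (.var 0 X.ty)) rfl ((MT.var 0 X.ty).cast (zero_add _).symm)

/-- The inverse of the left unitor. -/
noncomputable def leftInv (X : Syn hAx) : X ⟶ tensorO (unitO hAx) X :=
  lift (.var 0 X.ty) rfl ((MT.star.tens (.var 0 X.ty) (by simp [Nd])).cast (zero_add _))

/-- The right unitor. -/
noncomputable def rightHom (X : Syn hAx) : tensorO X (unitO hAx) ⟶ X :=
  lift (.tens (.var 0 X.ty) .unit) rfl ((MT.var 0 X.ty).cast (add_zero _).symm)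

/-- The inverse of the right unitor. -/
noncomputable def rightInv (X : Syn hAx) : X ⟶ tensorO X (unitO hAx) :=
  lift (.var 0 X.ty) rfl (((MT.var 0 X.ty).tens MT.star (by simp [Nd])).cast (add_zero _))

theorem Ev.leftHom (ha : MT m a X.ty) : Ev m (leftHom X) (.tens .star a) a := by
  have h := ev_lift (hAx := hAx) (X := tensorO (unitO hAx) X) (.tens .unit (.var 0 X.ty)) rfl
    ((MT.var 0 X.ty).cast (zero_add _).symm) (σ := fun _ => a) (Δ := fun _ => m)
  simp only [Pat.ctx, zero_add, Multiset.singleton_bind, Multiset.mem_singleton] at h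
  exact h (by rintro p rfl; exact ha) ha.nd

theorem Ev.leftInv (ha : MT m a X.ty) : Ev m (leftInv X) a (.tens .star a) := by
  have h := ev_lift (hAx := hAx) (Y := tensorO (unitO hAx) X) (.var 0 X.ty) rfl
    ((MT.star.tens (.var 0 X.ty) (by simp [Nd])).cast (zero_add _)) (σ := fun _ => a)
    (Δ := fun _ => m)
  simp only [Pat.ctx, Multiset.singleton_bind, Multiset.mem_singleton] at h
  exact h (by rintro p rfl; exact ha) ha.nd

theorem Ev.rightHom (ha : MT m a X.ty) : Ev m (rightHom X) (.tens a .star) a := by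
  have h := ev_lift (hAx := hAx) (X := tensorO X (unitO hAx)) (.tens (.var 0 X.ty) .unit) rfl
    ((MT.var 0 X.ty).cast (add_zero _).symm) (σ := fun _ => a) (Δ := fun _ => m)
  simp only [Pat.ctx, add_zero, Multiset.singleton_bind, Multiset.mem_singleton] at h
  exact h (by rintro p rfl; exact ha) ha.nd

theorem Ev.rightInv (ha : MT m a X.ty) : Ev m (rightInv X) a (.tens a .star) := by
  have h := ev_lift (hAx := hAx) (Y := tensorO X (unitO hAx)) (.var 0 X.ty) rfl
    (((MT.var 0 X.ty).tens MT.star (by simp [Nd])).cast (add_zero _)) (σ := fun _ => a)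
    (Δ := fun _ => m)
  simp only [Pat.ctx, Multiset.singleton_bind, Multiset.mem_singleton] at h
  exact h (by rintro p rfl; exact ha) ha.nd

/-- The braiding. -/
noncomputable def braidHom (X Y : Syn hAx) : tensorO X Y ⟶ tensorO Y X :=
  lift (.tens (.var 0 X.ty) (.var 1 Y.ty)) rfl
    (((MT.var 1 Y.ty).tens (.var 0 X.ty) (nd₂ one_ne_zero _ _)).cast (add_comm ..))

theorem Ev.braidHom (ha : MT m a X.ty) (hb : MT n b Y.ty) (hM : m + n = M) (hn : Nd M) :
    Ev M (braidHom X Y) (.tens a b) (.tens b a) :=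
  ev_lift₂ (W := tensorO X Y) (Z := tensorO Y X) _ rfl ha hb hM hn

end Syn

end

section

open MCtx

variable {S : Signature.{u, w}} {V : Type x} [CommMonoid V] [CompleteLattice V] [IsQuantale V]
  {B : Set V} {Ax : Set (VEq S B)} {hAx : Varietal.{u, w, v, x} Ax}
  {m n k M : MCtx S} {a b c s t r s' t' : Tm S}

namespace Syn

variable {X Y Z W X' Y' : Syn hAx}

/-! ### The symmetric monoidal structure -/

/-- Morphisms out of a tensor product are determined by their values on pairs. -/
theorem ext_pair {f g : tensorO X Y ⟶ Z}
    (hf : Ev ({(0, X.ty)} + {(1, Y.ty)}) f (.tens (.var 0) (.var 1)) t)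
    (hg : Ev ({(0, X.ty)} + {(1, Y.ty)}) g (.tens (.var 0) (.var 1)) t) : f = g :=
  Hom.ext (.tens (.var 0 X.ty) (.var 1 Y.ty)) rfl (nd₂ zero_ne_one ..) hf hg

theorem ext_left {f g : tensorO (tensorO X Y) Z ⟶ W}
    (hf : Ev ({(0, X.ty)} + {(1, Y.ty)} + {(2, Z.ty)}) f
      (.tens (.tens (.var 0) (.var 1)) (.var 2)) t)
    (hg : Ev ({(0, X.ty)} + {(1, Y.ty)} + {(2, Z.ty)}) g
      (.tens (.tens (.var 0) (.var 1)) (.var 2)) t) : f = g :=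
  Hom.ext (.tens (.tens (.var 0 X.ty) (.var 1 Y.ty)) (.var 2 Z.ty)) rfl (nd₃ ..) hf hg

theorem ext_right {f g : tensorO X (tensorO Y Z) ⟶ W}
    (hf : Ev ({(0, X.ty)} + {(1, Y.ty)} + {(2, Z.ty)}) f
      (.tens (.var 0) (.tens (.var 1) (.var 2))) t)
    (hg : Ev ({(0, X.ty)} + {(1, Y.ty)} + {(2, Z.ty)}) g
      (.tens (.var 0) (.tens (.var 1) (.var 2))) t) : f = g :=
  Hom.ext (.tens (.var 0 X.ty) (.tens (.var 1 Y.ty) (.var 2 Z.ty))) rfl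
    (by simp [Nd, Pat.ctx])
    (hf.cast (add_assoc ..)) (hg.cast (add_assoc ..))

theorem typed_pair (i j : ℕ) (h : i ≠ j) (X Y : Syn hAx) :
    MT ({(i, X.ty)} + {(j, Y.ty)}) (.tens (.var i) (.var j)) (tensorO X Y).ty :=
  (MT.var _ _).tens (.var _ _) (nd₂ h ..)

theorem typed_left (X Y Z : Syn hAx) :
    MT ({(0, X.ty)} + {(1, Y.ty)} + {(2, Z.ty)}) (.tens (.tens (.var 0) (.var 1)) (.var 2))
      (tensorO (tensorO X Y) Z).ty :=
  ((MT.var _ _).tens (.var _ _) (nd₂ zero_ne_one ..)).tens (.var _ _) (nd₃ ..)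

theorem typed_right (X Y Z : Syn hAx) :
    MT ({(0, X.ty)} + {(1, Y.ty)} + {(2, Z.ty)}) (.tens (.var 0) (.tens (.var 1) (.var 2)))
      (tensorO X (tensorO Y Z)).ty :=
  ((MT.var _ _).tens ((MT.var _ _).tens (.var _ _) (nd₂ (by simp) ..))
    (by rw [← add_assoc]; exact nd₃ ..)).cast (add_assoc ..).symm

noncomputable instance : MonoidalCategoryStruct (Syn hAx) where
  tensorObj := tensorO
  whiskerLeft X _ _ f := tensorH (𝟙 X) f
  whiskerRight f Y := tensorH f (𝟙 Y)
  tensorHom := tensorH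
  tensorUnit := unitO hAx
  associator X Y Z :=
    { hom := assocHom X Y Z
      inv := assocInv X Y Z
      hom_inv_id := ext_left
        ((Ev.assocHom (.var 0 _) (.var 1 _) (.var 2 _) rfl (nd₃ ..)).comp
          (Ev.assocInv (.var 0 _) (.var 1 _) (.var 2 _) rfl (nd₃ ..))) (.id (typed_left ..))
      inv_hom_id := ext_right
        ((Ev.assocInv (.var 0 _) (.var 1 _) (.var 2 _) rfl (nd₃ ..)).comp
          (Ev.assocHom (.var 0 _) (.var 1 _) (.var 2 _) rfl (nd₃ ..))) (.id (typed_right ..)) }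
  leftUnitor X :=
    { hom := leftHom X
      inv := leftInv X
      hom_inv_id := Hom.ext (.tens .unit (.var 0 X.ty)) rfl (by simp [Nd, Pat.ctx])
        (((Ev.leftHom (.var 0 _)).comp (Ev.leftInv (.var 0 _))).cast (zero_add _).symm)
        (.id (Pat.typed (P := .tens .unit (.var 0 X.ty)) (by simp [Nd, Pat.ctx])))
      inv_hom_id := Hom.ext_var ((Ev.leftInv (.var 0 _)).comp (Ev.leftHom (.var 0 _)))
        (.id (.var 0 _)) }
  rightUnitor X :=
    { hom := rightHom X
      inv := rightInv X
      hom_inv_id := Hom.ext (.tens (.var 0 X.ty) .unit) rfl (by simp [Nd, Pat.ctx])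
        (((Ev.rightHom (.var 0 _)).comp (Ev.rightInv (.var 0 _))).cast (add_zero _).symm)
        (.id (Pat.typed (P := .tens (.var 0 X.ty) .unit) (by simp [Nd, Pat.ctx])))
      inv_hom_id := Hom.ext_var ((Ev.rightInv (.var 0 _)).comp (Ev.rightHom (.var 0 _)))
        (.id (.var 0 _)) }

/-- Each law is evaluated on the tuple of distinct variables, with `∗` in the unit positions, that
fits its source. Both sides yield the same term, so the extensionality lemmas for patterns apply. -/
noncomputable instance : MonoidalCategory (Syn hAx) := .ofTensorHom
  (id_tensorHom_id := fun X Y => ext_pair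
    (Ev.tensorH (.id (.var 0 _)) (.id (.var 1 _)) rfl (nd₂ zero_ne_one ..))
    (.id (typed_pair _ _ zero_ne_one ..)))
  (id_tensorHom := fun _ _ _ _ => rfl)
  (tensorHom_id := fun _ _ => rfl)
  (tensorHom_comp_tensorHom := fun f₁ f₂ g₁ g₂ =>
    have h₁ := (Ev.self f₁ (.var 0 _))
    have h₂ := (Ev.self f₂ (.var 1 _))
    have k₁ := (Ev.self g₁ h₁.typed_right)
    have k₂ := (Ev.self g₂ h₂.typed_right)
    ext_pair
      ((Ev.tensorH h₁ h₂ rfl (nd₂ zero_ne_one ..)).comp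
        (Ev.tensorH k₁ k₂ rfl (nd₂ zero_ne_one ..)))
      (Ev.tensorH (h₁.comp k₁) (h₂.comp k₂) rfl (nd₂ zero_ne_one ..)))
  (associator_naturality := fun f₁ f₂ f₃ =>
    have h₁ := (Ev.self f₁ (.var 0 _))
    have h₂ := (Ev.self f₂ (.var 1 _))
    have h₃ := (Ev.self f₃ (.var 2 _))
    ext_left
      ((Ev.tensorH (.tensorH h₁ h₂ rfl (nd₂ zero_ne_one ..)) h₃ rfl (nd₃ ..)).comp
        (.assocHom h₁.typed_right h₂.typed_right h₃.typed_right rfl (nd₃ ..)))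
      ((Ev.assocHom (.var 0 _) (.var 1 _) (.var 2 _) rfl (nd₃ ..)).comp
        (.tensorH h₁ (.tensorH h₂ h₃ rfl (nd₂ (by simp) ..)) (add_assoc ..).symm (nd₃ ..))))
  (leftUnitor_naturality := fun {X Y} f =>
    have h := (Ev.self f (.var 0 _))
    Hom.ext (.tens .unit (.var 0 X.ty)) rfl (by simp [Nd, Pat.ctx])
      (((Ev.tensorH (.id (X := unitO hAx) MT.star) h (zero_add _) h.typed.nd).comp
        (.leftHom h.typed_right)).cast (zero_add _).symm)
      (((Ev.leftHom (.var 0 _)).comp h).cast (zero_add _).symm))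
  (rightUnitor_naturality := fun {X Y} f =>
    have h := (Ev.self f (.var 0 _))
    Hom.ext (.tens (.var 0 X.ty) .unit) rfl (by simp [Nd, Pat.ctx])
      (((Ev.tensorH h (.id (X := unitO hAx) MT.star) (add_zero _) h.typed.nd).comp
        (.rightHom h.typed_right)).cast (add_zero _).symm)
      (((Ev.rightHom (.var 0 _)).comp h).cast (add_zero _).symm))
  (pentagon := fun W X Y Z => by
    have n₄ := nd₄ W.ty X.ty Y.ty Z.ty
    have n₂₃ : Nd ({(2, Y.ty)} + {(3, Z.ty)}) := nd₂ (by simp) ..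
    have n₁₂₃ : Nd ({(1, X.ty)} + {(2, Y.ty)} + {(3, Z.ty)}) := by simp [Nd]
    have n₁₂ : Nd ({(1, X.ty)} + {(2, Y.ty)}) := nd₂ (by simp) ..
    have h₁ := (Ev.assocHom (X := W) (Y := X) (Z := Y) (.var 0 _) (.var 1 _) (.var 2 _) rfl
      (nd₃ ..)).tensorH (.id (X := Z) (.var 3 _)) rfl n₄
    have h₂ := Ev.assocHom (X := W) (Y := tensorO X Y) (Z := Z) (.var 0 _)
      (typed_pair 1 2 (by simp) X Y) (.var 3 _) (by rw [← add_assoc]) n₄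
    have h₃ := (Ev.id (X := W) (.var 0 _)).tensorH (Ev.assocHom (X := X) (Y := Y) (Z := Z)
      (.var 1 _) (.var 2 _) (.var 3 _) rfl n₁₂₃)
      (by rw [← add_assoc, ← add_assoc]) n₄
    have k₁ := Ev.assocHom (X := tensorO W X) (Y := Y) (Z := Z)
      (typed_pair 0 1 (by simp) W X) (.var 2 _) (.var 3 _) rfl n₄
    have k₂ := Ev.assocHom (X := W) (Y := X) (Z := tensorO Y Z) (.var 0 _) (.var 1 _)
      (typed_pair 2 3 (by simp) Y Z) (by rw [← add_assoc]) n₄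
    exact Hom.ext
      (.tens (.tens (.tens (.var 0 W.ty) (.var 1 X.ty)) (.var 2 Y.ty)) (.var 3 Z.ty)) rfl
      n₄ (h₁.comp (h₂.comp h₃)) (k₁.comp k₂))
  (triangle := fun X Y => by
    have n₂ := nd₂ zero_ne_one X.ty Y.ty
    have h₁ := Ev.assocHom (X := X) (Y := unitO hAx) (Z := Y) (.var 0 _) MT.star (.var 1 _)
      (by rw [add_zero]) n₂
    have h₂ := (Ev.id (X := X) (.var 0 _)).tensorH (Ev.leftHom (X := Y) (.var 1 _)) rfl n₂
    have h₃ := (Ev.rightHom (X := X) (.var 0 _)).tensorH (.id (X := Y) (.var 1 _)) rfl n₂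
    have e : {(0, X.ty)} + {(1, Y.ty)} =
        Pat.ctx (.tens (.tens (.var 0 X.ty) .unit) (.var 1 Y.ty)) := by simp [Pat.ctx]
    exact Hom.ext (.tens (.tens (.var 0 X.ty) .unit) (.var 1 Y.ty)) rfl (e ▸ n₂)
      ((h₁.comp h₂).cast e) (h₃.cast e))

noncomputable instance : SymmetricCategory (Syn hAx) where
  braiding X Y :=
    { hom := braidHom X Y
      inv := braidHom Y X
      hom_inv_id := ext_pair
        ((Ev.braidHom (.var 0 _) (.var 1 _) rfl (nd₂ zero_ne_one ..)).comp
          (.braidHom (.var 1 _) (.var 0 _) (add_comm ..) (nd₂ zero_ne_one ..)))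
        (.id (typed_pair _ _ zero_ne_one ..))
      inv_hom_id := ext_pair
        ((Ev.braidHom (.var 0 _) (.var 1 _) rfl (nd₂ zero_ne_one ..)).comp
          (.braidHom (.var 1 _) (.var 0 _) (add_comm ..) (nd₂ zero_ne_one ..)))
        (.id (typed_pair _ _ zero_ne_one ..)) }
  braiding_naturality_right X Y Z f :=
    have h := (Ev.self f (.var 1 _))
    ext_pair
      ((Ev.tensorH (.id (.var 0 _)) h rfl (nd₂ zero_ne_one ..)).comp
        (.braidHom (.var 0 _) h.typed_right rfl (nd₂ zero_ne_one ..)))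
      ((Ev.braidHom (.var 0 _) (.var 1 _) rfl (nd₂ zero_ne_one ..)).comp
        (.tensorH h (.id (.var 0 _)) (add_comm ..) (nd₂ zero_ne_one ..)))
  braiding_naturality_left f Z :=
    have h := (Ev.self f (.var 0 _))
    ext_pair
      ((Ev.tensorH h (.id (.var 1 _)) rfl (nd₂ zero_ne_one ..)).comp
        (.braidHom h.typed_right (.var 1 _) rfl (nd₂ zero_ne_one ..)))
      ((Ev.braidHom (.var 0 _) (.var 1 _) rfl (nd₂ zero_ne_one ..)).comp
        (.tensorH (.id (.var 1 _)) h (add_comm ..) (nd₂ zero_ne_one ..)))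
  hexagon_forward X Y Z := by
    have n₃ := nd₃ X.ty Y.ty Z.ty
    have h₁ := Ev.assocHom (X := X) (Y := Y) (Z := Z) (.var 0 _) (.var 1 _) (.var 2 _) rfl n₃
    have h₂ := Ev.braidHom (X := X) (Y := tensorO Y Z) (.var 0 _) (typed_pair 1 2 (by simp) Y Z)
      (add_assoc ..).symm n₃
    have h₃ := Ev.assocHom (X := Y) (Y := Z) (Z := X) (.var 1 _) (.var 2 _) (.var 0 _)
      (show _ = {(0, X.ty)} + {(1, Y.ty)} + {(2, Z.ty)} by abel) n₃
    have k₁ := (Ev.braidHom (X := X) (Y := Y) (.var 0 _) (.var 1 _) rfl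
      (nd₂ zero_ne_one ..)).tensorH (.id (X := Z) (.var 2 _)) rfl n₃
    have k₂ := Ev.assocHom (X := Y) (Y := X) (Z := Z) (.var 1 _) (.var 0 _) (.var 2 _)
      (show _ = {(0, X.ty)} + {(1, Y.ty)} + {(2, Z.ty)} by abel) n₃
    have k₃ := (Ev.id (X := Y) (.var 1 _)).tensorH (Ev.braidHom (X := X) (Y := Z) (.var 0 _)
      (.var 2 _) rfl (nd₂ (by simp) ..))
      (show _ = {(0, X.ty)} + {(1, Y.ty)} + {(2, Z.ty)} by abel) n₃
    exact ext_left (h₁.comp (h₂.comp h₃)) (k₁.comp (k₂.comp k₃))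
  hexagon_reverse X Y Z := by
    have n₃ := nd₃ X.ty Y.ty Z.ty
    have h₁ := Ev.assocInv (X := X) (Y := Y) (Z := Z) (.var 0 _) (.var 1 _) (.var 2 _) rfl n₃
    have h₂ := Ev.braidHom (X := tensorO X Y) (Y := Z) (typed_pair 0 1 (by simp) X Y) (.var 2 _)
      rfl n₃
    have h₃ := Ev.assocInv (X := Z) (Y := X) (Z := Y) (.var 2 _) (.var 0 _) (.var 1 _)
      (show _ = {(0, X.ty)} + {(1, Y.ty)} + {(2, Z.ty)} by abel) n₃
    have k₁ := (Ev.id (X := X) (.var 0 _)).tensorH (Ev.braidHom (X := Y) (Y := Z) (.var 1 _)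
      (.var 2 _) rfl (nd₂ (by simp) ..)) (add_assoc ..).symm n₃
    have k₂ := Ev.assocInv (X := X) (Y := Z) (Z := Y) (.var 0 _) (.var 2 _) (.var 1 _)
      (show _ = {(0, X.ty)} + {(1, Y.ty)} + {(2, Z.ty)} by abel) n₃
    have k₃ := (Ev.braidHom (X := X) (Y := Z) (.var 0 _) (.var 2 _) rfl
      (nd₂ (by simp) ..)).tensorH (.id (X := Y) (.var 1 _))
      (show _ = {(0, X.ty)} + {(1, Y.ty)} + {(2, Z.ty)} by abel) n₃
    exact ext_right (h₁.comp (h₂.comp h₃)) (k₁.comp (k₂.comp k₃))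
  symmetry X Y := ext_pair
    ((Ev.braidHom (.var 0 _) (.var 1 _) rfl (nd₂ zero_ne_one ..)).comp
      (.braidHom (.var 1 _) (.var 0 _) (add_comm ..) (nd₂ zero_ne_one ..)))
    (.id (typed_pair _ _ zero_ne_one ..))

end Syn

end

section

open MCtx

variable {S : Signature.{u, w}} {V : Type x} [CommMonoid V] [CompleteLattice V] [IsQuantale V]
  {B : Set V} {Ax : Set (VEq S B)} {hAx : Varietal.{u, w, v, x} Ax}
  {m n k M : MCtx S} {a b c s t r s' t' : Tm S}

namespace Syn

variable {X Y Z W X' Y' : Syn hAx}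

/-! ### The closed structure -/

theorem typed_lam_plug (f : tensorO X Y ⟶ Z) (hs : MT m s Y.ty) :
    MT m (.lam X.ty (f.rep.plug (.tens (.var 0) (s.rename Nat.succ)))) (lolliO X Z).ty := by
  have e : {(0, X.ty)} + m.shift 1 = (0, X.ty) ::ₘ m.shift 1 := Multiset.singleton_add ..
  exact .lam (f.typed.plug (((MT.var 0 X.ty).tens (hs.rename_add 1)
    (e ▸ hs.nd.cons_shift X.ty)).cast e))

/-- The transpose with respect to the first factor. -/
noncomputable def curryH (f : tensorO X Y ⟶ Z) : Y ⟶ lolliO X Z :=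
  homMk _ (typed_lam_plug f (.var 0 _))

/-- The inverse of `curryH`. -/
noncomputable def uncurryH (g : Y ⟶ lolliO X Z) : tensorO X Y ⟶ Z :=
  lift (.tens (.var 0 X.ty) (.var 1 Y.ty)) rfl
    (((g.typed.plug (.var 1 _)).app (.var 0 _) (nd₂ one_ne_zero ..)).cast (add_comm ..))

theorem Ev.curryH {f : tensorO X Y ⟶ Z} (hs : MT m s Y.ty)
    (hf : Ev ((0, X.ty) ::ₘ m.shift 1) f (.tens (.var 0) (s.rename Nat.succ)) t) :
    Ev m (curryH f) s (.lam X.ty t) := by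
  refine .homMk _ hs ?_
  have : (Tm.lam X.ty (f.rep.plug (.tens (.var 0) ((Tm.var 0).rename Nat.succ)))).plug s =
      .lam X.ty (f.rep.plug (.tens (.var 0) (s.rename Nat.succ))) := by
    simp [Tm.plug, Tm.subst, Tm.subst_subst, Tm.rename, Tm.up]
  rw [this]
  exact .lam hf.eqv

theorem Ev.uncurryH {g : Y ⟶ lolliO X Z} (ha : MT m a X.ty) (hg : Ev n g b t) (hM : m + n = M)
    (hn : Nd M) : Ev M (uncurryH g) (.tens a b) (.app t a) := by
  have h := ev_lift₂ (hAx := hAx) (W := tensorO X Y) (Z := Z)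
    (((g.typed.plug (.var 1 _)).app (.var 0 _) (nd₂ one_ne_zero ..)).cast (add_comm ..)) rfl
    ha hg.typed hM hn
  refine h.congr (.refl h.typed) ?_
  subst hM
  rw [add_comm] at hn ⊢
  simp only [Tm.subst, Tm.plug_subst]
  exact hg.eqv.app (.refl ha) hn

/-- This is β for the abstraction that defines `curryH`: the substituted argument does not touch the
weakened `s`. -/
theorem eqv_app_lam {f : tensorO X Y ⟶ Z} (hs : MT m s Y.ty) (ha : MT n a X.ty)
    (hn : Nd (m + n)) :
    Eqv Ax (m + n) (.app (.lam X.ty (f.rep.plug (.tens (.var 0) (s.rename Nat.succ)))) a)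
      (f.rep.plug (.tens a s)) Z.ty := by
  have e : {(0, X.ty)} + m.shift 1 = (0, X.ty) ::ₘ m.shift 1 := Multiset.singleton_add ..
  have h := Eqv.lolli_beta (Ax := Ax) (f.typed.plug (((MT.var 0 X.ty).tens (hs.rename_add 1)
    (e ▸ hs.nd.cons_shift X.ty)).cast e)) ha hn
  have h' : (f.rep.plug (.tens (.var 0) (s.rename Nat.succ))).inst₁ a = f.rep.plug (.tens a s) := by
    rw [Tm.inst₁, Tm.plug_subst]
    simp only [Tm.subst, Tm.subst_rename]
    congr 2
    exact Tm.subst_var s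
  rwa [h'] at h

/-- Maps out of a tensor product correspond to maps into the internal hom. -/
noncomputable def curryEquiv (X Y Z : Syn hAx) : (tensorO X Y ⟶ Z) ≃ (Y ⟶ lolliO X Z) where
  toFun := curryH
  invFun := uncurryH
  -- One inverse law is β for `⊸`, the other is η.
  left_inv f := by
    have n₂ := nd₂ zero_ne_one X.ty Y.ty
    have hs : MT {(1, Y.ty)} (.var 1) Y.ty := .var 1 _
    have h := Ev.uncurryH (.var 0 _) (Ev.curryH hs (Ev.self f (((MT.var 0 X.ty).tens
      (hs.rename_add 1) (nd₂ (by simp) ..)).cast (Multiset.singleton_add ..)))) rfl n₂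
    refine ext_pair (h.congr (.refl h.typed) ?_) (Ev.self f (typed_pair _ _ zero_ne_one ..))
    rw [add_comm] at n₂ ⊢
    exact eqv_app_lam hs (.var 0 _) n₂
  right_inv g := by
    have hs : MT {(0, Y.ty)} (.var 0) Y.ty := .var 0 _
    have hs' : MT {(1, Y.ty)} (.var 1) Y.ty := .var 1 _
    have h := Ev.curryH hs ((Ev.uncurryH (.var 0 _) (Ev.self g hs') rfl
      (nd₂ zero_ne_one ..)).cast (Multiset.singleton_add ..))
    refine Hom.ext_var (h.congr (.refl h.typed) ?_) (Ev.self g hs)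
    have := Eqv.lolli_eta (Ax := Ax) (g.typed.plug hs)
    rwa [Tm.plug_rename] at this

theorem curryH_naturality (f : Y' ⟶ Y) (g : X ⊗ Y ⟶ Z) :
    curryH (X ◁ f ≫ g) = f ≫ curryH (X := X) (Y := Y) g := by
  have hs : MT {(0, Y'.ty)} (.var 0) Y'.ty := .var 0 _
  have hs' : MT {(1, Y'.ty)} (.var 1) Y'.ty := .var 1 _
  have h₁ := Ev.self f hs
  have h₂ := Ev.tensorH (.id (X := X) (.var 0 _)) (Ev.self f hs') rfl (nd₂ zero_ne_one ..)
  have h₃ := Ev.self g h₂.typed_right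
  refine Hom.ext_var (Ev.curryH hs ((h₂.comp h₃).cast (Multiset.singleton_add ..)))
    (h₁.comp (Ev.curryH h₁.typed_right ?_))
  rw [Tm.plug_rename]
  exact h₃.cast (Multiset.singleton_add ..)

/-- The right adjoint of `X ⊗ -`. -/
noncomputable def lolliFunctor (X : Syn hAx) : Syn hAx ⥤ Syn hAx :=
  Adjunction.rightAdjointOfEquiv (F := tensorLeft X) (G_obj := lolliO X) (curryEquiv X)
    fun _ _ _ f g => curryH_naturality f g

/-- The adjunction between `X ⊗ -` and the internal hom. -/
noncomputable def closedAdj (X : Syn hAx) : tensorLeft X ⊣ lolliFunctor X :=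
  Adjunction.adjunctionOfEquivRight (F := tensorLeft X) (G_obj := lolliO X) (curryEquiv X) fun _ _ _ f g => curryH_naturality f g

theorem closedAdj_homEquiv (X Y Z : Syn hAx) :
    (closedAdj X).homEquiv Y Z = curryEquiv X Y Z := by
  delta closedAdj Adjunction.adjunctionOfEquivRight
  exact congrFun (congrFun (Adjunction.mkOfHomEquiv_homEquiv _) Y) Z

noncomputable instance : MonoidalClosed (Syn hAx) where
  closed X := { rightAdj := lolliFunctor X, adj := closedAdj X }

/-- The closed structure is adjoint to tensoring on the left, whereas `transpose` abstracts the
right factor; hence the braiding. -/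
theorem transpose_eq_curryH (f : X ⊗ Y ⟶ Z) :
    VLam.transpose f = curryH ((β_ Y X).hom ≫ f) :=
  congrArg (fun e : (tensorO Y X ⟶ Z) ≃ (X ⟶ lolliO Y Z) => e ((β_ Y X).hom ≫ f))
    (closedAdj_homEquiv Y X Z)

theorem Ev.transpose {f : X ⊗ Y ⟶ Z} (hs : MT m s X.ty)
    (hf : Ev ((0, Y.ty) ::ₘ m.shift 1) f (.tens (s.rename Nat.succ) (.var 0)) t) :
    Ev m (transpose f) s (.lam Y.ty t) := by
  have e : m.shift 1 + {(0, Y.ty)} = (0, Y.ty) ::ₘ m.shift 1 := by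
    rw [add_comm, Multiset.singleton_add]
  rw [transpose_eq_curryH]
  refine Ev.curryH (f := (β_ Y X).hom ≫ f) hs (Ev.comp ?_ hf)
  exact Ev.braidHom (.var 0 _) (hs.rename_add 1) (Multiset.singleton_add ..)
    (hs.nd.cons_shift Y.ty)

theorem Ev.evalMap (hs : MT m s (lolliO X Y).ty) (ha : MT n a X.ty) (hM : m + n = M) (hn : Nd M) :
    Ev M (evalMap X Y) (.tens s a) (.app s a) := by
  have h : Ev M (Syn.uncurryH (𝟙 (lolliO X Y))) (.tens a s) (.app s a) :=
    Ev.uncurryH ha (.id hs) (by rw [add_comm, hM]) hn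
  have e : (ihom.ev X).app Y = Syn.uncurryH (𝟙 (lolliO X Y)) := rfl
  exact Ev.comp (Ev.braidHom hs ha hM hn) h

/-! ### The enrichment -/

/-- Together with `hom_le_D` this computes the distance of two morphisms from their values on any
pattern: evaluation never loses distance, and on a pattern it reflects it. -/
theorem D_le_hom {f g : X ⟶ Y} (P : Pat S) (hP : P.ty = X.ty) (h : Nd P.ctx)
    (hf : Ev P.ctx f P.tm t) (hg : Ev P.ctx g P.tm t') :
    D Ax P.ctx t t' Y.ty ≤ D Ax {(0, X.ty)} f.rep g.rep Y.ty := by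
  have := Pat.D_le (Ax := Ax) (C := Y.ty) h (hP.symm ▸ f.typed) (hP.symm ▸ g.typed)
  rw [hP] at this
  exact (D_le_of_eqv hf.eqv.symm hg.eqv.symm).trans this

theorem hom_le_D {f g : X ⟶ Y} (hf : Ev m f s t) (hg : Ev m g s t') :
    D Ax {(0, X.ty)} f.rep g.rep Y.ty ≤ D Ax m t t' Y.ty :=
  ((le_mul_of_one_le (one_le_D_self hf.typed)).trans
    (D_plug f.typed g.typed hf.typed.nd)).trans (D_le_of_eqv hf.eqv hg.eqv)

/-- The enrichment axioms are compatibility rules: substitution for composition, `⊗` for the tensor,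
abstraction for one half of `transpose_eq`, application for the other. -/
noncomputable instance : EnrichedAutonomous V (Syn hAx) where
  homV X Y :=
    { a f g := D Ax {(0, X.ty)} (Hom.rep f) (Hom.rep g) Y.ty
      one_le f := one_le_D_self (Hom.typed f)
      mul_le _ _ _ := D_trans }
  separated X Y f g h h' := by
    rw [← homMk_rep f, ← homMk_rep g]
    exact homMk_eq_homMk.2 ⟨Hom.typed f, Hom.typed g, h, h'⟩
  comp_le f f' g g' := by
    rw [mul_comm]
    exact (D_plug (Hom.typed g) (Hom.typed g') (by simp [Nd])).trans
      (D_le_of_eqv (rep_homMk ((Hom.typed g).plug (Hom.typed f))).symm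
        (rep_homMk ((Hom.typed g').plug (Hom.typed f'))).symm)
  tensor_le {X X' Y Y'} f f' g g' := by
    have n₂ := nd₂ zero_ne_one X.ty X'.ty
    have h (f : X ⟶ Y) (g : X' ⟶ Y') :=
      Ev.tensorH (Ev.self f (.var 0 _)) (Ev.self g (.var 1 _)) rfl n₂
    refine le_trans ?_ (D_le_hom (X := tensorO X X') (Y := tensorO Y Y')
      (.tens (.var 0 X.ty) (.var 1 X'.ty)) rfl n₂ (h f g) (h f' g'))
    exact (mul_le_mul' (hom_le_D (Ev.self f (.var 0 _)) (Ev.self f' (.var 0 _)))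
      (hom_le_D (Ev.self g (.var 1 _)) (Ev.self g' (.var 1 _)))).trans (D_tens n₂)
  transpose_eq {X Y Z} f g := by
    have hs : MT {(0, X.ty)} (.var 0) X.ty := .var 0 _
    have n₂ : Nd ({(1, X.ty)} + {(0, Y.ty)}) := nd₂ one_ne_zero ..
    have e : {(1, X.ty)} + {(0, Y.ty)} = (0, Y.ty) ::ₘ MCtx.shift 1 {(0, X.ty)} := by
      rw [add_comm, Multiset.singleton_add]; rfl
    have h (f : X ⊗ Y ⟶ Z) := (Ev.self f (typed_pair 1 0 one_ne_zero X Y)).cast e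
    have h' (f : X ⊗ Y ⟶ Z) := Ev.transpose hs (h f)
    refine le_antisymm ?_ ?_
    -- By β, `f` is recovered on a pair by applying its transpose, so `D_app` bounds the distance of
    -- the transposes by that of the original maps.
    · have k (f : X ⊗ Y ⟶ Z) : Ev ({(0, X.ty)} + {(1, Y.ty)}) f (.tens (.var 0) (.var 1))
          (.app ((transpose f).rep.plug (.var 0)) (.var 1)) := by
        have n₂' := nd₂ zero_ne_one X.ty Y.ty
        have h₁ := (Ev.braidHom (X := Y) (Y := X) (.var 1 _) (.var 0 _) (add_comm ..) n₂').comp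
          (Ev.self f (typed_pair _ _ zero_ne_one X Y))
        have hs' : MT {(1, X.ty)} ((Tm.var 0).rename Nat.succ) X.ty := .var 1 _
        have h₂ := Ev.curryH (X := Y) hs ((Ev.self ((β_ Y X).hom ≫ f) ((MT.var 0 Y.ty).tens hs'
          (nd₂ zero_ne_one ..))).cast (Multiset.singleton_add ..))
        rw [← transpose_eq_curryH] at h₂
        have h₃ := eqv_app_lam (f := (β_ Y X).hom ≫ f) hs (MT.var 1 Y.ty) n₂'
        refine (Ev.self f (typed_pair _ _ zero_ne_one X Y)).congr
          (.refl (typed_pair _ _ zero_ne_one X Y)) ?_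
        exact ((h₂.eqv.app (.refl (.var 1 _)) n₂').trans (h₃.trans h₁.eqv)).symm
      refine le_trans ?_ (D_le_hom (X := tensorO X Y) (Y := Z)
        (.tens (.var 0 X.ty) (.var 1 Y.ty)) rfl (nd₂ zero_ne_one ..) (k f) (k g))
      exact ((hom_le_D (Ev.self _ hs) (Ev.self _ hs)).trans
        (le_mul_of_one_le (one_le_D_self (.var 1 _)))).trans (D_app (nd₂ zero_ne_one ..))
    · exact (hom_le_D (h f) (h g)).trans (D_lam.trans
        (D_le_hom (X := X) (Y := lolliO Y Z) (.var 0 X.ty) rfl (by simp [Nd, Pat.ctx])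
          (h' f) (h' g)))

end Syn

end

section

open MCtx

variable {S : Signature.{u, w}} {V : Type x} [CommMonoid V] [CompleteLattice V] [IsQuantale V]
  {B : Set V} {Ax : Set (VEq S B)} {hAx : Varietal.{u, w, v, x} Ax}
  {m n k M : MCtx S} {a b c s t r s' t' : Tm S}

namespace Syn

variable {X Y Z W X' Y' : Syn hAx}

/-! ### Elements under elimination -/

theorem Ev.whiskerRight {f : X ⟶ Y} (hf : Ev m f a t) (hb : MT n b Z.ty) (hM : m + n = M)
    (hn : Nd M) : Ev M (f ▷ Z) (.tens a b) (.tens t b) :=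
  Ev.tensorH hf (.id hb) hM hn

theorem Ev.whiskerLeft {f : X ⟶ Y} (hb : MT m b Z.ty) (hf : Ev n f a t) (hM : m + n = M)
    (hn : Nd M) : Ev M (Z ◁ f) (.tens b a) (.tens b t) :=
  Ev.tensorH (.id hb) hf hM hn

/-- The η law, applied to `h` at `z ⊗ b` with `z` fresh, acts as a commuting conversion: the value
at `s ⊗ b` is `s to ∗.` followed by the value at `∗ ⊗ b`. -/
theorem Ev.unitE {h : 𝟙_ (Syn hAx) ⊗ Y ⟶ Z} (hs : MT m s .unit) (ht : Ev n h (.tens .star b) t)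
    (hb : MT n b Y.ty) (hM : m + n = M) (hn : Nd M) : Ev M h (.tens s b) (.unitE s t) := by
  subst hM
  obtain ⟨z, hz⟩ := exists_bound n
  have hz' : z ∉ n.map Prod.fst := fun H => by
    obtain ⟨p, hp, e⟩ := Multiset.mem_map.1 H
    exact absurd (hz p hp) (e ▸ lt_irrefl _)
  have hnz : Nd ((z, .unit) ::ₘ n) := nd_cons.2 ⟨hz', hb.nd⟩
  have e : {(z, .unit)} + n = (z, .unit) ::ₘ n := Multiset.singleton_add ..
  have H := Eqv.unit_eta (Ax := Ax) (z := z) hs (h.typed.plug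
    (((MT.var z .unit).tens hb (e ▸ hnz)).cast e)) (by rwa [add_comm])
  have hsub : ∀ r : Tm S, (h.rep.plug (.tens (.var z) b)).sub z r = h.rep.plug (.tens r b) := by
    intro r
    have := hb.sub_eq_self hz' r
    rw [Tm.sub] at this ⊢
    simp [Tm.plug_subst, Tm.subst, this]
  rw [hsub, hsub, add_comm] at H
  exact ⟨hs.tens hb hn, H.symm.trans ((Eqv.refl hs).unitE ht.eqv hn)⟩

/-- The analogue of `Ev.unitE` for pairs: η for `⊗` reduces the value at `s ⊗ b` to the value at a
pair of bound variables. -/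
theorem Ev.pm {h : (X ⊗ Y) ⊗ W ⟶ Z} {A A' : Ty S.Ground} (hX : X.ty = A) (hY : Y.ty = A')
    (hs : MT m s (.tensor A A')) (hb : MT n b W.ty)
    (ht : Ev ((0, A') ::ₘ (1, A) ::ₘ n.shift 2) h
      (.tens (.tens (.var 1) (.var 0)) (b.rename (· + 2))) t)
    (hM : m + n = M) (hn : Nd M) : Ev M h (.tens s b) (.pm s t) := by
  subst hM hX hY
  obtain ⟨z, hz⟩ := exists_bound n
  have hz' : z ∉ n.map Prod.fst := fun H => by
    obtain ⟨p, hp, e⟩ := Multiset.mem_map.1 H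
    exact absurd (hz p hp) (e ▸ lt_irrefl _)
  have hnz : Nd ((z, .tensor X.ty Y.ty) ::ₘ n) := nd_cons.2 ⟨hz', hb.nd⟩
  have e : {(z, .tensor X.ty Y.ty)} + n = (z, .tensor X.ty Y.ty) ::ₘ n :=
    Multiset.singleton_add ..
  have H := Eqv.tens_eta (Ax := Ax) (z := z) hs (h.typed.plug
    (((MT.var z _).tens hb (e ▸ hnz)).cast e)) (by rwa [add_comm])
  have h₁ : (h.rep.plug (.tens (.var z) b)).sub z s = h.rep.plug (.tens s b) := by
    have := hb.sub_eq_self hz' s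
    rw [Tm.sub] at this ⊢
    simp [Tm.plug_subst, Tm.subst, this]
  have h₂ : (h.rep.plug (.tens (.var z) b)).subUnder₂ z (.tens (.var 1) (.var 0)) =
      h.rep.plug (.tens (.tens (.var 1) (.var 0)) (b.rename (· + 2))) := by
    have : b.subst (fun j => if j = z then .tens (.var 1) (.var 0) else .var (j + 2)) =
        b.rename (· + 2) := by
      rw [Tm.rename_eq_subst]
      exact hb.subst_congr fun q hq => if_neg fun E => hz' (Multiset.mem_map.2 ⟨_, hq, E⟩)
    rw [Tm.subUnder₂]
    simp [Tm.plug_subst, Tm.subst, this]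
  rw [h₁, h₂, add_comm] at H
  exact ⟨hs.tens hb hn, H.symm.trans ((Eqv.refl hs).pm ht.eqv hn)⟩

theorem Ev.eqToHom (h : X = Y) (hs : MT m s X.ty) : Ev m (eqToHom h) s s := by
  subst h
  exact .id hs

/-! ### Tuples -/

/-- The `n`-tuple `(… (v₁ ⊗ v₂) ⊗ …) ⊗ vₙ`. -/
def nTm : (n : ℕ) → (Fin n → Tm S) → Tm S
  | 0, _ => .star
  | 1, vs => vs 0
  | n + 2, vs => .tens (nTm (n + 1) fun i => vs i.castSucc) (vs (Fin.last (n + 1)))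

/-- The pattern `(… (P₁ ⊗ P₂) ⊗ …) ⊗ Pₙ`. -/
def nPat : (n : ℕ) → (Fin n → Pat S) → Pat S
  | 0, _ => .unit
  | 1, P => P 0
  | n + 2, P => .tens (nPat (n + 1) fun i => P i.castSucc) (P (Fin.last (n + 1)))

theorem nPat_tm : ∀ (n : ℕ) (P : Fin n → Pat S), (nPat n P).tm = nTm n fun i => (P i).tm
  | 0, _ => rfl
  | 1, _ => rfl
  | n + 2, P => congrArg (Tm.tens · _) (nPat_tm (n + 1) fun i => P i.castSucc)

theorem nPat_ctx : ∀ (n : ℕ) (P : Fin n → Pat S), (nPat n P).ctx = ∑ i, (P i).ctx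
  | 0, _ => rfl
  | 1, P => by simp [nPat]
  | n + 2, P => by
    rw [Fin.sum_univ_castSucc, ← nPat_ctx (n + 1) fun i => P i.castSucc]; rfl

theorem nPat_ty : ∀ (n : ℕ) (P : Fin n → Pat S) (X : Fin n → Syn hAx),
    (∀ i, (P i).ty = (X i).ty) → (nPat n P).ty = (nTensor n X).ty
  | 0, _, _, _ => rfl
  | 1, _, _, h => h 0
  | n + 2, P, X, h => congrArg₂ Ty.tensor
      (nPat_ty (n + 1) (fun i => P i.castSucc) (fun i => X i.castSucc) fun i => h i.castSucc)
      (h (Fin.last (n + 1)))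

theorem nTm_subst (σ : ℕ → Tm S) : ∀ (n : ℕ) (vs : Fin n → Tm S),
    (nTm n vs).subst σ = nTm n fun i => (vs i).subst σ
  | 0, _ => rfl
  | 1, _ => rfl
  | n + 2, vs => congrArg (Tm.tens · _) (nTm_subst σ (n + 1) fun i => vs i.castSucc)

theorem Ev.nTensorMap : ∀ (n : ℕ) {X Y : Fin n → Syn hAx} {f : ∀ i, X i ⟶ Y i}
    {ms : Fin n → MCtx S} {ss ts : Fin n → Tm S}, (∀ i, Ev (ms i) (f i) (ss i) (ts i)) →
    Nd (∑ i, ms i) → Ev (∑ i, ms i) (nTensorMap n f) (nTm n ss) (nTm n ts)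
  | 0, _, _, _, _, _, _, _, _ => .id MT.star
  | 1, _, _, _, ms, _, _, h, _ => (h 0).cast (by simp)
  | n + 2, _, _, _, ms, _, _, h, hn => by
    rw [Fin.sum_univ_castSucc] at hn ⊢
    exact Ev.tensorH (Ev.nTensorMap (n + 1) (fun i => h i.castSucc) hn.left) (h _) rfl hn

/-! ### The canonical interpretation -/

/-- The interpretation of the ground types by themselves. -/
def ground (X : S.Ground) : Syn hAx := ⟨.base X⟩

/-- Types are interpreted by themselves, but for a variable type only up to a propositional
equality, along which typings have to be transported. -/
theorem tyObj_ty : ∀ A : Ty S.Ground, (tyObj (ground (hAx := hAx)) A).ty = A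
  | .base _ => rfl
  | .unit => rfl
  | .tensor A A' => congrArg₂ Ty.tensor (tyObj_ty A) (tyObj_ty A')
  | .lolli A A' => congrArg₂ Ty.lolli (tyObj_ty A) (tyObj_ty A')

/-- The pattern of the arguments of an operation symbol. -/
def opPat (f : S.Op) : Pat S := nPat (S.arity f) fun i => .var i (S.dom f i)

theorem opPat_ctx (f : S.Op) : (opPat f).ctx = ∑ i : Fin (S.arity f), {((i : ℕ), S.dom f i)} :=
  nPat_ctx ..

theorem opPat_tm (f : S.Op) : (opPat f).tm = nTm (S.arity f) fun i => .var i := nPat_tm ..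

theorem opPat_typed (f : S.Op) :
    MT (opPat f).ctx (.op f fun i => .var i) (tyObj (ground (hAx := hAx)) (S.cod f)).ty := by
  rw [opPat_ctx, tyObj_ty]
  refine .op f (fun i => .var _ _) ?_
  have e : ∑ i : Fin (S.arity f), {((i : ℕ), S.dom f i)} =
      Multiset.map (fun i : Fin (S.arity f) => ((i : ℕ), S.dom f i)) Finset.univ.val := by
    rw [← Multiset.sum_map_singleton (Multiset.map _ _), Multiset.map_map]
    rfl
  rw [Nd, e, Multiset.map_map]
  exact Finset.univ.nodup.map Fin.val_injective

/-- The canonical interpretation in the syntactic category. -/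
noncomputable def interp (hAx : Varietal.{u, w, v, x} Ax) : Interp S (Syn hAx) where
  ground := ground
  op f := lift (opPat f) (nPat_ty _ _ _ fun i => (tyObj_ty (S.dom f i)).symm) (opPat_typed f)

theorem Ev.op (f : S.Op) {ms : Fin (S.arity f) → MCtx S} {vs : Fin (S.arity f) → Tm S}
    (h : ∀ i, MT (ms i) (vs i) (S.dom f i)) (hn : Nd (∑ i, ms i)) :
    Ev (∑ i, ms i) ((interp hAx).op f) (nTm _ vs) (.op f vs) := by
  -- The defaults `∗` and the empty context are never reached: the variables of `opPat f` are
  -- exactly those below the arity.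
  let σ : ℕ → Tm S := fun j => if h : j < S.arity f then vs ⟨j, h⟩ else .star
  let Δ : ℕ × Ty S.Ground → MCtx S := fun p => if h : p.1 < S.arity f then ms ⟨p.1, h⟩ else 0
  have e : (opPat f).ctx.bind Δ = ∑ i, ms i := by
    rw [opPat_ctx]
    refine (map_sum (⟨⟨fun m : MCtx S => m.bind Δ, Multiset.zero_bind _⟩,
      fun a b => Multiset.add_bind a b Δ⟩ : MCtx S →+ MCtx S) _ _).trans ?_
    simp [Δ]
  have H := ev_lift (hAx := hAx) (opPat f) (nPat_ty _ _ _ fun i => (tyObj_ty (S.dom f i)).symm)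
    (opPat_typed f) (σ := σ) (Δ := Δ) ?_ (e ▸ hn)
  · rw [e, opPat_tm, nTm_subst] at H
    simp only [Tm.subst, σ, Fin.is_lt, dite_true, Fin.eta] at H
    exact H
  · intro p hp
    rw [opPat_ctx] at hp
    obtain ⟨i, _, hi⟩ := Multiset.mem_sum.1 hp
    rw [Multiset.mem_singleton.1 hi]
    simpa [σ, Δ] using h i

/-! ### Contexts as tuples of variables -/

/-- The pattern of the variables of a context. -/
def ctxPat : Ctx S → Pat S
  | [] => .unit
  | [p] => .var p.1 p.2
  | p :: q :: Γ => .tens (ctxPat (q :: Γ)) (.var p.1 p.2)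

theorem ctxPat_ctx : ∀ Γ : Ctx S, (ctxPat Γ).ctx = Γ
  | [] => rfl
  | [p] => rfl
  | p :: q :: Γ => by
    rw [ctxPat, Pat.ctx, ctxPat_ctx (q :: Γ), add_comm]
    exact Multiset.singleton_add ..

theorem ctxPat_ty : ∀ Γ : Ctx S, (ctxPat Γ).ty = ((interp hAx).ctx Γ).ty
  | [] => rfl
  | [p] => (tyObj_ty p.2).symm
  | p :: q :: Γ => congrArg₂ Ty.tensor (ctxPat_ty (q :: Γ)) (tyObj_ty p.2).symm

/-- The tuple of the variables of a context. -/
def tup (Γ : Ctx S) : Tm S := (ctxPat Γ).tm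

theorem tup_typed {Γ : Ctx S} (h : Γ.Valid) : MT (Γ : MCtx S) (tup Γ) ((interp hAx).ctx Γ).ty := by
  have := Pat.typed (P := ctxPat Γ) (by rw [ctxPat_ctx]; exact nd_coe.2 h)
  rwa [ctxPat_ctx, ctxPat_ty (hAx := hAx)] at this

theorem tup_shift (k : ℕ) : ∀ Γ : Ctx S, tup (Γ.shift k) = (tup Γ).rename (· + k)
  | [] => rfl
  | [_] => rfl
  | p :: q :: Γ => congrArg (Tm.tens · (.var (p.1 + k))) (tup_shift k (q :: Γ))

theorem var_typed (i : ℕ) (A : Ty S.Ground) : MT {(i, A)} (.var i) ((interp hAx).ty A).ty := by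
  have h : ((interp hAx).ty A).ty = A := tyObj_ty A
  rw [h]
  exact .var i A

theorem coe_add_singleton (p : ℕ × Ty S.Ground) (Γ : Ctx S) :
    (Γ : MCtx S) + {p} = ((p :: Γ : Ctx S) : MCtx S) := by
  rw [add_comm]
  exact Multiset.singleton_add ..

theorem ev_snocIso_hom (p : ℕ × Ty S.Ground) : ∀ {Γ : Ctx S}, Ctx.Valid (p :: Γ) →
    Ev ((p :: Γ : Ctx S) : MCtx S) ((interp hAx).snocIso p Γ).hom (tup (p :: Γ))
      (.tens (tup Γ) (.var p.1))
  | [], _ => Ev.leftInv (var_typed p.1 p.2)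
  | _ :: _, h => .id (tup_typed h)

theorem ev_snocIso_inv (p : ℕ × Ty S.Ground) : ∀ {Γ : Ctx S}, Ctx.Valid (p :: Γ) →
    Ev ((p :: Γ : Ctx S) : MCtx S) ((interp hAx).snocIso p Γ).inv (.tens (tup Γ) (.var p.1))
      (tup (p :: Γ))
  | [], _ => Ev.leftHom (var_typed p.1 p.2)
  | _ :: _, h => .id (tup_typed h)

/-- The structural isomorphisms only regroup and permute the variables; the tuple is followed
through the composite by induction on the shuffle. -/
theorem ev_split {Γ Δ E : Ctx S} (s : Shuffle Γ Δ E) : E.Valid →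
    Ev (E : MCtx S) ((interp hAx).split s) (tup E) (.tens (tup Γ) (tup Δ)) := by
  induction s with
  | nil => exact fun _ => Ev.leftInv MT.star
  | @left p Γ Δ E s ih =>
    intro h
    have hn : Nd ((p :: E : Ctx S) : MCtx S) := nd_coe.2 h
    have eE := s.coe_eq
    have e : (Γ : MCtx S) + Δ + {p} = ((p :: E : Ctx S) : MCtx S) := by
      rw [← eE, coe_add_singleton]
    have e' : (Γ : MCtx S) + {p} + Δ = ((p :: E : Ctx S) : MCtx S) := by
      rw [← e]; abel
    have hn' := e' ▸ hn
    have hΓ : MT (Γ : MCtx S) (tup Γ) ((interp hAx).ctx Γ).ty :=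
      tup_typed (nd_coe.1 hn'.left.left)
    have hΔ : MT (Δ : MCtx S) (tup Δ) ((interp hAx).ctx Δ).ty := tup_typed (nd_coe.1 hn'.right)
    have hp : MT {p} (.var p.1) ((interp hAx).ty p.2).ty := var_typed p.1 p.2
    have hpΔ : Nd ((Δ : MCtx S) + {p}) := by
      rw [← e, add_assoc] at hn
      exact hn.right
    have hpΓ : Ctx.Valid (p :: Γ) := nd_coe.1 (coe_add_singleton p Γ ▸ hn'.left)
    exact (ev_snocIso_hom p h).comp (((ih h.of_cons).whiskerRight hp (coe_add_singleton ..) hn).comp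
      ((Ev.assocHom hΓ hΔ hp e hn).comp
      ((Ev.whiskerLeft hΓ (Ev.braidHom hΔ hp rfl hpΔ) (by rw [← add_assoc, e]) hn).comp
      ((Ev.assocInv hΓ hp hΔ e' hn).comp
      ((ev_snocIso_inv p hpΓ).whiskerRight hΔ (by rw [← coe_add_singleton, e']) hn)))))
  | @right p Γ Δ E s ih =>
    intro h
    have hn : Nd ((p :: E : Ctx S) : MCtx S) := nd_coe.2 h
    have eE := s.coe_eq
    have e : (Γ : MCtx S) + Δ + {p} = ((p :: E : Ctx S) : MCtx S) := by
      rw [← eE, coe_add_singleton]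
    have hn' := e ▸ hn
    have hΓ : MT (Γ : MCtx S) (tup Γ) ((interp hAx).ctx Γ).ty :=
      tup_typed (nd_coe.1 hn'.left.left)
    have hΔ : MT (Δ : MCtx S) (tup Δ) ((interp hAx).ctx Δ).ty :=
      tup_typed (nd_coe.1 hn'.left.right)
    have hp : MT {p} (.var p.1) ((interp hAx).ty p.2).ty := var_typed p.1 p.2
    have hpΔ : Ctx.Valid (p :: Δ) := by
      rw [add_assoc, coe_add_singleton] at hn'
      exact nd_coe.1 hn'.right
    exact (ev_snocIso_hom p h).comp (((ih h.of_cons).whiskerRight hp (coe_add_singleton ..) hn).comp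
      ((Ev.assocHom hΓ hΔ hp e hn).comp
      (Ev.whiskerLeft hΓ (ev_snocIso_inv p hpΔ)
        (by rw [← coe_add_singleton, ← add_assoc, e]) hn)))

theorem ev_splitN {n : ℕ} {Γs : Fin n → Ctx S} {E : Ctx S} (s : ShuffleN Γs E) : E.Valid →
    Ev (E : MCtx S) ((interp hAx).splitN s) (tup E) (nTm n fun i => tup (Γs i)) := by
  induction s with
  | nil Γs => exact fun _ => .id MT.star
  | one Γs => exact fun h => .id (tup_typed h)
  | snoc Γs s s' ih =>
    intro h
    have hn := s'.coe_eq ▸ nd_coe.2 h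
    exact (ev_split s' h).comp ((ih (nd_coe.1 hn.left)).whiskerRight
      (tup_typed (nd_coe.1 hn.right)) s'.coe_eq.symm (nd_coe.2 h))

theorem ev_shiftIso_inv (k : ℕ) (Γ : Ctx S) (hs : MT m s ((interp hAx).ctx Γ).ty) :
    Ev m ((interp hAx).shiftIso k Γ).inv s s := 
  Ev.eqToHom ((interp hAx).ctx_shift k Γ).symm hs

end Syn

end

/-! ### Denotations in the syntactic model -/

section

open MCtx

variable {S : Signature.{u, w}} {V : Type x} [CommMonoid V] [CompleteLattice V] [IsQuantale V]
  {B : Set V} {Ax : Set (VEq S B)} {hAx : Varietal.{u, w, v, x} Ax}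

namespace Syn

/-- The denotation of a judgement takes the tuple of the variables to the term. -/
theorem ev_den {Γ : Ctx S} {v : Tm S} {A : Ty S.Ground} (d : Der Γ v A) :
    Ev (Γ : MCtx S) ((interp hAx).den d) (tup Γ) v := by
  have ty_eq : ∀ A, ((interp hAx).ty A).ty = A := tyObj_ty
  induction d with
  | hyp n A => exact .id (var_typed n A)
  | op f Γs vs d s hE ih =>
    have hn := s.coe_eq ▸ nd_coe.2 hE
    exact (ev_splitN s hE).comp (((Ev.nTensorMap _ ih hn).comp
      (Ev.op f (fun i => .of_typed ⟨d i⟩) hn)).cast s.coe_eq.symm)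
  | unitI => exact .id MT.star
  | @unitE Γ Δ E v t A d e s hE ih ih' =>
    have hn := s.coe_eq ▸ nd_coe.2 hE
    have hΔ : MT (Δ : MCtx S) (tup Δ) ((interp hAx).ctx Δ).ty := tup_typed e.valid
    exact (ev_split s hE).comp ((ih.whiskerRight hΔ s.coe_eq.symm (nd_coe.2 hE)).comp
      (Ev.unitE (.of_typed ⟨d⟩) ((Ev.leftHom hΔ).comp ih') hΔ s.coe_eq.symm (nd_coe.2 hE)))
  | tensI d e s hE ih ih' =>
    exact (ev_split s hE).comp (Ev.tensorH ih ih' s.coe_eq.symm (nd_coe.2 hE))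
  | @tensE Γ Δ E v t A A' C d e s hE ih ih' =>
    have hΔv : Δ.Valid := nd_coe.1 (s.coe_eq ▸ nd_coe.2 hE).right
    have hΔ : MT (Δ : MCtx S) (tup Δ) ((interp hAx).ctx Δ).ty := tup_typed hΔv
    refine (ev_split s hE).comp ((ih.whiskerRight hΔ s.coe_eq.symm (nd_coe.2 hE)).comp
      (Ev.pm (ty_eq A) (ty_eq A') (.of_typed ⟨d⟩) hΔ ?_ s.coe_eq.symm (nd_coe.2 hE)))
    have hv₀ := e.valid
    have hv₁ : Ctx.Valid ((1, A) :: Δ.shift 2) := hv₀.of_cons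
    have h₁ : MT {(1, A)} (.var 1) ((interp hAx).ty A).ty := var_typed 1 A
    have h₀ : MT {(0, A')} (.var 0) ((interp hAx).ty A').ty := var_typed 0 A'
    have hs : MT ((Ctx.shift 2 Δ : Ctx S) : MCtx S) (tup (Δ.shift 2)) ((interp hAx).ctx Δ).ty := by
      rw [tup_shift]; exact hΔ.rename_add 2
    have hs' : MT ((Ctx.shift 2 Δ : Ctx S) : MCtx S) (tup (Δ.shift 2))
      ((interp hAx).ctx (Δ.shift 2)).ty := tup_typed hv₁.of_cons
    have e₁ := coe_add_singleton (1, A) (Δ.shift 2)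
    have e₀ := coe_add_singleton (0, A') ((1, A) :: Δ.shift 2)
    have e₂ : ((Ctx.shift 2 Δ : Ctx S) : MCtx S) + {(1, A)} + {(0, A')} =
      (((0, A') :: (1, A) :: Δ.shift 2 : Ctx S) : MCtx S) := by rw [e₁, e₀]
    have hn := nd_coe.2 hv₀
    have hp := h₁.tens h₀ (nd₂ one_ne_zero ..)
    rw [← tup_shift]
    exact (Ev.braidHom hp hs (by rw [← e₂]; abel) hn).comp
      ((Ev.assocInv hs h₁ h₀ e₂ hn).comp
      ((((ev_shiftIso_inv 2 Δ hs).whiskerRight h₁ e₁ (nd_coe.2 hv₁)).whiskerRight h₀ e₀ hn).comp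
      (((ev_snocIso_inv (1, A) hv₁).whiskerRight h₀ e₀ hn).comp
      ((ev_snocIso_inv (0, A') hv₀).comp ih'))))
  | @lolliI Γ v A A' d ih =>
    have hv₀ := d.valid
    have hΓ : MT (Γ : MCtx S) (tup Γ) ((interp hAx).ctx Γ).ty := tup_typed (Der.lolliI d).valid
    have h₀ : MT {(0, A)} (.var 0) ((interp hAx).ty A).ty := var_typed 0 A
    have hs : MT ((Ctx.shift 1 Γ : Ctx S) : MCtx S) (tup (Γ.shift 1)) ((interp hAx).ctx Γ).ty := by
      rw [tup_shift]; exact hΓ.rename_add 1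
    have H := ((ev_shiftIso_inv 1 Γ hs).whiskerRight h₀ (coe_add_singleton ..)
      (nd_coe.2 hv₀)).comp ((ev_snocIso_inv (0, A) hv₀).comp ih)
    rw [tup_shift] at H
    -- The abstraction produced here is annotated with the type of the object `⟦A⟧`, which `ty_eq`
    -- identifies with `A` before and after the step.
    have H' := Ev.transpose (Y := (interp hAx).ty A) hΓ (t := v) (f := _) (by
      rw [ty_eq]; exact H)
    rw [ty_eq] at H'
    exact H'
  | @lolliE Γ Δ E v t A A' d e s hE ih ih' =>
    refine (ev_split s hE).comp ((Ev.tensorH ih ih' s.coe_eq.symm (nd_coe.2 hE)).comp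
      (Ev.evalMap ih.typed_right ih'.typed_right s.coe_eq.symm (nd_coe.2 hE)))

/-- The denotations take the values `v` and `t` on the tuple of variables, and that tuple is a
pattern, so evaluating there preserves the distance exactly. -/
theorem homV_den {Γ : Ctx S} {v t : Tm S} {A : Ty S.Ground} (d : Der Γ v A) (d' : Der Γ t A) :
    (EnrichedAutonomous.homV (V := V) ((interp hAx).ctx Γ) ((interp hAx).ty A)).a
      ((interp hAx).den d) ((interp hAx).den d') = sSup {q | Thm Ax Γ v q t A} := by
  have ty_eq : ((interp hAx).ty A).ty = A := tyObj_ty A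
  have h := ev_den (hAx := hAx) d
  have h' := ev_den (hAx := hAx) d'
  have e : sSup {q | Thm Ax Γ v q t A} = D Ax (Γ : MCtx S) v t ((interp hAx).ty A).ty := by
    rw [ty_eq, D_coe]
  rw [e]
  refine le_antisymm (hom_le_D h h') ?_
  have hc := ctxPat_ctx Γ
  have := D_le_hom (ctxPat Γ) (ctxPat_ty Γ) (by rw [hc]; exact nd_coe.2 d.valid)
    (h.cast hc.symm) (h'.cast hc.symm)
  rwa [hc] at this

theorem isModel_interp (hAx : Varietal.{u, w, v, x} Ax) : (interp hAx).IsModel Ax := by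
  intro e he d d'
  rw [homV_den]
  exact le_sSup (.ax e he)

end Syn

end

end VLam

/-! ### Approximate completeness -/

theorem mainTheorem8 {V : Type x} [CommMonoid V] [CompleteLattice V] [IsQuantale V]
    (hV : (1 : V) = ⊤) {B : Set V} (hB : IsLabelBasis B)
    (S : Signature.{u, w}) (Ax : Set (VEq S B)) (hAx : Varietal.{u, w, v, x} Ax)
    (e : VEq S B)
    (he : ∀ (C : Type u) [Category.{v} C] [MonoidalCategory C] [SymmetricCategory C]
      [MonoidalClosed C] [EnrichedAutonomous V C] (M : Interp S C),
      M.IsModel Ax → M.Satisfies e) :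
    (∀ r ∈ B, WayBelow r e.label → Thm Ax e.ctx e.lhs r e.rhs e.ty) ∧
    (WayBelow e.label e.label → Thm Ax e.ctx e.lhs e.label e.rhs e.ty) := by
  have key : ∀ r ∈ B, WayBelow r e.label → Thm Ax e.ctx e.lhs r e.rhs e.ty := by
    intro r hr hre
    obtain ⟨d⟩ := e.lhs_typed
    obtain ⟨d'⟩ := e.rhs_typed
    have h := he (Syn hAx) (Syn.interp hAx) (Syn.isModel_interp hAx) d d'
    rw [Syn.homV_den] at h
    -- Validity in the syntactic model bounds the label by the join of the provable labels; the
    -- way-below relation extracts finitely many of them, to which the finite join rule applies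
    -- before weakening to `r`.
    obtain ⟨A, hA, hfin, hle⟩ := hre _ h
    obtain ⟨n, q, -, rfl⟩ := hfin.fin_param
    refine .weak (.join ⟨d⟩ ⟨d'⟩ fun i => hA ⟨i, rfl⟩) hr ?_
    rwa [sSup_range] at hle
  exact ⟨key, key _ e.label_mem⟩
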